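/- **Model.** Fix constants $\lambda_B,\lambda_u,A_B,A_D,P_B,P_0,P_d,\beta>0$, $\alpha_B,\alpha_D>2$, $\sigma_B,\sigma_D\ge 0$, $\varepsilon\in(0,1]$, $\eta_d\ge 0$, and put $\kappa=-\ln 10/10$. A link with shadowing $\xi$ (in dB) has fading coefficient $\mathcal H=e^{\kappa\xi}$, where $\xi\sim N(0,\sigma_B^2)$ for cellular links and $\xi\sim N(0,\sigma_D^2)$ for D2D links; a link of length $R$ has equivalent distance $\overline R=\mathcal H^{-1/\alpha}R$, with $\alpha=\alpha_B$ or $\alpha_D$ respectively. All marks mentioned below are i.i.d. over the points and independent of the points. *Mode selection.* Base stations form a homogeneous Poisson point process (PPP) of intensity $\lambda_B$ in $\mathbb R^2$, with i.i.d. shadowings to a typical user at the origin. The typical user is in cellular mode if the largest received power $P^*=\max_b A_BP_B\mathcal H_B(b)R_b^{-\alpha_B}$ exceeds $\beta$; let $q=\Pr[P^*>\beta]$, and let $\overline R_i$ be its equivalent distance to the strongest base station, conditioned on cellular mode. With $t=(\beta/(A_BP_B))^{-1/\alpha_B}$ and $e_B=\exp(2\kappa^2\sigma_B^2/\alpha_B^2)$,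 $$q=1-\exp\!\Big(-\pi\lambda_B\big(\tfrac{A_BP_B}{\beta}\big)^{2/\alpha_B}e_B\Big),\qquad f_{\overline R_i}(\rho)=\frac{2\pi\lambda_Be_B\,\rho\,e^{-\pi\lambda_Be_B\rho^2}}{q}\quad(0<\rho<t).$$ *Interferers.* The active cellular users form a PPP $\phi_c$ of intensity $\lambda_B$; the $i$-th one has a cellular shadowing to the origin and, independently, an equivalent distance $\rho_i$ to its own base station distributed as $\overline R_i$, and transmits with power $P_{c_i}=P_0(\rho_i^{\alpha_B}/A_B)^{\varepsilon}$. The D2D users form a PPP of intensity $(1-q)\lambda_u$, independent (with its marks) of $\phi_c$ (with its marks); each has a D2D shadowing to the origin and is, by a fair coin independent of its shadowing, a transmitter (of power $P_d$) or a receiver. *SINR.* A typical D2D receiver at the origin is served by the D2D transmitter that it receives with the largest power; $\overline R_d$ is the equivalent distance of that link. With $R_{B,i},R_{D,j}$ the distances to the origin, $$\mathrm{SINR}=\frac{P_dA_D\overline R_d^{-\alpha_D}}{\sum_{i\in\phi_c}P_{c_i}A_B\mathcal H_i^BR_{B,i}^{-\alpha_B}+\sum_{j}P_dA_D\mathcal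 H_j^DR_{D,j}^{-\alpha_D}+\eta_d},$$ the second sum being over the D2D transmitters other than the serving one. **Lemma 5.** Let $e_D=\exp(2\kappa^2\sigma_D^2/\alpha_D^2)$. The distribution function of $\overline R_d$ is differentiable on $(0,\infty)$, and its derivative $f_{\overline R_d}(r)=\frac{d}{dr}\Pr[\overline R_d\le r]$ is the density of $\overline R_d$. For every real $\omega$ the conditional characteristic function of $1/\mathrm{SINR}$ is $\mathbb E[e^{-i\omega/\mathrm{SINR}}\mid\overline R_d]=\mathcal F(\omega,\overline R_d)$ almost surely, where for $r>0$ $$\begin{aligned}\mathcal F(\omega,r)=&\exp\Big\{-2\pi\lambda_Be_B\int_0^\infty\Big(1-\int_0^t\exp\Big(-\frac{i\omega\,P_0A_B^{1-\varepsilon}\rho^{\alpha_B\varepsilon}\tau^{-\alpha_B}}{P_dA_Dr^{-\alpha_D}}\Big)f_{\overline R_i}(\rho)\,d\rho\Big)\tau\,d\tau\Big\}\\&\times\exp\Big\{-\pi(1-q)\lambda_ue_D\int_r^\infty\Big(1-\exp\Big(-\frac{i\omega L^{-\alpha_D}}{r^{-\alpha_D}}\Big)\Big)L\,dL\Big\}\times\exp\Big(-\frac{i\omega\eta_d}{P_dA_Dr^{-\alpha_D}}\Big).\end{aligned}$$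 For every $T>0$, $$\Pr[\mathrm{SINR}>T]=\int_0^\infty\Big(\int_{-\infty}^\infty\frac{e^{i\omega/T}-1}{2\pi i\omega}\,\mathcal F(\omega,r)\,d\omega\Big)f_{\overline R_d}(r)\,dr,$$ where the inner integral converges absolutely for every $r>0$ and the outer one converges absolutely. -/

import Mathlib

open MeasureTheory ProbabilityTheory Set
open scoped ENNReal NNReal

noncomputable section

namespace D2D

/-- The plane in which base stations (BSs) and user equipments (UEs) live. -/
abbrev Plane : Type := EuclideanSpace ℝ (Fin 2)

/-! ### Marked Poisson point processes, enumerated as sequences of random points -/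

/-- The number of points of the configuration `X 0 ω, X 1 ω, …` in the set `B`. -/
def pointCount {Ω E : Type*} (X : ℕ → Ω → E) (B : Set E) (ω : Ω) : ℝ≥0∞ :=
  ∑' i, B.indicator (fun _ => (1 : ℝ≥0∞)) (X i ω)

/-- The random points `X 0, X 1, …` form a Poisson point process with intensity measure `ν`. -/
structure IsPoissonProcess {Ω E : Type*} [MeasurableSpace Ω] [MeasurableSpace E]
    (X : ℕ → Ω → E) (ν : Measure E) (μ : Measure Ω) : Prop where
  measurable : ∀ i, Measurable (X i)
  law_count : ∀ B : Set E, MeasurableSet B → ν B < ∞ → ∀ n : ℕ,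
    μ {ω | pointCount X B ω = n} = poissonMeasure (ν B).toNNReal {n}
  indep_count : ∀ (m : ℕ) (B : Fin m → Set E), (∀ k, MeasurableSet (B k)) →
    Pairwise (Function.onFun Disjoint B) → iIndepFun (fun k => pointCount X (B k)) μ

/-- `X` is a Poisson point process with intensity `ν`, whose points carry i.i.d. marks `M i` of
law `κ`, independent of the points. -/
structure IsMarkedPoisson {Ω E F : Type*} [MeasurableSpace Ω] [MeasurableSpace E]
    [MeasurableSpace F] (X : ℕ → Ω → E) (M : ℕ → Ω → F) (ν : Measure E) (κ : Measure F)
    (μ : Measure Ω) : Prop where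
  poisson : IsPoissonProcess X ν μ
  measurable_mark : ∀ i, Measurable (M i)
  law_mark : ∀ i, μ.map (M i) = κ
  indep_marks : iIndepFun M μ
  indep_points : IndepFun (fun ω i => X i ω) (fun ω i => M i ω) μ

/-! ### The network -/

/-- The constants of the network. Shadowing standard deviations are in dB. -/
structure Params where
  /-- intensity of the base stations (and of the active cellular UEs) -/
  lamB : ℝ
  /-- intensity of the UEs -/
  lamU : ℝ
  /-- path loss constants of cellular and of D2D links -/
  AB : ℝ
  AD : ℝ
  /-- path loss exponents of cellular and of D2D links -/
  alphaB : ℝ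
  alphaD : ℝ
  /-- shadowing standard deviations, in dB, of cellular and of D2D links -/
  sigmaB : ℝ≥0
  sigmaD : ℝ≥0
  /-- transmit power of a BS, receiver sensitivity, transmit power of a D2D transmitter -/
  PB : ℝ
  P0 : ℝ
  Pd : ℝ
  /-- fractional path loss compensation -/
  eps : ℝ
  /-- mode selection threshold -/
  beta : ℝ
  /-- noise power at a D2D receiver -/
  eta : ℝ
  lamB_pos : 0 < lamB
  lamU_pos : 0 < lamU
  AB_pos : 0 < AB
  AD_pos : 0 < AD
  two_lt_alphaB : 2 < alphaB
  two_lt_alphaD : 2 < alphaD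
  PB_pos : 0 < PB
  P0_pos : 0 < P0
  Pd_pos : 0 < Pd
  eps_pos : 0 < eps
  eps_le_one : eps ≤ 1
  beta_pos : 0 < beta
  eta_nonneg : 0 ≤ eta

/-- The constant `κ = -ln 10 / 10` that converts dB. -/
def kappa : ℝ := -Real.log 10 / 10

/-- The lognormal fading coefficient `exp (κ ξ)` of a link whose shadowing is `ξ` dB. -/
def fading (xi : ℝ) : ℝ := Real.exp (kappa * xi)

/-- The equivalent distance `H ^ (-1/α) * R` of a link from the origin to `x` with shadowing `ξ`. -/
def equivDist (alpha : ℝ) (x : Plane) (xi : ℝ) : ℝ := fading xi ^ (-1 / alpha) * ‖x‖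

/-- The index of the largest value of a sequence (the first one if there are several). -/
def strongest (v : ℕ → ℝ) : ℕ := sInf {j | ∀ k, v k ≤ v j}

variable {Ω : Type*} [MeasurableSpace Ω]

/-! ### Mode selection of a typical UE at the origin; `Y` are the BSs, `xi` their shadowings -/

/-- Power received from the `k`-th BS. -/
def rxBS (p : Params) (Y : ℕ → Ω → Plane) (xi : ℕ → Ω → ℝ) (ω : Ω) (k : ℕ) : ℝ :=
  p.AB * p.PB * fading (xi k ω) * ‖Y k ω‖ ^ (-p.alphaB)

/-- The event that the typical UE operates in cellular mode: the power received from the strongest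
BS exceeds the threshold. -/
def cellularMode (p : Params) (Y : ℕ → Ω → Plane) (xi : ℕ → Ω → ℝ) : Set Ω :=
  {ω | p.beta < rxBS p Y xi ω (strongest (rxBS p Y xi ω))}

/-- The equivalent distance from the typical UE to its strongest BS. -/
def servingDist (p : Params) (Y : ℕ → Ω → Plane) (xi : ℕ → Ω → ℝ) (ω : Ω) : ℝ :=
  let k := strongest (rxBS p Y xi ω)
  equivDist p.alphaB (Y k ω) (xi k ω)

/-- The law of the equivalent distance from a cellular UE to its BS. -/
def cellularDistLaw (p : Params) (Y : ℕ → Ω → Plane) (xi : ℕ → Ω → ℝ) (μ : Measure Ω) :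
    Measure ℝ :=
  (cond μ (cellularMode p Y xi)).map (servingDist p Y xi)

/-- The intensity `(1 - q) λ_u` of the D2D UEs, where `q` is the probability of cellular mode. -/
def lamD2D (p : Params) (Y : ℕ → Ω → Plane) (xi : ℕ → Ω → ℝ) (μ : Measure Ω) : ℝ :=
  (1 - μ.real (cellularMode p Y xi)) * p.lamU

/-- The homogeneous intensity measure of density `lam` on the plane. -/
def homogeneous (lam : ℝ) : Measure Plane := ENNReal.ofReal lam • volume

/-- Law of a dB shadowing of standard deviation `σ`. -/
def shadowLaw (σ : ℝ≥0) : Measure ℝ := gaussianReal 0 (σ ^ 2)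

/-- A fair coin. -/
def fairCoin : Measure Bool := (PMF.uniformOfFintype Bool).toMeasure

/-! ### SINR of a typical D2D receiver at the origin

`C` are the active cellular UEs. The mark of a cellular UE is the pair of its shadowing towards
the origin and of the equivalent distance to its own BS. `D` are the (other) D2D UEs. The mark of
a D2D UE is the pair of its shadowing towards the origin and of the coin that decides
whether it is a transmitter (`true`) or a receiver (`false`). -/

/-- Transmit power of a cellular UE at equivalent distance `ρ` from its BS. -/
def txCellular (p : Params) (ρ : ℝ) : ℝ := p.P0 * (ρ ^ p.alphaB / p.AB) ^ p.eps

/-- Power received from the `i`-th cellular UE. -/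
def rxCellular (p : Params) (C : ℕ → Ω → Plane) (M : ℕ → Ω → ℝ × ℝ) (ω : Ω) (i : ℕ) : ℝ :=
  txCellular p (M i ω).2 * p.AB * fading (M i ω).1 * ‖C i ω‖ ^ (-p.alphaB)

/-- Power received from the `j`-th D2D UE; it is zero if that UE is not a transmitter. -/
def rxD2D (p : Params) (D : ℕ → Ω → Plane) (N : ℕ → Ω → ℝ × Bool) (ω : Ω) (j : ℕ) : ℝ :=
  if (N j ω).2 then p.Pd * p.AD * fading (N j ω).1 * ‖D j ω‖ ^ (-p.alphaD) else 0

/-- The serving transmitter: the D2D transmitter that is received with the largest power. -/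
def serving (p : Params) (D : ℕ → Ω → Plane) (N : ℕ → Ω → ℝ × Bool) (ω : Ω) : ℕ :=
  strongest (rxD2D p D N ω)

/-- The equivalent distance of the typical D2D link. -/
def linkDist (p : Params) (D : ℕ → Ω → Plane) (N : ℕ → Ω → ℝ × Bool) (ω : Ω) : ℝ :=
  equivDist p.alphaD (D (serving p D N ω) ω) (N (serving p D N ω) ω).1

/-- Interference from the cellular UEs. -/
def interfC (p : Params) (C : ℕ → Ω → Plane) (M : ℕ → Ω → ℝ × ℝ) (ω : Ω) : ℝ≥0∞ :=
  ∑' i, ENNReal.ofReal (rxCellular p C M ω i)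

/-- Interference from the D2D transmitters other than the serving one. -/
def interfD (p : Params) (D : ℕ → Ω → Plane) (N : ℕ → Ω → ℝ × Bool) (ω : Ω) : ℝ≥0∞ :=
  ∑' j, if j = serving p D N ω then 0 else ENNReal.ofReal (rxD2D p D N ω j)

/-- The signal to interference plus noise ratio of the typical D2D receiver. -/
def sinr (p : Params) (C : ℕ → Ω → Plane) (M : ℕ → Ω → ℝ × ℝ) (D : ℕ → Ω → Plane)
    (N : ℕ → Ω → ℝ × Bool) (ω : Ω) : ℝ≥0∞ :=
  ENNReal.ofReal (rxD2D p D N ω (serving p D N ω)) /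
    (interfC p C M ω + interfD p D N ω + ENNReal.ofReal p.eta)

/-- The derivative of the distribution function of the equivalent distance of the D2D link. -/
def linkDensity (p : Params) (D : ℕ → Ω → Plane) (N : ℕ → Ω → ℝ × Bool) (μ : Measure Ω)
    (r : ℝ) : ℝ :=
  deriv (fun x => μ.real {ω | linkDist p D N ω ≤ x}) r

/-! ### The explicit expressions -/

/-- The fading factor `E[H ^ (2/α)] = exp (2 (κ σ)² / α²)`. -/
def fadingFactor (σ : ℝ≥0) (alpha : ℝ) : ℝ := Real.exp (2 * (kappa * σ) ^ 2 / alpha ^ 2)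

/-- The largest equivalent distance at which a UE is in cellular mode. -/
def tMax (p : Params) : ℝ := (p.beta / (p.AB * p.PB)) ^ (-1 / p.alphaB)

/-- The probability of cellular mode in closed form. -/
def qCellular (p : Params) : ℝ :=
  1 - Real.exp (-(Real.pi * p.lamB * (p.AB * p.PB / p.beta) ^ (2 / p.alphaB) *
    fadingFactor p.sigmaB p.alphaB))

/-- The density on `(0, tMax)` of the equivalent distance from a cellular UE to its BS. -/
def fCellular (p : Params) (ρ : ℝ) : ℝ :=
  2 * Real.pi * p.lamB * fadingFactor p.sigmaB p.alphaB * ρ *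
    Real.exp (-(Real.pi * p.lamB * ρ ^ 2 * fadingFactor p.sigmaB p.alphaB)) / qCellular p

/-- The signal power at equivalent distance `r`. -/
def signal (p : Params) (r : ℝ) : ℝ := p.Pd * p.AD * r ^ (-p.alphaD)

/-- The factor of the conditional characteristic function due to the cellular UEs. -/
def charC (p : Params) (w r : ℝ) : ℂ :=
  Complex.exp (-(2 * Real.pi * p.lamB * fadingFactor p.sigmaB p.alphaB : ℝ) *
    ∫ τ in Ioi (0 : ℝ),
      (1 - ∫ ρ in Ioo 0 (tMax p),
        Complex.exp (-(Complex.I * w *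
          (p.P0 * p.AB ^ (1 - p.eps) * ρ ^ (p.alphaB * p.eps) * τ ^ (-p.alphaB) /
            signal p r : ℝ))) * (fCellular p ρ : ℂ)) * (τ : ℂ))

/-- The factor of the conditional characteristic function due to the D2D transmitters. -/
def charD (p : Params) (w r : ℝ) : ℂ :=
  Complex.exp (-(Real.pi * (1 - qCellular p) * p.lamU * fadingFactor p.sigmaD p.alphaD : ℝ) *
    ∫ L in Ioi r,
      (1 - Complex.exp (-(Complex.I * w * (L ^ (-p.alphaD) / r ^ (-p.alphaD) : ℝ)))) * (L : ℂ))

/-- The conditional characteristic function of `1 / SINR`, at a D2D link of equivalent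
distance `r`. -/
def charInvSinr (p : Params) (w r : ℝ) : ℂ :=
  charC p w r * charD p w r * Complex.exp (-(Complex.I * w * (p.eta / signal p r : ℝ)))

/-- The integrand of the inversion integral. -/
def inversionIntegrand (p : Params) (T r w : ℝ) : ℂ :=
  (Complex.exp (Complex.I * w / T) - 1) / (2 * Real.pi * Complex.I * w) * charInvSinr p w r

end D2D

end

/-! Fading can be absorbed into geometry. The power of a link depends only on its equivalent
distance, and the equivalent distances of a homogeneous planar process with lognormal marks have
intensity proportional to `v dv` on the half line (`map_equivDist`). All laws are then read off the
generating functional of a marked Poisson process, `IsMarkedPoisson.tendsto_integral_prod`. Applied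
to a function that vanishes on a set `A` and equals `exp (-i w f)` elsewhere, it gives the joint
transform "no point in `A`, and characteristic function of the sum of `f`"
(`IsMarkedPoisson.integral_void_exp`). Void probabilities make the distances to the strongest base
station and to the serving transmitter Rayleigh. The first law, cut off at `tMax`, gives the mark
law of the cellular interferers.

The delicate point is conditioning on the D2D link distance `R`, because the serving transmitter is
one of the points of the process. No Palm calculus is needed. Keep the serving transmitter in the
sum and let `S(r)` be the signal power at distance `r`. The void functional gives the transform of
the total D2D power on `R > a` as `deviceChar p w a`, for every `a ≥ 0`. Its derivative in `a` is
explicit, so that it is the tail integral of `exp (-i w S(r))` times the Rayleigh density times the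
transform of the power coming from beyond `r` (`deviceChar_eq_integral`). Tails determine set
functions on the line, so this identifies the conditional characteristic function of the total power
given `R = r`. The total power divided by `S(R)` is `1 + 1/SINR`. Allowing the frequency to depend
on `R` (`setIntegral_exp_substitute`) and taking it to be `w / S(R)` gives the conditional
characteristic function of `1/SINR` up to the factor `exp (-i w)`, which cancels.

The coverage formula is Fourier inversion on the interval `(0, 1/T)`. Gaussian damping proves the
inversion at points that carry no mass, and continuity in the endpoint removes that restriction
(`integral_inversion`). Absolute convergence comes from the D2D factor. Transmitters at distance
comparable to `r |w| ^ (1/α_D)` already force a decay `exp (-c |w| ^ (2/α_D) r²)` for `|w| ≥ 1`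
(`le_deviceExponent_re`). Against the kernel, which is `O(1/(1+|w|))`, this is integrable in `w` for
fixed `r > 0`, and still integrable after averaging over `r`, which leaves `|w| ^ (-2/α_D)`.
Fubini's theorem then exchanges the two integrals. -/

namespace D2D

open Filter Topology

/-! ### Counts of a Poisson process: finiteness, mean and generating function. -/

section Poisson

variable {Ω E F : Type*} [MeasurableSpace Ω] [MeasurableSpace E] [MeasurableSpace F]
  {X : ℕ → Ω → E} {M : ℕ → Ω → F} {ν : Measure E} {κ : Measure F} {μ : Measure Ω}

theorem measurable_pointCount (hX : ∀ i, Measurable (X i)) {B : Set E} (hB : MeasurableSet B) :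
    Measurable (pointCount X B) :=
  Measurable.tsum fun i => (measurable_const.indicator hB).comp (hX i)

/-- The Poisson weights of the finite values already sum to 1, so nothing is left for the value `∞`.
-/
theorem IsPoissonProcess.ae_pointCount_eq_natCast [IsProbabilityMeasure μ]
    (h : IsPoissonProcess X ν μ) {B : Set E} (hB : MeasurableSet B) (hfin : ν B < ∞) :
    ∀ᵐ ω ∂μ, ∃ n : ℕ, pointCount X B ω = n := by
  have hm := measurable_pointCount h.measurable hB
  have hU : μ (⋃ n : ℕ, {ω | pointCount X B ω = n}) = 1 := by
    rw [measure_iUnion]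
    · simp_rw [h.law_count B hB hfin]
      rw [← measure_iUnion (fun i j hij => by simpa using hij) (fun i => measurableSet_singleton i)]
      rw [iUnion_of_singleton, measure_univ]
    · intro i j hij
      refine Set.disjoint_left.2 fun ω (h1 : _ = _) (h2 : _ = _) => hij ?_
      exact_mod_cast h1.symm.trans h2
    · exact fun i => hm (measurableSet_singleton _)
  have := (prob_compl_eq_zero_iff
    (MeasurableSet.iUnion fun n : ℕ => hm (measurableSet_singleton (n : ℝ≥0∞)))).2 hU
  filter_upwards [compl_mem_ae_iff.2 this] with ω hω
  simpa using hω

/-- The number of points as a natural number. -/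
noncomputable def natCount (X : ℕ → Ω → E) (B : Set E) (ω : Ω) : ℕ := ⌊(pointCount X B ω).toReal⌋₊

theorem measurable_natCount (hX : ∀ i, Measurable (X i)) {B : Set E} (hB : MeasurableSet B) :
    Measurable (natCount X B) :=
  Nat.measurable_floor.comp (measurable_pointCount hX hB).ennreal_toReal

theorem IsPoissonProcess.ae_natCount [IsProbabilityMeasure μ]
    (h : IsPoissonProcess X ν μ) {B : Set E} (hB : MeasurableSet B) (hfin : ν B < ∞) :
    ∀ᵐ ω ∂μ, pointCount X B ω = natCount X B ω := by
  filter_upwards [h.ae_pointCount_eq_natCast hB hfin] with ω ⟨n, hn⟩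
  simp [natCount, hn]

theorem IsPoissonProcess.map_natCount [IsProbabilityMeasure μ]
    (h : IsPoissonProcess X ν μ) {B : Set E} (hB : MeasurableSet B) (hfin : ν B < ∞) :
    μ.map (natCount X B) = poissonMeasure (ν B).toNNReal := by
  refine Measure.ext_of_singleton fun n => ?_
  rw [Measure.map_apply (measurable_natCount h.measurable hB) (measurableSet_singleton _),
    ← h.law_count B hB hfin n]
  refine measure_congr ?_
  filter_upwards [h.ae_natCount hB hfin] with ω hω
  refine propext ?_
  change natCount X B ω = n ↔ pointCount X B ω = n
  rw [hω]
  norm_cast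

theorem lintegral_natCast_poissonMeasure (r : ℝ≥0) :
    ∫⁻ n, (n : ℝ≥0∞) ∂(poissonMeasure r) = r := by
  rw [lintegral_countable', tsum_eq_zero_add' ENNReal.summable]
  · simp only [poissonMeasure_singleton]
    have : ∀ n : ℕ, ((n + 1 : ℕ) : ℝ≥0∞) *
        ENNReal.ofReal (Real.exp (-r) * r ^ (n + 1) / (n + 1).factorial) =
        ENNReal.ofReal (Real.exp (-r) * r ^ n / n.factorial) * r := by
      intro n
      rw [← ENNReal.ofReal_natCast, ← ENNReal.ofReal_mul (by positivity),
        ← ENNReal.ofReal_coe_nnreal, ← ENNReal.ofReal_mul (by positivity)]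
      congr 1
      rw [Nat.factorial_succ]
      push_cast
      field_simp
      ring
    simp only [this]
    rw [ENNReal.tsum_mul_right]
    have h1 : ∑' n : ℕ, ENNReal.ofReal (Real.exp (-r) * r ^ n / n.factorial) = 1 := by
      rw [← ENNReal.ofReal_tsum_of_nonneg (fun n => by positivity)
        (hasSum_one_poissonMeasure r).summable, (hasSum_one_poissonMeasure r).tsum_eq]
      simp
    rw [h1]
    simp

/-- Campbell's formula for the number of points: the intensity measure of `X` is `ν`. -/
theorem IsPoissonProcess.sum_map [IsProbabilityMeasure μ] [SigmaFinite ν]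
    (h : IsPoissonProcess X ν μ) : Measure.sum (fun i => μ.map (X i)) = ν := by
  have key : ∀ B, MeasurableSet B → ν B < ∞ → Measure.sum (fun i => μ.map (X i)) B = ν B := by
    intro B hB hfin
    rw [Measure.sum_apply _ hB]
    have h1 : ∫⁻ ω, pointCount X B ω ∂μ = ∑' i, μ.map (X i) B := by
      unfold pointCount
      rw [lintegral_tsum]
      · congr with i
        rw [Measure.map_apply (h.measurable i) hB, ← lintegral_indicator_one (h.measurable i hB)]
        rfl
      · exact fun i => ((measurable_const.indicator hB).comp (h.measurable i)).aemeasurable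
    rw [← h1, lintegral_congr_ae (h.ae_natCount hB hfin)]
    rw [← lintegral_map (f := fun n : ℕ => (n : ℝ≥0∞)) (by fun_prop)
      (measurable_natCount h.measurable hB), h.map_natCount hB hfin,
      lintegral_natCast_poissonMeasure, ENNReal.coe_toNNReal hfin.ne]
  ext B hB
  have hU : B = ⋃ n, B ∩ spanningSets ν n := by
    rw [← inter_iUnion, iUnion_spanningSets, inter_univ]
  have hmono : Monotone fun n => B ∩ spanningSets ν n := fun i j hij =>
    inter_subset_inter_right _ (monotone_spanningSets ν hij)
  rw [hU, hmono.measure_iUnion, hmono.measure_iUnion]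
  congr with n
  exact key _ (hB.inter (measurableSet_spanningSets ν n))
    ((measure_mono inter_subset_right).trans_lt (measure_spanningSets_lt_top ν n))

theorem integral_pow_poissonMeasure (r : ℝ≥0) (c : ℂ) :
    ∫ n, c ^ n ∂(poissonMeasure r) = Complex.exp (-(r * (1 - c))) := by
  rw [integral_poissonMeasure r]
  calc ∑' a : ℕ, (Real.exp (-r) * r ^ a / a.factorial : ℝ) • c ^ a
  _ = ∑' a : ℕ, (Real.exp (-r) : ℂ) * ((r * c) ^ a / a.factorial) := by
      congr with a
      rw [Complex.real_smul]
      push_cast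
      rw [mul_pow]
      ring
  _ = (Real.exp (-r) : ℂ) * ∑' a : ℕ, ((r * c) ^ a / a.factorial) := tsum_mul_left
  _ = (Real.exp (-r) : ℂ) * Complex.exp (r * c) := by
      rw [(NormedSpace.expSeries_div_hasSum_exp (r * c : ℂ)).tsum_eq, Complex.exp_eq_exp_ℂ]
  _ = Complex.exp (-(r * (1 - c))) := by
      rw [Complex.ofReal_exp, ← Complex.exp_add]
      push_cast
      ring_nf

theorem IsPoissonProcess.integral_pow_natCount [IsProbabilityMeasure μ]
    (h : IsPoissonProcess X ν μ) {B : Set E} (hB : MeasurableSet B) (hfin : ν B < ∞) (c : ℂ) :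
    ∫ ω, c ^ natCount X B ω ∂μ = Complex.exp (-(ν.real B * (1 - c))) := by
  rw [← integral_map (f := fun n : ℕ => c ^ n)
    (measurable_natCount h.measurable hB).aemeasurable .of_discrete, h.map_natCount hB hfin,
    integral_pow_poissonMeasure]
  rfl

end Poisson

/-! ### The probability generating functional, without and with marks. -/

section GeneratingFunctional

variable {Ω E F : Type*} [MeasurableSpace Ω] [MeasurableSpace E] [MeasurableSpace F]
  {X : ℕ → Ω → E} {M : ℕ → Ω → F} {ν : Measure E} {κ : Measure F} {μ : Measure Ω}

/-- Only finitely many points contribute a factor other than 1. Once all of them are included,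
grouping the factors by value turns the product into powers whose exponents are counts. The value 1
is excluded from `R` because its level set may hold infinitely many points. -/
theorem prod_range_eventually_eq {S : Type*} {g : S → ℂ} {x : ℕ → S} {R : Finset ℂ}
    (hR : ∀ y, g y ≠ 1 → g y ∈ R) (hR1 : (1 : ℂ) ∉ R)
    (hfin : ∑' i, (g ⁻¹' {1}ᶜ).indicator (fun _ => (1 : ℝ≥0∞)) (x i) ≠ ∞) :
    ∀ᶠ n in atTop, ∏ i ∈ Finset.range n, g (x i) =
      ∏ c ∈ R, c ^ ⌊(∑' i, (g ⁻¹' {c}).indicator (fun _ => (1 : ℝ≥0∞)) (x i)).toReal⌋₊ := by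
  classical
  have hS : {i | g (x i) ≠ 1}.Finite := by
    refine (ENNReal.finite_const_le_of_tsum_ne_top hfin one_ne_zero).subset fun i hi => ?_
    have : x i ∈ g ⁻¹' {1}ᶜ := hi
    exact (indicator_of_mem this fun _ => (1 : ℝ≥0∞)).ge
  set S := hS.toFinset with hSdef
  have hmem : ∀ i, i ∈ S ↔ g (x i) ≠ 1 := fun i => by simp [hSdef]
  obtain ⟨n₀, hn₀⟩ := S.exists_nat_subset_range
  filter_upwards [eventually_ge_atTop n₀] with n hn
  have h1 : ∏ i ∈ Finset.range n, g (x i) = ∏ i ∈ S, g (x i) := by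
    symm
    refine Finset.prod_subset (hn₀.trans (Finset.range_mono hn)) fun i _ hi => ?_
    simpa [hmem] using hi
  rw [h1, ← Finset.prod_fiberwise_of_maps_to (t := R) (g := fun i => g (x i))
    (fun i hi => hR _ ((hmem i).1 hi))]
  refine Finset.prod_congr rfl fun c hc => ?_
  have hc1 : c ≠ 1 := fun h => hR1 (h ▸ hc)
  have h2 : ∑' i, (g ⁻¹' {c}).indicator (fun _ => (1 : ℝ≥0∞)) (x i) =
      ((S.filter fun i => g (x i) = c).card : ℝ≥0∞) := by
    rw [tsum_eq_sum (s := S)]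
    · simp [indicator_apply, Finset.sum_boole]
    · intro i hi
      refine indicator_of_notMem (fun h => hi ((hmem i).2 ?_)) _
      have : g (x i) = c := h
      rwa [this]
  rw [h2, ENNReal.toReal_natCast, Nat.floor_natCast, ← Finset.prod_const]
  exact Finset.prod_congr rfl fun i hi => (Finset.mem_filter.1 hi).2

theorem norm_finset_prod_le_one {ι : Type*} (s : Finset ι) {f : ι → ℂ} (h : ∀ i, ‖f i‖ ≤ 1) :
    ‖∏ i ∈ s, f i‖ ≤ 1 := by
  rw [norm_prod]
  exact Finset.prod_le_one (fun i _ => norm_nonneg _) fun i _ => h i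

theorem norm_prod_sub_prod_le_sum {f g : ℕ → ℂ} (hf : ∀ i, ‖f i‖ ≤ 1) (hg : ∀ i, ‖g i‖ ≤ 1)
    (n : ℕ) : ‖∏ i ∈ Finset.range n, f i - ∏ i ∈ Finset.range n, g i‖ ≤
      ∑ i ∈ Finset.range n, ‖f i - g i‖ := by
  induction n with
  | zero => simp
  | succ n ih =>
    rw [Finset.prod_range_succ, Finset.prod_range_succ, Finset.sum_range_succ]
    calc _ = ‖(∏ i ∈ Finset.range n, f i - ∏ i ∈ Finset.range n, g i) * f n +
          (∏ i ∈ Finset.range n, g i) * (f n - g n)‖ := by ring_nf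
      _ ≤ _ := by
        refine (norm_add_le _ _).trans (add_le_add ?_ ?_)
        · rw [norm_mul]
          exact (mul_le_of_le_one_right (norm_nonneg _) (hf n)).trans ih
        · rw [norm_mul]
          exact mul_le_of_le_one_left (norm_nonneg _) (norm_finset_prod_le_one _ hg)

/-- The level sets of `g` are disjoint, so their counts are independent, and the expectation factors
into Poisson generating functions. The exponents add up to the integral of `1 - g`. -/
theorem IsPoissonProcess.tendsto_integral_prod_simpleFunc [IsProbabilityMeasure μ]
    (h : IsPoissonProcess X ν μ) (g : SimpleFunc E ℂ) (hg : ∀ x, ‖g x‖ ≤ 1)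
    (hfin : ν (g ⁻¹' {1}ᶜ) < ∞) :
    Tendsto (fun n => ∫ ω, ∏ i ∈ Finset.range n, g (X i ω) ∂μ) atTop
      (𝓝 (Complex.exp (-∫ x, (1 - g x) ∂ν))) := by
  classical
  set R := g.range.erase 1 with hRdef
  have hlt : ∀ c ∈ R, ν (g ⁻¹' {c}) < ∞ := fun c hc => by
    refine (measure_mono fun x hx => ?_).trans_lt hfin
    have : g x = c := hx
    simpa [this] using (Finset.mem_erase.1 hc).1
  have hlim : ∫ ω, ∏ c ∈ R, c ^ natCount X (g ⁻¹' {c}) ω ∂μ =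
      Complex.exp (-∫ x, (1 - g x) ∂ν) := by
    let e : Fin R.card ≃ R := R.equivFin.symm
    have hind := h.indep_count R.card (fun k => g ⁻¹' {(e k : ℂ)})
      (fun k => g.measurableSet_preimage _) (fun i j hij => by
        refine Disjoint.preimage _ ?_
        simpa using fun h => hij (e.injective (Subtype.ext h)))
    have hind2 : iIndepFun (fun k => natCount X (g ⁻¹' {(e k : ℂ)})) μ :=
      hind.comp (fun _ x => ⌊x.toReal⌋₊)
        (fun _ => Nat.measurable_floor.comp ENNReal.measurable_toReal)
    have hprod : ∀ ω, ∏ c ∈ R, c ^ natCount X (g ⁻¹' {c}) ω =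
        ∏ k, (e k : ℂ) ^ natCount X (g ⁻¹' {(e k : ℂ)}) ω := fun ω => by
      rw [← Finset.prod_coe_sort]
      exact (Equiv.prod_comp e (fun c : R => (c : ℂ) ^ natCount X (g ⁻¹' {(c : ℂ)}) ω)).symm
    simp_rw [hprod]
    rw [hind2.integral_fun_prod_comp (f := fun k n => (e k : ℂ) ^ n)
      (fun k => (measurable_natCount h.measurable (g.measurableSet_preimage _)).aemeasurable)
      (fun k => .of_discrete)]
    have : ∀ k, ∫ ω, (e k : ℂ) ^ natCount X (g ⁻¹' {(e k : ℂ)}) ω ∂μ =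
        Complex.exp (-(ν.real (g ⁻¹' {(e k : ℂ)}) * (1 - (e k : ℂ)))) := fun k =>
      h.integral_pow_natCount (g.measurableSet_preimage _) (hlt _ (e k).2) _
    simp_rw [this]
    rw [← Complex.exp_sum, Finset.sum_neg_distrib]
    congr 2
    have hpt : ∀ x, 1 - g x = ∑ c ∈ R, (g ⁻¹' {c}).indicator (fun _ => 1 - c) x := fun x => by
      by_cases hx : g x = 1
      · rw [hx, sub_self]
        refine (Finset.sum_eq_zero fun c hc => indicator_of_notMem (fun h => ?_) _).symm
        have : g x = c := h
        exact (Finset.mem_erase.1 hc).1 (this ▸ hx)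
      · rw [Finset.sum_eq_single (g x)]
        · simp
        · intro c _ hc
          exact indicator_of_notMem (fun h => hc (Eq.symm h)) _
        · exact fun h => absurd (Finset.mem_erase.2 ⟨hx, g.mem_range_self x⟩) h
    simp_rw [hpt]
    rw [integral_finsetSum]
    · refine Eq.trans ?_ (Finset.sum_coe_sort R _)
      rw [← Equiv.sum_comp e]
      refine Finset.sum_congr rfl fun k _ => ?_
      rw [integral_indicator_const _ (g.measurableSet_preimage _), Complex.real_smul]
    · intro c hc
      exact (integrable_indicator_iff (g.measurableSet_preimage _)).2
        (integrableOn_const (hlt c hc).ne)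
  rw [← hlim]
  refine tendsto_integral_of_dominated_convergence (fun _ => 1) (fun n => ?_)
    (integrable_const _) (fun n => .of_forall fun ω => norm_finset_prod_le_one _ fun i => hg _) ?_
  · exact (Finset.measurable_fun_prod _ fun i _ =>
      g.measurable.comp (h.measurable i)).aestronglyMeasurable
  · filter_upwards [h.ae_pointCount_eq_natCast (g.measurableSet_preimage {1}ᶜ) hfin]
      with ω ⟨k, hk⟩
    refine tendsto_const_nhds.congr' ?_
    have := prod_range_eventually_eq (g := g) (x := fun i => X i ω) (R := R)
      (fun y hy => Finset.mem_erase.2 ⟨hy, g.mem_range_self y⟩) (by simp [hRdef])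
      (by rw [show ∑' i, (g ⁻¹' {1}ᶜ).indicator (fun _ => (1 : ℝ≥0∞)) (X i ω) = k from hk]
          exact ENNReal.natCast_ne_top k)
    filter_upwards [this] with n hn
    rw [hn]
    rfl

/-- The bound does not depend on `n`. It lets an approximation of `g` in `L¹(ν)` control all partial
products at once. -/
theorem IsPoissonProcess.lintegral_sum_comp_le [IsProbabilityMeasure μ] [SigmaFinite ν]
    (h : IsPoissonProcess X ν μ) {f : E → ℝ≥0∞} (hf : Measurable f) (n : ℕ) :
    ∑ i ∈ Finset.range n, ∫⁻ ω, f (X i ω) ∂μ ≤ ∫⁻ x, f x ∂ν := by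
  conv_rhs => rw [← h.sum_map, lintegral_sum_measure]
  simp_rw [lintegral_map hf (h.measurable _)]
  exact ENNReal.sum_le_tsum _

theorem norm_integral_prod_sub_le [IsProbabilityMeasure μ] {Y : ℕ → Ω → E}
    (hY : ∀ i, Measurable (Y i)) {f g : E → ℂ} (hfm : Measurable f) (hgm : Measurable g)
    (hf : ∀ x, ‖f x‖ ≤ 1) (hg : ∀ x, ‖g x‖ ≤ 1) (n : ℕ) :
    ‖∫ ω, ∏ i ∈ Finset.range n, f (Y i ω) ∂μ - ∫ ω, ∏ i ∈ Finset.range n, g (Y i ω) ∂μ‖ₑ ≤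
      ∑ i ∈ Finset.range n, ∫⁻ ω, ‖f (Y i ω) - g (Y i ω)‖ₑ ∂μ := by
  have hint : ∀ {u : E → ℂ}, Measurable u → (∀ x, ‖u x‖ ≤ 1) →
      Integrable (fun ω => ∏ i ∈ Finset.range n, u (Y i ω)) μ := fun hum hu =>
    Integrable.of_bound (Finset.measurable_fun_prod _ fun i _ =>
      hum.comp (hY i)).aestronglyMeasurable 1 (.of_forall fun ω =>
        norm_finset_prod_le_one _ fun i => hu _)
  rw [← integral_sub (hint hfm hf) (hint hgm hg),
    ← lintegral_finsetSum' _ fun i _ => by fun_prop]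
  refine (enorm_integral_le_lintegral_enorm _).trans (lintegral_mono fun ω => ?_)
  have := norm_prod_sub_prod_le_sum (f := fun i => f (Y i ω)) (g := fun i => g (Y i ω))
    (fun i => hf _) (fun i => hg _) n
  simp_rw [← ofReal_norm]
  rw [← ENNReal.ofReal_sum_of_nonneg fun i _ => norm_nonneg _]
  exact ENNReal.ofReal_le_ofReal this

/-- The probability generating functional of a Poisson process. -/
theorem IsPoissonProcess.tendsto_integral_prod [IsProbabilityMeasure μ] [SigmaFinite ν]
    (h : IsPoissonProcess X ν μ) {g : E → ℂ} (hgm : Measurable g) (hg : ∀ x, ‖g x‖ ≤ 1)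
    (hint : Integrable (fun x => 1 - g x) ν) :
    Tendsto (fun n => ∫ ω, ∏ i ∈ Finset.range n, g (X i ω) ∂μ) atTop
      (𝓝 (Complex.exp (-∫ x, (1 - g x) ∂ν))) := by
  have h1 : (1 : ℂ) ∈ Metric.closedBall (0 : ℂ) 1 := by simp
  have hint' : Integrable (fun x => g x - 1) ν :=
    hint.neg.congr (.of_forall fun x => by simp)
  -- The approximation starts from the value 1, since `1 - g` rather than `g` is integrable. Staying
  -- in the closed unit ball keeps the telescoping estimate for products available.
  let s : ℕ → SimpleFunc E ℂ := SimpleFunc.approxOn g hgm (Metric.closedBall 0 1) 1 h1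
  have hs : ∀ m x, ‖s m x‖ ≤ 1 := fun m x => by
    simpa using SimpleFunc.approxOn_mem hgm h1 m x
  have hL1 : Tendsto (fun m => ∫⁻ x, ‖s m x - g x‖ₑ ∂ν) atTop (𝓝 0) :=
    SimpleFunc.tendsto_approxOn_L1_enorm hgm h1
      (.of_forall fun x => subset_closure (by simpa using hg x)) hint'.2
  have hsint : ∀ᶠ m in atTop, Integrable (fun x => 1 - s m x) ν := by
    filter_upwards [hL1.eventually (gt_mem_nhds (zero_lt_one))] with m hm
    have : Integrable (fun x => s m x - g x) ν :=
      ⟨((s m).measurable.sub hgm).aestronglyMeasurable, hm.trans ENNReal.one_lt_top⟩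
    refine (hint.sub this).congr (.of_forall fun x => ?_)
    simp
  have hsfin : ∀ᶠ m in atTop, ν ((s m) ⁻¹' {1}ᶜ) < ∞ := by
    filter_upwards [hsint] with m hm
    have h2 : Integrable (⇑(SimpleFunc.const E (1 : ℂ) - s m)) ν := hm
    refine (measure_mono fun x hx => ?_).trans_lt (SimpleFunc.integrable_iff_finMeasSupp.1 h2)
    have : s m x ≠ 1 := hx
    exact sub_ne_zero.2 this.symm
  have hexp : Tendsto (fun m => Complex.exp (-∫ x, (1 - s m x) ∂ν)) atTop
      (𝓝 (Complex.exp (-∫ x, (1 - g x) ∂ν))) := by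
    refine (Complex.continuous_exp.tendsto _).comp (Tendsto.neg ?_)
    refine tendsto_integral_of_L1 _ hint.1 hsint ?_
    refine hL1.congr fun m => lintegral_congr fun x => ?_
    rw [← enorm_neg]
    congr 1
    ring
  rw [Metric.tendsto_atTop]
  intro ε hε
  have h3 : 0 < ε / 3 := by positivity
  obtain ⟨m, hm1, hm2, hm3⟩ := ((hL1.eventually (gt_mem_nhds (ENNReal.ofReal_pos.2 h3))).and
    (hsfin.and (hexp.eventually (Metric.ball_mem_nhds _ h3)))).exists
  obtain ⟨N, hN⟩ := Metric.tendsto_atTop.1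
    (h.tendsto_integral_prod_simpleFunc (s m) (hs m) hm2) (ε / 3) h3
  refine ⟨N, fun n hn => ?_⟩
  -- This estimate holds for every `n`, which is why `m` could be fixed before `N`.
  have hd : dist (∫ ω, ∏ i ∈ Finset.range n, g (X i ω) ∂μ)
      (∫ ω, ∏ i ∈ Finset.range n, s m (X i ω) ∂μ) < ε / 3 := by
    rw [dist_comm, dist_eq_norm, ← ENNReal.ofReal_lt_ofReal_iff h3, ofReal_norm]
    refine ((norm_integral_prod_sub_le h.measurable (s m).measurable hgm (hs m) hg n).trans
      (h.lintegral_sum_comp_le (f := fun x => ‖s m x - g x‖ₑ) ?_ n)).trans_lt hm1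
    exact ((s m).measurable.sub hgm).enorm
  calc _ ≤ _ := dist_triangle4 _ _ _ _
    _ < ε / 3 + ε / 3 + ε / 3 := add_lt_add (add_lt_add hd (hN n hn)) hm3
    _ = ε := by ring

/-- With the points frozen, the factors are independent functions of the marks, so each mark can be
averaged out separately. A marked process thus reduces to an unmarked one with an averaged `g`. -/
theorem IsMarkedPoisson.integral_prod_eq [IsProbabilityMeasure μ] [IsProbabilityMeasure κ]
    (h : IsMarkedPoisson X M ν κ μ) {g : E × F → ℂ} (hgm : Measurable g) (hg : ∀ x, ‖g x‖ ≤ 1)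
    (n : ℕ) :
    ∫ ω, ∏ i ∈ Finset.range n, g (X i ω, M i ω) ∂μ =
      ∫ ω, ∏ i ∈ Finset.range n, (∫ m, g (X i ω, m) ∂κ) ∂μ := by
  let G : (ℕ → E) × (ℕ → F) → ℂ := fun p => ∏ i ∈ Finset.range n, g (p.1 i, p.2 i)
  have hXm : Measurable fun ω i => X i ω := measurable_pi_lambda _ h.poisson.measurable
  have hMm : Measurable fun ω i => M i ω := measurable_pi_lambda _ h.measurable_mark
  have hGm : Measurable G := Finset.measurable_fun_prod _ fun i _ => hgm.comp (by fun_prop)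
  have hGb : ∀ p, ‖G p‖ ≤ 1 := fun p => norm_finset_prod_le_one _ fun i => hg _
  have := Measure.isProbabilityMeasure_map (μ := μ) hXm.aemeasurable
  have := Measure.isProbabilityMeasure_map (μ := μ) hMm.aemeasurable
  have hmap := (indepFun_iff_map_prod_eq_prod_map_map hXm.aemeasurable hMm.aemeasurable).1
    h.indep_points
  calc ∫ ω, ∏ i ∈ Finset.range n, g (X i ω, M i ω) ∂μ
      = ∫ p, G p ∂(μ.map fun ω => ((fun i => X i ω), fun i => M i ω)) := by
        rw [integral_map (hXm.prodMk hMm).aemeasurable hGm.aestronglyMeasurable]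
    _ = ∫ x, ∫ m, G (x, m) ∂(μ.map fun ω i => M i ω) ∂(μ.map fun ω i => X i ω) := by
        rw [hmap, integral_prod]
        exact Integrable.of_bound hGm.aestronglyMeasurable 1 (.of_forall hGb)
    _ = ∫ x, ∏ i ∈ Finset.range n, (∫ m, g (x i, m) ∂κ) ∂(μ.map fun ω i => X i ω) := by
        refine integral_congr_ae (.of_forall fun x => ?_)
        beta_reduce
        rw [integral_map (f := fun m => G (x, m)) hMm.aemeasurable
          (hGm.comp (measurable_const.prodMk measurable_id)).aestronglyMeasurable]
        simp only [G]
        have hind : iIndepFun (fun i : Fin n => M i) μ :=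
          h.indep_marks.precomp (g := fun i : Fin n => (i : ℕ)) Fin.val_injective
        have hp := iIndepFun.integral_fun_prod_comp (X := fun i : Fin n => M i)
          (f := fun i m => g (x i, m)) hind
          (fun i => (h.measurable_mark i).aemeasurable)
          (fun i => (hgm.comp (measurable_const.prodMk measurable_id)).aestronglyMeasurable)
        simp_rw [Finset.prod_range]
        rw [hp]
        refine Finset.prod_congr rfl fun i _ => ?_
        rw [← h.law_mark i, integral_map (f := fun m => g (x i, m)) (h.measurable_mark i).aemeasurable
          (hgm.comp (measurable_const.prodMk measurable_id)).aestronglyMeasurable]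
    _ = _ := by
        rw [integral_map hXm.aemeasurable]
        have hm : Measurable fun y => ∫ m, g (y, m) ∂κ :=
          hgm.stronglyMeasurable.integral_prod_right'.measurable
        exact (Finset.measurable_fun_prod _ fun i _ =>
          hm.comp (measurable_pi_apply i)).aestronglyMeasurable

/-- The probability generating functional of an independently marked Poisson process. -/
theorem IsMarkedPoisson.tendsto_integral_prod [IsProbabilityMeasure μ] [IsProbabilityMeasure κ]
    [SigmaFinite ν] (h : IsMarkedPoisson X M ν κ μ) {g : E × F → ℂ} (hgm : Measurable g)
    (hg : ∀ x, ‖g x‖ ≤ 1) (hint : Integrable (fun x => 1 - g x) (ν.prod κ)) :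
    Tendsto (fun n => ∫ ω, ∏ i ∈ Finset.range n, g (X i ω, M i ω) ∂μ) atTop
      (𝓝 (Complex.exp (-∫ x, (1 - g x) ∂(ν.prod κ)))) := by
  have hm : Measurable fun y => ∫ m, g (y, m) ∂κ :=
    hgm.stronglyMeasurable.integral_prod_right'.measurable
  have hsec : ∀ x, 1 - ∫ m, g (x, m) ∂κ = ∫ m, (1 - g (x, m)) ∂κ := fun x => by
    rw [integral_sub (integrable_const _)]
    · simp
    · exact Integrable.of_bound (hgm.comp
        (measurable_const.prodMk measurable_id)).aestronglyMeasurable 1 (.of_forall fun m => hg _)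
  simp_rw [h.integral_prod_eq hgm hg]
  rw [integral_prod _ hint]
  simp_rw [← hsec]
  refine h.poisson.tendsto_integral_prod hm (fun x => ?_) ?_
  · refine (norm_integral_le_of_norm_le_const (.of_forall fun m => hg (x, m))).trans ?_
    simp
  · simp_rw [hsec]
    exact hint.integral_prod_left

/-- Campbell's formula for the points together with their marks. -/
theorem IsMarkedPoisson.sum_map [IsProbabilityMeasure μ] [IsProbabilityMeasure κ]
    [SigmaFinite ν] (h : IsMarkedPoisson X M ν κ μ) :
    Measure.sum (fun i => μ.map fun ω => (X i ω, M i ω)) = ν.prod κ := by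
  have hi : ∀ i, μ.map (fun ω => (X i ω, M i ω)) = (μ.map (X i)).prod κ := fun i => by
    have hind : IndepFun (X i) (M i) μ :=
      h.indep_points.comp (measurable_pi_apply i) (measurable_pi_apply i)
    rw [(indepFun_iff_map_prod_eq_prod_map_map (h.poisson.measurable i).aemeasurable
      (h.measurable_mark i).aemeasurable).1 hind, h.law_mark i]
  simp_rw [hi]
  rw [← h.poisson.sum_map, Measure.prod_sum_left]

theorem IsMarkedPoisson.lintegral_tsum [IsProbabilityMeasure μ] [IsProbabilityMeasure κ]
    [SigmaFinite ν] (h : IsMarkedPoisson X M ν κ μ) {f : E × F → ℝ≥0∞} (hf : Measurable f) :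
    ∫⁻ ω, ∑' i, f (X i ω, M i ω) ∂μ = ∫⁻ x, f x ∂(ν.prod κ) := by
  have hm : ∀ i, Measurable fun ω => (X i ω, M i ω) := fun i =>
    (h.poisson.measurable i).prodMk (h.measurable_mark i)
  rw [MeasureTheory.lintegral_tsum (f := fun i ω => f (X i ω, M i ω))
    fun i => (hf.comp (hm i)).aemeasurable, ← h.sum_map,
    lintegral_sum_measure]
  simp_rw [lintegral_map hf (hm _)]

/-- Summability of the truncated terms forces all but finitely many of them below 1, where
truncation does nothing. The remaining terms form a finite sum. -/
theorem tsum_ne_top_of_tsum_min_one {f : ℕ → ℝ≥0∞} (hf : ∀ i, f i ≠ ∞)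
    (h : ∑' i, min 1 (f i) ≠ ∞) : ∑' i, f i ≠ ∞ := by
  classical
  have hS : {i | 1 ≤ min 1 (f i)}.Finite :=
    ENNReal.finite_const_le_of_tsum_ne_top h one_ne_zero
  have hle : ∀ i, f i ≤ min 1 (f i) + if i ∈ hS.toFinset then f i else 0 := fun i => by
    by_cases hi : i ∈ hS.toFinset
    · rw [if_pos hi]
      exact le_add_self
    · have h2 : f i < 1 := by simpa using hi
      rw [min_eq_right h2.le]
      exact le_self_add
  refine ne_top_of_le_ne_top ?_ (ENNReal.tsum_le_tsum hle)
  rw [ENNReal.tsum_add, tsum_eq_sum (s := hS.toFinset) fun i hi => if_neg hi]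
  refine ENNReal.add_ne_top.2 ⟨h, ENNReal.sum_ne_top.2 fun i hi => ?_⟩
  rw [if_pos hi]
  exact hf i

/-- The truncation at 1 is essential for the application. Power-law interference has infinite mean
because of points close to the origin, yet it is almost surely finite. -/
theorem IsMarkedPoisson.ae_tsum_ne_top [IsProbabilityMeasure μ] [IsProbabilityMeasure κ]
    [SigmaFinite ν] (h : IsMarkedPoisson X M ν κ μ) {f : E × F → ℝ≥0∞} (hf : Measurable f)
    (hft : ∀ x, f x ≠ ∞) (hint : ∫⁻ x, min 1 (f x) ∂(ν.prod κ) ≠ ∞) :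
    ∀ᵐ ω ∂μ, ∑' i, f (X i ω, M i ω) ≠ ∞ := by
  have hm : ∀ i, Measurable fun ω => (X i ω, M i ω) := fun i =>
    (h.poisson.measurable i).prodMk (h.measurable_mark i)
  rw [← h.lintegral_tsum (measurable_const.min hf)] at hint
  filter_upwards [ae_lt_top (Measurable.tsum fun i =>
    (measurable_const.min hf).comp (hm i)) hint] with ω hω
  exact tsum_ne_top_of_tsum_min_one (fun i => hft _) hω.ne

end GeneratingFunctional

/-! ### The intensity of equivalent distances. -/

section Geometry

/-- The image on the half line of a homogeneous planar measure under the distance to the origin: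
the measure of density `c * v` on `(0, ∞)`. -/
noncomputable def radial (c : ℝ) : Measure ℝ :=
  (volume.restrict (Ioi 0)).withDensity fun v => ENNReal.ofReal (c * v)

instance (c : ℝ) : SigmaFinite (radial c) := by
  unfold radial
  exact SigmaFinite.withDensity_ofReal _

instance (lam : ℝ) : SigmaFinite (homogeneous lam) := by
  unfold homogeneous
  exact inferInstanceAs (SigmaFinite (lam.toNNReal • (volume : Measure Plane)))

instance (σ : ℝ≥0) : IsProbabilityMeasure (shadowLaw σ) := by
  unfold shadowLaw
  infer_instance

instance : IsProbabilityMeasure fairCoin := by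
  unfold fairCoin
  infer_instance

theorem fading_pos (x : ℝ) : 0 < fading x := Real.exp_pos _

theorem measurable_fading : Measurable fading := by
  unfold fading
  fun_prop

theorem measurable_equivDist (alpha : ℝ) :
    Measurable fun z : Plane × ℝ => equivDist alpha z.1 z.2 := by
  unfold equivDist
  exact ((measurable_fading.comp measurable_snd).pow_const _).mul measurable_fst.norm

theorem equivDist_nonneg (alpha : ℝ) (x : Plane) (xi : ℝ) : 0 ≤ equivDist alpha x xi :=
  mul_nonneg (Real.rpow_nonneg (fading_pos _).le _) (norm_nonneg _)

/-- A replacement for uniqueness of distribution functions that allows infinite total mass, as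
`radial` requires. -/
theorem ext_of_Iic_of_lt_top {m₁ m₂ : Measure ℝ} (hfin : ∀ v, m₁ (Iic v) < ∞)
    (h : ∀ v, m₁ (Iic v) = m₂ (Iic v)) : m₁ = m₂ := by
  refine Measure.ext_of_Ioc' _ _
    (fun a b _ => ((measure_mono Ioc_subset_Iic_self).trans_lt (hfin b)).ne) fun a b hab => ?_
  rw [← Iic_sdiff_Iic, measure_sdiff (Iic_subset_Iic.2 hab.le) nullMeasurableSet_Iic (hfin a).ne,
    measure_sdiff (Iic_subset_Iic.2 hab.le) nullMeasurableSet_Iic (h a ▸ (hfin a).ne), h, h]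

theorem lintegral_radial (c : ℝ) {f : ℝ → ℝ≥0∞} (hf : Measurable f) :
    ∫⁻ v, f v ∂(radial c) = ∫⁻ v in Ioi 0, ENNReal.ofReal (c * v) * f v := by
  unfold radial
  rw [lintegral_withDensity_eq_lintegral_mul _ (by fun_prop) hf]
  rfl

theorem integral_radial {c : ℝ} (hc : 0 ≤ c) (f : ℝ → ℂ) :
    ∫ v, f v ∂(radial c) = c * ∫ v in Ioi 0, f v * v := by
  unfold radial
  rw [integral_withDensity_eq_integral_toReal_smul (by fun_prop) (by simp),
    ← integral_const_mul]
  refine setIntegral_congr_fun measurableSet_Ioi fun v (hv : 0 < v) => ?_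
  rw [ENNReal.toReal_ofReal (by positivity), Complex.real_smul]
  push_cast
  ring

theorem lintegral_Ioc_mul {c a b : ℝ} (hc : 0 ≤ c) (ha : 0 ≤ a) (hab : a ≤ b) :
    ∫⁻ v in Ioc a b, ENNReal.ofReal (c * v) = ENNReal.ofReal (c * (b ^ 2 - a ^ 2) / 2) := by
  have hint : IntegrableOn (fun v : ℝ => c * v) (Ioc a b) :=
    (Continuous.integrableOn_Icc (by fun_prop)).mono_set Ioc_subset_Icc_self
  rw [← ofReal_integral_eq_lintegral_ofReal hint, ← intervalIntegral.integral_of_le hab,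
    intervalIntegral.integral_const_mul, integral_id]
  · congr 1
    ring
  · filter_upwards [ae_restrict_mem measurableSet_Ioc] with v hv
    have : 0 ≤ v := ha.trans hv.1.le
    positivity

theorem radial_Iic {c : ℝ} (hc : 0 ≤ c) {v : ℝ} (hv : 0 ≤ v) :
    radial c (Iic v) = ENNReal.ofReal (c * v ^ 2 / 2) := by
  unfold radial
  rw [withDensity_apply _ measurableSet_Iic, Measure.restrict_restrict measurableSet_Iic,
    inter_comm, Ioi_inter_Iic, lintegral_Ioc_mul hc le_rfl hv]
  simp

theorem radial_Iic_of_nonpos (c : ℝ) {v : ℝ} (hv : v ≤ 0) : radial c (Iic v) = 0 := by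
  unfold radial
  rw [withDensity_apply _ measurableSet_Iic, Measure.restrict_restrict measurableSet_Iic,
    inter_comm, Ioi_inter_Iic, Ioc_eq_empty (by simpa using hv)]
  simp

theorem equivDist_le_iff (alpha : ℝ) (x : Plane) (xi v : ℝ) :
    equivDist alpha x xi ≤ v ↔ ‖x‖ ≤ v * Real.exp (kappa * xi / alpha) := by
  unfold equivDist fading
  rw [← Real.exp_mul, show kappa * xi * (-1 / alpha) = -(kappa * xi / alpha) by ring,
    Real.exp_neg, inv_mul_le_iff₀ (Real.exp_pos _), mul_comm]

/-- The Gaussian moment generating function at `2κ/α`. -/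
theorem lintegral_exp_shadowLaw (σ : ℝ≥0) (alpha : ℝ) :
    ∫⁻ xi, ENNReal.ofReal (Real.exp (kappa * xi / alpha) ^ 2) ∂(shadowLaw σ) =
      ENNReal.ofReal (fadingFactor σ alpha) := by
  have h1 : ∀ xi : ℝ, Real.exp (kappa * xi / alpha) ^ 2 = Real.exp (2 * kappa / alpha * xi) :=
    fun xi => by
      rw [← Real.exp_nat_mul]
      congr 1
      push_cast
      ring
  simp_rw [h1]
  unfold shadowLaw
  rw [← ofReal_integral_eq_lintegral_ofReal (integrable_exp_mul_gaussianReal _)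
    (.of_forall fun _ => (Real.exp_pos _).le)]
  have := congrFun (mgf_id_gaussianReal (μ := 0) (v := σ ^ 2)) (2 * kappa / alpha)
  simp only [mgf, id] at this
  rw [this]
  unfold fadingFactor
  congr 2
  push_cast
  ring

/-- For a fixed shadowing `ξ`, equivalent distance at most `v` describes a disc of radius `v exp (κ
ξ / α)`. Averaging its area over `ξ` multiplies `π v²` by the fading factor. -/
theorem map_equivDist {lam : ℝ} (hlam : 0 ≤ lam) (σ : ℝ≥0) (alpha : ℝ) :
    ((homogeneous lam).prod (shadowLaw σ)).map (fun z => equivDist alpha z.1 z.2) =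
      radial (2 * Real.pi * lam * fadingFactor σ alpha) := by
  have he : 0 < fadingFactor σ alpha := Real.exp_pos _
  have key : ∀ v, ((homogeneous lam).prod (shadowLaw σ)).map
      (fun z => equivDist alpha z.1 z.2) (Iic v) =
      radial (2 * Real.pi * lam * fadingFactor σ alpha) (Iic v) := by
    intro v
    have hm := measurable_equivDist alpha
    rw [Measure.map_apply hm measurableSet_Iic]
    rcases lt_or_ge v 0 with hv | hv
    · rw [radial_Iic_of_nonpos _ hv.le]
      convert measure_empty (μ := (homogeneous lam).prod (shadowLaw σ))
      refine eq_empty_of_forall_notMem fun z hz => ?_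
      exact (hv.trans_le (equivDist_nonneg alpha z.1 z.2)).not_ge hz
    · rw [radial_Iic (by positivity) hv, Measure.prod_apply_symm (hm measurableSet_Iic)]
      have hsec : ∀ xi : ℝ, homogeneous lam ((fun x => (x, xi)) ⁻¹'
          ((fun z : Plane × ℝ => equivDist alpha z.1 z.2) ⁻¹' Iic v)) =
          ENNReal.ofReal (lam * v ^ 2 * Real.pi) *
            ENNReal.ofReal (Real.exp (kappa * xi / alpha) ^ 2) := fun xi => by
        have : (fun x => (x, xi)) ⁻¹' ((fun z : Plane × ℝ => equivDist alpha z.1 z.2) ⁻¹' Iic v) =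
            Metric.closedBall (0 : Plane) (v * Real.exp (kappa * xi / alpha)) := by
          ext x
          simp [equivDist_le_iff]
        rw [this, homogeneous, Measure.smul_apply, InnerProductSpace.volume_closedBall_of_dim_even
          (k := 1) (by simp)]
        rw [smul_eq_mul, finrank_euclideanSpace, ← ENNReal.ofReal_pow (by positivity),
          ← ENNReal.ofReal_mul (by positivity), ← ENNReal.ofReal_mul (by positivity),
          ← ENNReal.ofReal_mul (by positivity)]
        congr 1
        simp
        ring
      simp_rw [hsec]
      rw [lintegral_const_mul _ (by fun_prop), lintegral_exp_shadowLaw,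
        ← ENNReal.ofReal_mul (by positivity)]
      congr 1
      ring
  refine ext_of_Iic_of_lt_top (fun v => ?_) key
  rw [key]
  rcases le_total v 0 with hv | hv
  · rw [radial_Iic_of_nonpos _ hv]
    exact ENNReal.zero_lt_top
  · rw [radial_Iic (by positivity) hv]
    exact ENNReal.ofReal_lt_top

/-- The shadowing is consumed by the equivalent distance while the second mark (distance to the own
base station, or coin) passes through independently. -/
theorem map_equivDist_mark {F : Type*} [MeasurableSpace F] {lam : ℝ} (hlam : 0 ≤ lam) (σ : ℝ≥0)
    (alpha : ℝ) (κ : Measure F) [SFinite κ] :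
    ((homogeneous lam).prod ((shadowLaw σ).prod κ)).map
        (fun z => (equivDist alpha z.1 z.2.1, z.2.2)) =
      (radial (2 * Real.pi * lam * fadingFactor σ alpha)).prod κ := by
  have h1 := Measure.map_prod_map ((homogeneous lam).prod (shadowLaw σ)) κ
    (measurable_equivDist alpha) measurable_id
  rw [map_equivDist hlam, Measure.map_id] at h1
  rw [h1, ← Measure.prodAssoc_prod, Measure.map_map]
  · congr
  · exact ((measurable_equivDist alpha).comp
      (measurable_fst.prodMk (measurable_fst.comp measurable_snd))).prodMk
      (measurable_snd.comp measurable_snd)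
  · exact MeasurableEquiv.prodAssoc.measurable

end Geometry

/-! ### Existence and measurability of the index of the largest term. -/

section Strongest

theorem le_strongest {v : ℕ → ℝ} (h : ∃ j, ∀ k, v k ≤ v j) (k : ℕ) : v k ≤ v (strongest v) :=
  Nat.sInf_mem (s := {j | ∀ k, v k ≤ v j}) h k

/-- Only finitely many terms reach the level of a given positive term, and the maximum over these is
a global one. -/
theorem exists_forall_le {v : ℕ → ℝ} (hlim : Tendsto v cofinite (𝓝 0)) (hpos : ∃ j, 0 < v j) :
    ∃ j, ∀ k, v k ≤ v j := by
  obtain ⟨i, hi⟩ := hpos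
  have hfin : {k | v i ≤ v k}.Finite := by
    have := hlim.eventually (gt_mem_nhds hi)
    simpa [Filter.eventually_cofinite] using this
  obtain ⟨j, hj, hmax⟩ := hfin.exists_maximalFor v _ ⟨i, le_refl (v i)⟩
  refine ⟨j, fun k => ?_⟩
  rcases le_total (v i) (v k) with hk | hk
  · rcases le_total (v j) (v k) with h | h
    · exact hmax hk h
    · exact h
  · exact hk.trans hj

/-- If no term is maximal, the infimum of the empty set is 0. This default adds a separate piece to
the fibre over 0. -/
theorem measurable_strongest {Ω : Type*} [MeasurableSpace Ω] {v : Ω → ℕ → ℝ}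
    (hv : ∀ k, Measurable fun ω => v ω k) : Measurable fun ω => strongest (v ω) := by
  have hS : ∀ j, MeasurableSet {ω | ∀ k, v ω k ≤ v ω j} := fun j => by
    simp_rw [ofPred_forall]
    exact MeasurableSet.iInter fun k => measurableSet_le (hv k) (hv j)
  refine measurable_to_countable' fun n => ?_
  have h0 : ∀ ω, strongest (v ω) = n ↔
      ((∀ k, v ω k ≤ v ω n) ∧ ∀ j < n, ¬ ∀ k, v ω k ≤ v ω j) ∨
        (n = 0 ∧ ∀ j, ¬ ∀ k, v ω k ≤ v ω j) := fun ω => by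
    constructor
    · intro h
      by_cases hne : ∃ j, ∀ k, v ω k ≤ v ω j
      · left
        refine ⟨h ▸ le_strongest hne, fun j hj hj2 => ?_⟩
        exact (Nat.sInf_le (s := {j | ∀ k, v ω k ≤ v ω j}) hj2).not_gt (hj.trans_eq h.symm)
      · right
        push Not at hne
        refine ⟨?_, fun j hj => ?_⟩
        · rw [← h]
          refine Nat.sInf_eq_zero.2 (Or.inr (eq_empty_of_forall_notMem fun j hj => ?_))
          obtain ⟨k, hk⟩ := hne j
          exact hk.not_ge (hj k)
        · obtain ⟨k, hk⟩ := hne j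
          exact hk.not_ge (hj k)
    · rintro (⟨h1, h2⟩ | ⟨rfl, h⟩)
      · refine le_antisymm (Nat.sInf_le h1) (le_of_not_gt fun hlt => ?_)
        exact h2 _ hlt (le_strongest ⟨n, h1⟩)
      · exact Nat.sInf_eq_zero.2 (Or.inr (eq_empty_of_forall_notMem h))
  have : (fun ω => strongest (v ω)) ⁻¹' {n} =
      ({ω | ∀ k, v ω k ≤ v ω n} ∩ ⋂ j, ⋂ _ : j < n, {ω | ∀ k, v ω k ≤ v ω j}ᶜ) ∪
        ({ω | n = 0} ∩ ⋂ j, {ω | ∀ k, v ω k ≤ v ω j}ᶜ) := by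
    ext ω
    simp only [mem_preimage, mem_singleton_iff, h0, mem_union, mem_inter_iff, mem_iInter,
      mem_compl_iff, mem_ofPred_eq]
  rw [this]
  exact ((hS n).inter (MeasurableSet.iInter fun j => MeasurableSet.iInter fun _ =>
    (hS j).compl)).union ((MeasurableSet.const _).inter
      (MeasurableSet.iInter fun j => (hS j).compl))

end Strongest

/-! ### Void probabilities and characteristic functions of sums over points. -/

section Functional

variable {Ω E F G : Type*} [MeasurableSpace Ω] [MeasurableSpace E] [MeasurableSpace F]
  [MeasurableSpace G] {X : ℕ → Ω → E} {M : ℕ → Ω → F} {ν : Measure E} {κ : Measure F}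
  {μ : Measure Ω} [IsProbabilityMeasure μ] [IsProbabilityMeasure κ] [SigmaFinite ν]
  {φ : E × F → G} {π : Measure G}

theorem IsMarkedPoisson.measurable_pair {μ : Measure Ω} {κ : Measure F} {ν : Measure E} (h : IsMarkedPoisson X M ν κ μ) (i : ℕ) :
    Measurable fun ω => (X i ω, M i ω) :=
  (h.poisson.measurable i).prodMk (h.measurable_mark i)

/-- By Campbell's formula, a null set of the intensity is null for the law of each single point, and
there are countably many points. -/
theorem IsMarkedPoisson.ae_forall (h : IsMarkedPoisson X M ν κ μ) (hφ : Measurable φ)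
    (hπ : (ν.prod κ).map φ = π) {P : G → Prop} (hP : ∀ᵐ z ∂π, P z) :
    ∀ᵐ ω ∂μ, ∀ i, P (φ (X i ω, M i ω)) := by
  rw [← hπ] at hP
  have h1 := ae_of_ae_map hφ.aemeasurable hP
  rw [← h.sum_map, Measure.ae_sum_iff] at h1
  exact ae_all_iff.2 fun i => ae_of_ae_map (h.measurable_pair i).aemeasurable (h1 i)

theorem IsMarkedPoisson.ae_tsum_comp_ne_top (h : IsMarkedPoisson X M ν κ μ) (hφ : Measurable φ)
    (hπ : (ν.prod κ).map φ = π) {f : G → ℝ} (hf : Measurable f)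
    (hint : ∫⁻ z, min 1 (ENNReal.ofReal (f z)) ∂π ≠ ∞) :
    ∀ᵐ ω ∂μ, ∑' i, ENNReal.ofReal (f (φ (X i ω, M i ω))) ≠ ∞ := by
  refine h.ae_tsum_ne_top (f := fun z => ENNReal.ofReal (f (φ z)))
    (hf.comp hφ).ennreal_ofReal (fun _ => ENNReal.ofReal_ne_top) ?_
  rw [← hπ, lintegral_map (measurable_const.min hf.ennreal_ofReal) hφ] at hint
  exact hint

theorem norm_one_sub_exp_le (x : ℝ) : ‖1 - Complex.exp (-(Complex.I * x))‖ ≤ min 2 |x| := by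
  have h1 : ‖Complex.exp (-(Complex.I * x))‖ = 1 := by
    rw [Complex.norm_exp]
    simp
  refine le_min ?_ ?_
  · refine (norm_sub_le _ _).trans ?_
    rw [h1]
    norm_num
  · rw [norm_sub_rev]
    have := Real.norm_exp_I_mul_ofReal_sub_one_le (x := -x)
    simpa using this

theorem norm_exp_neg_I_mul (x : ℝ) : ‖Complex.exp (-(Complex.I * x))‖ = 1 := by
  rw [Complex.norm_exp]
  simp

theorem enorm_one_sub_exp_le (w : ℝ) {x : ℝ} (hx : 0 ≤ x) :
    ‖1 - Complex.exp (-(Complex.I * w * x))‖ₑ ≤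
      ENNReal.ofReal (2 + |w|) * min 1 (ENNReal.ofReal x) := by
  rw [← ENNReal.ofReal_one, ← ENNReal.ofReal_min, ← ENNReal.ofReal_mul (by positivity),
    ← ofReal_norm]
  refine ENNReal.ofReal_le_ofReal ?_
  have := norm_one_sub_exp_le (w * x)
  push_cast at this
  rw [← mul_assoc] at this
  refine this.trans ?_
  rw [abs_mul, abs_of_nonneg hx]
  rcases le_total 1 x with h | h
  · rw [min_eq_left h]
    exact (min_le_left _ _).trans (by linarith [abs_nonneg w])
  · rw [min_eq_right h]
    exact (min_le_right _ _).trans (by nlinarith)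

/-- The integrand of the exponent of the generating functional that combines a void probability
with a characteristic function. -/
theorem integrable_one_sub_indicator {A : Set G} (hA : MeasurableSet A) (hAfin : π A ≠ ∞)
    {f : G → ℝ} (hf : Measurable f) (hf0 : ∀ z, 0 ≤ f z)
    (hint : ∫⁻ z, min 1 (ENNReal.ofReal (f z)) ∂π ≠ ∞) (w : ℝ) :
    Integrable (fun z => 1 - Aᶜ.indicator
      (fun z => Complex.exp (-(Complex.I * w * (f z : ℝ)))) z) π := by
  have hgm : Measurable fun z => Complex.exp (-(Complex.I * w * (f z : ℝ))) := by fun_prop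
  refine ⟨(measurable_const.sub (hgm.indicator hA.compl)).aestronglyMeasurable, ?_⟩
  have hb : ∀ z, ‖1 - Aᶜ.indicator
      (fun z => Complex.exp (-(Complex.I * w * (f z : ℝ)))) z‖ₑ ≤
      A.indicator 1 z + ENNReal.ofReal (2 + |w|) * min 1 (ENNReal.ofReal (f z)) := fun z => by
    by_cases hz : z ∈ A
    · rw [indicator_of_notMem (by simpa using hz), indicator_of_mem hz]
      simp
    · rw [indicator_of_mem (by simpa using hz), indicator_of_notMem hz, zero_add]
      exact enorm_one_sub_exp_le w (hf0 z)
  refine (lintegral_mono hb).trans_lt ?_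
  rw [lintegral_add_left (measurable_one.indicator hA), lintegral_indicator_one hA,
    lintegral_const_mul _ (measurable_const.min hf.ennreal_ofReal)]
  exact ENNReal.add_lt_top.2 ⟨hAfin.lt_top, ENNReal.mul_lt_top ENNReal.ofReal_lt_top hint.lt_top⟩

/-- The characteristic function of a sum over the points, on the event that no point falls
into `A`. -/
theorem IsMarkedPoisson.integral_void_exp (h : IsMarkedPoisson X M ν κ μ) (hφ : Measurable φ)
    (hπ : (ν.prod κ).map φ = π) {A : Set G} (hA : MeasurableSet A) (hAfin : π A ≠ ∞)
    {f : G → ℝ} (hf : Measurable f) (hf0 : ∀ z, 0 ≤ f z)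
    (hint : ∫⁻ z, min 1 (ENNReal.ofReal (f z)) ∂π ≠ ∞) (w : ℝ) :
    ∫ ω, {ω | ∀ i, φ (X i ω, M i ω) ∉ A}.indicator (fun ω => Complex.exp (-(Complex.I * w *
      ((∑' i, ENNReal.ofReal (f (φ (X i ω, M i ω)))).toReal : ℝ)))) ω ∂μ =
      Complex.exp (-∫ z, (1 - Aᶜ.indicator
        (fun z => Complex.exp (-(Complex.I * w * (f z : ℝ)))) z) ∂π) := by
  -- The product of `g` over the points vanishes as soon as one point lies in `A`, and otherwise is
  -- the exponential of the sum. A single generating functional thus encodes both the void event and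
  -- the characteristic function.
  set g : G → ℂ := Aᶜ.indicator fun z => Complex.exp (-(Complex.I * w * (f z : ℝ))) with hg
  have hgm : Measurable g := by
    refine Measurable.indicator ?_ hA.compl
    fun_prop
  have hgb : ∀ z, ‖g z‖ ≤ 1 := fun z => by
    refine (norm_indicator_le_norm_self _ _).trans ?_
    have := norm_exp_neg_I_mul (w * f z)
    push_cast at this
    rw [← mul_assoc] at this
    exact this.le
  have hgi := integrable_one_sub_indicator hA hAfin hf hf0 hint w
  have h1 := h.tendsto_integral_prod (g := fun z => g (φ z)) (hgm.comp hφ) (fun z => hgb _) (by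
    rw [← hπ] at hgi
    exact hgi.comp_measurable hφ)
  rw [← hπ, integral_map (f := fun z => 1 - g z) hφ.aemeasurable (measurable_const.sub hgm).aestronglyMeasurable]
  refine tendsto_nhds_unique ?_ h1
  refine tendsto_integral_of_dominated_convergence (fun _ => 1) (fun n => ?_)
    (integrable_const _) (fun n => .of_forall fun ω => norm_finset_prod_le_one _ fun i => hgb _) ?_
  · exact (Finset.measurable_fun_prod _ fun i _ =>
      (hgm.comp hφ).comp (h.measurable_pair i)).aestronglyMeasurable
  · filter_upwards [h.ae_tsum_comp_ne_top hφ hπ hf hint] with ω hω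
    by_cases hv : ∀ i, φ (X i ω, M i ω) ∉ A
    · rw [indicator_of_mem (by simpa using hv)]
      have hprod : ∀ n, ∏ i ∈ Finset.range n, g (φ (X i ω, M i ω)) =
          Complex.exp (-(Complex.I * w *
            ((∑ i ∈ Finset.range n, f (φ (X i ω, M i ω)) : ℝ) : ℂ))) := fun n => by
        rw [Complex.ofReal_sum, Finset.mul_sum, ← Finset.sum_neg_distrib, Complex.exp_sum]
        exact Finset.prod_congr rfl fun i _ => indicator_of_mem (by simpa using hv i) _
      simp_rw [hprod]
      refine ((Complex.continuous_exp.comp (continuous_const.mul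
        Complex.continuous_ofReal).neg).tendsto _).comp ?_
      have hs := ENNReal.hasSum_toReal hω
      rw [← ENNReal.tsum_toReal_eq fun i => ENNReal.ofReal_ne_top] at hs
      simp_rw [ENNReal.toReal_ofReal (hf0 _)] at hs
      exact hs.tendsto_sum_nat
    · rw [indicator_of_notMem (by simpa using hv)]
      push Not at hv
      obtain ⟨i, hi⟩ := hv
      refine tendsto_const_nhds.congr' ?_
      filter_upwards [eventually_gt_atTop i] with n hn
      exact (Finset.prod_eq_zero (Finset.mem_range.2 hn)
        (indicator_of_notMem (s := Aᶜ) (fun hn => hn hi) _)).symm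

/-- Void probabilities. -/
theorem IsMarkedPoisson.measure_void (h : IsMarkedPoisson X M ν κ μ) (hφ : Measurable φ)
    (hπ : (ν.prod κ).map φ = π) {A : Set G} (hA : MeasurableSet A) (hAfin : π A ≠ ∞) :
    μ {ω | ∀ i, φ (X i ω, M i ω) ∉ A} = ENNReal.ofReal (Real.exp (-π.real A)) := by
  have h1 := h.integral_void_exp hφ hπ hA hAfin (f := fun _ => 0) measurable_const
    (fun _ => le_rfl) (by simp) 0
  have hm : MeasurableSet {ω | ∀ i, φ (X i ω, M i ω) ∉ A} := by
    rw [ofPred_forall]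
    exact MeasurableSet.iInter fun i => (hφ.comp (h.measurable_pair i)) hA.compl
  have h2 : ∀ z, 1 - Aᶜ.indicator (fun _ : G => (1 : ℂ)) z = A.indicator (fun _ => 1) z :=
    fun z => by by_cases hz : z ∈ A <;> simp [hz]
  simp only [Complex.ofReal_zero, mul_zero, zero_mul, neg_zero, Complex.exp_zero, h2]
    at h1
  rw [integral_indicator_const _ hm, integral_indicator_const _ hA] at h1
  simp only [Complex.real_smul, mul_one] at h1
  rw [← ofReal_measureReal]
  congr 1
  exact_mod_cast h1

end Functional

/-! ### The Rayleigh law and integrability of truncated power laws. -/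

section Rayleigh

/-- The Rayleigh distribution of density `c r exp (-c r² / 2)`: the law of the smallest point of a
Poisson process of intensity `radial c`. -/
noncomputable def rayleigh (c : ℝ) : Measure ℝ :=
  (volume.restrict (Ioi 0)).withDensity
    fun r => ENNReal.ofReal (c * r * Real.exp (-(c * r ^ 2 / 2)))

theorem hasDerivAt_exp_neg_sq (c r : ℝ) :
    HasDerivAt (fun r => -Real.exp (-(c * r ^ 2 / 2))) (c * r * Real.exp (-(c * r ^ 2 / 2))) r := by
  have h1 : HasDerivAt (fun r => -(c * r ^ 2 / 2)) (-(c * r)) r := by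
    refine (((hasDerivAt_pow 2 r).const_mul c).div_const 2).neg.congr_deriv ?_
    push_cast
    ring
  refine h1.exp.neg.congr_deriv ?_
  ring

theorem tendsto_exp_neg_sq {c : ℝ} (hc : 0 < c) :
    Tendsto (fun r : ℝ => Real.exp (-(c * r ^ 2 / 2))) atTop (𝓝 0) := by
  refine Real.tendsto_exp_neg_atTop_nhds_zero.comp ?_
  exact ((tendsto_pow_atTop two_ne_zero).const_mul_atTop hc).atTop_div_const two_pos

theorem lintegral_rayleigh_Ioi {c a : ℝ} (hc : 0 < c) (ha : 0 ≤ a) :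
    IntegrableOn (fun r => c * r * Real.exp (-(c * r ^ 2 / 2))) (Ioi a) ∧
      rayleigh c (Ioi a) = ENNReal.ofReal (Real.exp (-(c * a ^ 2 / 2))) := by
  have hnn : ∀ r ∈ Ioi a, 0 ≤ c * r * Real.exp (-(c * r ^ 2 / 2)) := fun r hr => by
    have : 0 ≤ r := ha.trans (le_of_lt hr)
    positivity
  have hlim : Tendsto (fun r : ℝ => -Real.exp (-(c * r ^ 2 / 2))) atTop (𝓝 0) := by
    simpa using (tendsto_exp_neg_sq hc).neg
  have hint := integrableOn_Ioi_deriv_of_nonneg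
    (hasDerivAt_exp_neg_sq c a).continuousAt.continuousWithinAt
    (fun r _ => hasDerivAt_exp_neg_sq c r) hnn hlim
  refine ⟨hint, ?_⟩
  unfold rayleigh
  rw [withDensity_apply _ measurableSet_Ioi, Measure.restrict_restrict measurableSet_Ioi,
    Ioi_inter_Ioi, max_eq_left ha, ← ofReal_integral_eq_lintegral_ofReal hint
    ((ae_restrict_mem measurableSet_Ioi).mono hnn), integral_Ioi_of_hasDerivAt_of_tendsto
    (hasDerivAt_exp_neg_sq c a).continuousAt.continuousWithinAt
    (fun r _ => hasDerivAt_exp_neg_sq c r) hint hlim]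
  simp

theorem rayleigh_Iic_zero (c : ℝ) : rayleigh c (Iic 0) = 0 := by
  unfold rayleigh
  rw [withDensity_apply _ measurableSet_Iic, Measure.restrict_restrict measurableSet_Iic,
    inter_comm, Ioi_inter_Iic, Ioc_self]
  simp

theorem isProbabilityMeasure_rayleigh {c : ℝ} (hc : 0 < c) : IsProbabilityMeasure (rayleigh c) := by
  constructor
  rw [← Iic_union_Ioi (a := (0 : ℝ)), measure_union (Iic_disjoint_Ioi le_rfl) measurableSet_Ioi,
    rayleigh_Iic_zero, (lintegral_rayleigh_Ioi hc le_rfl).2]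
  simp

theorem eq_rayleigh {c : ℝ} (hc : 0 < c) {m : Measure ℝ} [IsProbabilityMeasure m]
    (h : ∀ a, 0 ≤ a → m (Ioi a) = ENNReal.ofReal (Real.exp (-(c * a ^ 2 / 2)))) :
    m = rayleigh c := by
  have := isProbabilityMeasure_rayleigh hc
  refine Measure.ext_of_Iic _ _ fun a => ?_
  have key : ∀ a, 0 ≤ a → m (Iic a) = rayleigh c (Iic a) := fun a ha => by
    rw [← compl_Ioi, prob_compl_eq_one_sub measurableSet_Ioi,
      prob_compl_eq_one_sub measurableSet_Ioi, h a ha, (lintegral_rayleigh_Ioi hc ha).2]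
  rcases le_total 0 a with ha | ha
  · exact key a ha
  · rw [measure_mono_null (Iic_subset_Iic.2 ha) (rayleigh_Iic_zero c),
      measure_mono_null (Iic_subset_Iic.2 ha) ((key 0 le_rfl).trans (rayleigh_Iic_zero c))]

theorem ae_pos_radial (c : ℝ) : ∀ᵐ v ∂(radial c), 0 < v := by
  unfold radial
  exact (withDensity_absolutelyContinuous _ _).ae_le (ae_restrict_mem measurableSet_Ioi)

theorem ae_pos_rayleigh (c : ℝ) : ∀ᵐ v ∂(rayleigh c), 0 < v := by
  unfold rayleigh
  exact (withDensity_absolutelyContinuous _ _).ae_le (ae_restrict_mem measurableSet_Ioi)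

/-- On `(0, 1]` the truncation leaves only the integrable density `c v`. Beyond 1 the integrand is
at most a multiple of `v ^ (1 - α)`, which is integrable because `α > 2`. -/
theorem lintegral_min_one_radial {c alpha : ℝ} (hc : 0 ≤ c) (K : ℝ) (halpha : 2 < alpha) :
    ∫⁻ v, min 1 (ENNReal.ofReal (K * v ^ (-alpha))) ∂(radial c) ≠ ∞ := by
  rw [lintegral_radial _ (by fun_prop), ← Ioc_union_Ioi_eq_Ioi zero_le_one]
  refine ne_top_of_le_ne_top ?_ (lintegral_union_le _ _ _)
  refine ENNReal.add_ne_top.2 ⟨?_, ?_⟩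
  · refine ne_top_of_le_ne_top ?_ (lintegral_mono (g := fun v => ENNReal.ofReal (c * v)) fun v =>
      mul_le_of_le_one_right' (min_le_left _ _))
    rw [lintegral_Ioc_mul hc le_rfl zero_le_one]
    exact ENNReal.ofReal_ne_top
  · have hint : IntegrableOn (fun v : ℝ => c * (|K| * v ^ (1 - alpha))) (Ioi 1) :=
      ((integrableOn_Ioi_rpow_of_lt (by linarith) one_pos).const_mul _).const_mul _
    refine ne_top_of_le_ne_top hint.lintegral_lt_top.ne
      (setLIntegral_mono' measurableSet_Ioi fun v (hv : 1 < v) => ?_)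
    have hv0 : 0 < v := one_pos.trans hv
    refine (mul_le_mul_right (min_le_right _ _) _).trans ?_
    rw [← ENNReal.ofReal_mul (by positivity)]
    refine ENNReal.ofReal_le_ofReal ?_
    rw [sub_eq_add_neg, Real.rpow_add hv0, Real.rpow_one]
    have : K * v ^ (-alpha) ≤ |K| * v ^ (-alpha) := by gcongr; exact le_abs_self K
    calc c * v * (K * v ^ (-alpha)) ≤ c * v * (|K| * v ^ (-alpha)) := by gcongr
      _ = _ := by ring

end Rayleigh

/-! ### Mode selection and the law of the distance to the serving base station. -/

section BaseStations

/-- The exponent `-1/α` in the equivalent distance is chosen so that the fading coefficient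
reappears with exponent 1. -/
theorem power_eq_equivDist {alpha : ℝ} (halpha : alpha ≠ 0) (K : ℝ) (x : Plane) (xi : ℝ) :
    K * fading xi * ‖x‖ ^ (-alpha) = K * equivDist alpha x xi ^ (-alpha) := by
  unfold equivDist
  rw [Real.mul_rpow (Real.rpow_nonneg (fading_pos _).le _) (norm_nonneg _),
    ← Real.rpow_mul (fading_pos _).le, show -1 / alpha * -alpha = 1 by field_simp, Real.rpow_one]
  ring

theorem power_le_power_iff {K alpha v u : ℝ} (hK : 0 < K) (halpha : 0 < alpha) (hv : 0 < v)
    (hu : 0 < u) : K * v ^ (-alpha) ≤ K * u ^ (-alpha) ↔ u ≤ v := by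
  rw [mul_le_mul_iff_right₀ hK, Real.rpow_le_rpow_iff_of_neg hv hu (by linarith)]

theorem fadingFactor_pos (σ : ℝ≥0) (alpha : ℝ) : 0 < fadingFactor σ alpha := Real.exp_pos _

/-- The intensity of the equivalent distances of the base stations is `radial p.rateB`. -/
noncomputable def Params.rateB (p : Params) : ℝ :=
  2 * Real.pi * p.lamB * fadingFactor p.sigmaB p.alphaB

theorem Params.rateB_pos (p : Params) : 0 < p.rateB := by
  have := p.lamB_pos
  have := fadingFactor_pos p.sigmaB p.alphaB
  unfold Params.rateB
  positivity

theorem Params.alphaB_pos (p : Params) : 0 < p.alphaB := two_pos.trans p.two_lt_alphaB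

theorem Params.alphaD_pos (p : Params) : 0 < p.alphaD := two_pos.trans p.two_lt_alphaD

theorem tMax_pos (p : Params) : 0 < tMax p :=
  Real.rpow_pos_of_pos (div_pos p.beta_pos (mul_pos p.AB_pos p.PB_pos)) _

theorem qCellular_eq (p : Params) : qCellular p = 1 - Real.exp (-(p.rateB * tMax p ^ 2 / 2)) := by
  have hA := mul_pos p.AB_pos p.PB_pos
  have ht : tMax p ^ 2 = (p.AB * p.PB / p.beta) ^ (2 / p.alphaB) := by
    unfold tMax
    rw [← Real.rpow_mul_natCast (div_pos p.beta_pos hA).le, ← inv_div p.beta,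
      Real.inv_rpow (div_pos p.beta_pos hA).le, ← Real.rpow_neg (div_pos p.beta_pos hA).le]
    congr 1
    push_cast
    ring
  unfold qCellular Params.rateB
  rw [ht]
  ring_nf

theorem qCellular_pos (p : Params) : 0 < qCellular p := by
  have := tMax_pos p
  have := p.rateB_pos
  rw [qCellular_eq, sub_pos, Real.exp_lt_one_iff]
  have : 0 < p.rateB * tMax p ^ 2 / 2 := by positivity
  linarith

theorem qCellular_lt_one (p : Params) : qCellular p < 1 := by
  unfold qCellular
  linarith [Real.exp_pos (-(Real.pi * p.lamB * (p.AB * p.PB / p.beta) ^ (2 / p.alphaB) *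
    fadingFactor p.sigmaB p.alphaB))]

/-- `tMax` is the distance at which the received power equals `β`, and the power decreases with
distance. -/
theorem beta_lt_power_iff (p : Params) {v : ℝ} (hv : 0 < v) :
    p.beta < p.AB * p.PB * v ^ (-p.alphaB) ↔ v < tMax p := by
  have hA := mul_pos p.AB_pos p.PB_pos
  have hb : p.beta = p.AB * p.PB * tMax p ^ (-p.alphaB) := by
    unfold tMax
    rw [← Real.rpow_mul (div_pos p.beta_pos hA).le, show -1 / p.alphaB * -p.alphaB = 1 by
      have := p.alphaB_pos.ne'
      field_simp, Real.rpow_one]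
    have := p.AB_pos.ne'
    have := p.PB_pos.ne'
    field_simp
  conv_lhs => rw [hb]
  rw [← not_le, power_le_power_iff hA p.alphaB_pos hv (tMax_pos p), not_le]

variable {Ω : Type*} [MeasurableSpace Ω] {μ : Measure Ω} [IsProbabilityMeasure μ] {p : Params}
  {Y : ℕ → Ω → Plane} {xi : ℕ → Ω → ℝ}

/-- Minimal equivalent distances have a Rayleigh law. -/
theorem map_eq_rayleigh {c : ℝ} (hc : 0 < c) {R : Ω → ℝ} (hR : Measurable R)
    (h : ∀ a, 0 ≤ a → μ {ω | a < R ω} = ENNReal.ofReal (Real.exp (-(c * a ^ 2 / 2)))) :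
    μ.map R = rayleigh c := by
  have := Measure.isProbabilityMeasure_map (μ := μ) hR.aemeasurable
  refine eq_rayleigh hc fun a ha => ?_
  rw [Measure.map_apply hR measurableSet_Ioi]
  exact h a ha

theorem measurable_rxBS {μ : Measure Ω}
    (hY : IsMarkedPoisson Y xi (homogeneous p.lamB) (shadowLaw p.sigmaB) μ)
    (k : ℕ) : Measurable fun ω => rxBS p Y xi ω k := by
  unfold rxBS
  exact (measurable_const.mul (measurable_fading.comp (hY.measurable_mark k))).mul
    ((hY.poisson.measurable k).norm.pow_const _)

theorem measurable_eval_nat {S : Type*} [MeasurableSpace S] {f : ℕ → Ω → S}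
    (hf : ∀ k, Measurable (f k)) {n : Ω → ℕ} (hn : Measurable n) : Measurable fun ω => f (n ω) ω :=
  (measurable_from_prod_countable_right (f := fun z : ℕ × Ω => f z.1 z.2) hf).comp
    (hn.prodMk measurable_id)

theorem measurable_servingDist {μ : Measure Ω}
    (hY : IsMarkedPoisson Y xi (homogeneous p.lamB) (shadowLaw p.sigmaB) μ) :
    Measurable (servingDist p Y xi) :=
  measurable_eval_nat (f := fun k ω => equivDist p.alphaB (Y k ω) (xi k ω))
    (fun k => (measurable_equivDist p.alphaB).comp (hY.measurable_pair k))
    (measurable_strongest (measurable_rxBS hY))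

/-- Almost surely the strongest base station exists, at a positive minimal equivalent distance. -/
theorem ae_servingDist_spec
    (hY : IsMarkedPoisson Y xi (homogeneous p.lamB) (shadowLaw p.sigmaB) μ) :
    ∀ᵐ ω ∂μ, 0 < servingDist p Y xi ω ∧
      (∀ i, servingDist p Y xi ω ≤ equivDist p.alphaB (Y i ω) (xi i ω)) ∧
      (ω ∈ cellularMode p Y xi ↔ servingDist p Y xi ω < tMax p) := by
  have hA := mul_pos p.AB_pos p.PB_pos
  have hφ := measurable_equivDist p.alphaB
  have hπ := map_equivDist p.lamB_pos.le p.sigmaB p.alphaB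
  have hrx : ∀ ω k, rxBS p Y xi ω k =
      p.AB * p.PB * equivDist p.alphaB (Y k ω) (xi k ω) ^ (-p.alphaB) := fun ω k =>
    power_eq_equivDist p.alphaB_pos.ne' _ _ _
  filter_upwards [hY.ae_forall hφ hπ (ae_pos_radial _), hY.ae_tsum_comp_ne_top hφ hπ
    (f := fun v => p.AB * p.PB * v ^ (-p.alphaB)) (by fun_prop)
    (lintegral_min_one_radial p.rateB_pos.le _ p.two_lt_alphaB)] with ω hpos hsum
  have hrxpos : ∀ k, 0 < rxBS p Y xi ω k := fun k => by
    rw [hrx]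
    exact mul_pos hA (Real.rpow_pos_of_pos (hpos k) _)
  -- A finite total power forces the individual powers to 0, so that a strongest station exists and
  -- `strongest` does not take its default value.
  have hlim : Tendsto (rxBS p Y xi ω) cofinite (𝓝 0) := by
    have := (ENNReal.tendsto_toReal ENNReal.zero_ne_top).comp
      (ENNReal.tendsto_cofinite_zero_of_tsum_ne_top hsum)
    refine this.congr fun k => ?_
    rw [Function.comp_apply, ← hrx, ENNReal.toReal_ofReal (hrxpos k).le]
  have hmax := le_strongest (exists_forall_le hlim ⟨0, hrxpos 0⟩)
  refine ⟨hpos _, fun i => ?_, ?_⟩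
  · have := hmax i
    rw [hrx, hrx] at this
    exact (power_le_power_iff hA p.alphaB_pos (hpos _) (hpos _)).1 this
  · rw [← beta_lt_power_iff p (show 0 < servingDist p Y xi ω from hpos _)]
    exact iff_of_eq (congrArg (p.beta < ·) (hrx ω _))

/-- The strongest station has the smallest equivalent distance, which exceeds `a` exactly when no
station has equivalent distance at most `a`. The void probability is the Rayleigh tail. -/
theorem map_servingDist (hY : IsMarkedPoisson Y xi (homogeneous p.lamB) (shadowLaw p.sigmaB) μ) :
    μ.map (servingDist p Y xi) = rayleigh p.rateB := by
  have hφ := measurable_equivDist p.alphaB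
  have hπ := map_equivDist p.lamB_pos.le p.sigmaB p.alphaB
  refine map_eq_rayleigh p.rateB_pos (measurable_servingDist hY) fun a ha => ?_
  have hI := radial_Iic p.rateB_pos.le ha
  have h0 : 0 ≤ p.rateB * a ^ 2 / 2 := by
    have := p.rateB_pos
    positivity
  have := hY.measure_void hφ hπ (A := Iic a) measurableSet_Iic
    (by
      change radial p.rateB (Iic a) ≠ ∞
      rw [hI]
      exact ENNReal.ofReal_ne_top)
  change _ = ENNReal.ofReal (Real.exp (-(radial p.rateB).real (Iic a))) at this
  rw [measureReal_def, hI, ENNReal.toReal_ofReal h0] at this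
  rw [← this]
  refine measure_congr ?_
  filter_upwards [ae_servingDist_spec hY] with ω ⟨_, hle, _⟩
  refine propext ?_
  change a < servingDist p Y xi ω ↔ ∀ i, equivDist p.alphaB (Y i ω) (xi i ω) ∉ Iic a
  simp only [mem_Iic, not_le]
  exact ⟨fun h i => h.trans_le (hle i), fun h => h _⟩

theorem cellularMode_ae_eq (hY : IsMarkedPoisson Y xi (homogeneous p.lamB) (shadowLaw p.sigmaB) μ) :
    cellularMode p Y xi =ᵐ[μ] servingDist p Y xi ⁻¹' Iio (tMax p) := by
  filter_upwards [ae_servingDist_spec hY] with ω hω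
  exact propext hω.2.2

theorem rayleigh_Iio_tMax (p : Params) :
    rayleigh p.rateB (Iio (tMax p)) = ENNReal.ofReal (qCellular p) := by
  have := isProbabilityMeasure_rayleigh p.rateB_pos
  have hna : rayleigh p.rateB {tMax p} = 0 := by
    unfold rayleigh
    exact withDensity_absolutelyContinuous _ _ (measure_singleton _)
  have h1 : rayleigh p.rateB (Iio (tMax p)) = rayleigh p.rateB (Iic (tMax p)) :=
    measure_congr (Iio_ae_eq_Iic' hna)
  rw [h1, ← compl_Ioi, prob_compl_eq_one_sub measurableSet_Ioi,
    (lintegral_rayleigh_Ioi p.rateB_pos (tMax_pos p).le).2, qCellular_eq,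
    ENNReal.ofReal_sub _ (Real.exp_pos _).le, ENNReal.ofReal_one]

theorem measure_cellularMode
    (hY : IsMarkedPoisson Y xi (homogeneous p.lamB) (shadowLaw p.sigmaB) μ) :
    μ (cellularMode p Y xi) = ENNReal.ofReal (qCellular p) := by
  rw [measure_congr (cellularMode_ae_eq hY), ← Measure.map_apply (measurable_servingDist hY)
    measurableSet_Iio, map_servingDist hY, rayleigh_Iio_tMax]

theorem fCellular_eq (p : Params) (ρ : ℝ) : fCellular p ρ =
    (qCellular p)⁻¹ * (p.rateB * ρ * Real.exp (-(p.rateB * ρ ^ 2 / 2))) := by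
  unfold fCellular Params.rateB
  rw [div_eq_inv_mul]
  congr 4
  ring

/-- The equivalent distance of a cellular UE to its base station has density `fCellular`. -/
theorem cellularDistLaw_eq
    (hY : IsMarkedPoisson Y xi (homogeneous p.lamB) (shadowLaw p.sigmaB) μ) :
    cellularDistLaw p Y xi μ = (volume.restrict (Ioo 0 (tMax p))).withDensity
      fun ρ => ENNReal.ofReal (fCellular p ρ) := by
  have hq := qCellular_pos p
  unfold cellularDistLaw
  rw [ProbabilityTheory.cond, Measure.map_smul, Measure.restrict_congr_set (cellularMode_ae_eq hY),
    ← Measure.restrict_map (measurable_servingDist hY) measurableSet_Iio, map_servingDist hY,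
    measure_cellularMode hY]
  unfold rayleigh
  rw [restrict_withDensity measurableSet_Iio, Measure.restrict_restrict measurableSet_Iio,
    inter_comm, Ioi_inter_Iio, ← withDensity_smul _ (by fun_prop)]
  congr 1
  ext ρ
  rw [fCellular_eq, ENNReal.ofReal_mul (inv_pos.2 hq).le, ENNReal.ofReal_inv_of_pos hq]
  rfl

theorem isProbabilityMeasure_cellularDistLaw
    (hY : IsMarkedPoisson Y xi (homogeneous p.lamB) (shadowLaw p.sigmaB) μ) :
    IsProbabilityMeasure (cellularDistLaw p Y xi μ) := by
  have : IsProbabilityMeasure (cond μ (cellularMode p Y xi)) :=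
    cond_isProbabilityMeasure (by
      rw [measure_cellularMode hY]
      simpa using qCellular_pos p)
  exact Measure.isProbabilityMeasure_map (measurable_servingDist hY).aemeasurable

theorem ae_mem_Ioo_cellularDistLaw
    (hY : IsMarkedPoisson Y xi (homogeneous p.lamB) (shadowLaw p.sigmaB) μ) :
    ∀ᵐ ρ ∂(cellularDistLaw p Y xi μ), ρ ∈ Ioo 0 (tMax p) := by
  rw [cellularDistLaw_eq hY]
  exact (withDensity_absolutelyContinuous _ _).ae_le (ae_restrict_mem measurableSet_Ioo)

theorem integral_cellularDistLaw
    (hY : IsMarkedPoisson Y xi (homogeneous p.lamB) (shadowLaw p.sigmaB) μ) (g : ℝ → ℂ) :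
    ∫ ρ, g ρ ∂(cellularDistLaw p Y xi μ) = ∫ ρ in Ioo 0 (tMax p), g ρ * (fCellular p ρ : ℂ) := by
  rw [cellularDistLaw_eq hY, integral_withDensity_eq_integral_toReal_smul _ (by simp)]
  · refine setIntegral_congr_fun measurableSet_Ioo fun ρ hρ => ?_
    have : 0 ≤ fCellular p ρ := by
      have h1 := qCellular_pos p
      have h2 := p.rateB_pos
      have h3 := hρ.1
      rw [fCellular_eq]
      positivity
    rw [ENNReal.toReal_ofReal this, Complex.real_smul, mul_comm]
  · unfold fCellular
    fun_prop

theorem lamD2D_eq (hY : IsMarkedPoisson Y xi (homogeneous p.lamB) (shadowLaw p.sigmaB) μ) :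
    lamD2D p Y xi μ = (1 - qCellular p) * p.lamU := by
  unfold lamD2D
  rw [measureReal_def, measure_cellularMode hY, ENNReal.toReal_ofReal (qCellular_pos p).le]

end BaseStations

/-! ### The interference from the cellular users. -/

section CellularInterference

variable {Ω : Type*} [MeasurableSpace Ω] {μ : Measure Ω} [IsProbabilityMeasure μ] {p : Params}
  {Y : ℕ → Ω → Plane} {xi : ℕ → Ω → ℝ} {C : ℕ → Ω → Plane} {M : ℕ → Ω → ℝ × ℝ}

/-- The power received from a cellular UE at equivalent distance `z.1` from the origin and `z.2`
from its base station. -/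
noncomputable def cellularPower (p : Params) (z : ℝ × ℝ) : ℝ :=
  max (txCellular p z.2 * p.AB * z.1 ^ (-p.alphaB)) 0

theorem measurable_txCellular (p : Params) : Measurable (txCellular p) := by
  unfold txCellular
  fun_prop

theorem measurable_cellularPower (p : Params) : Measurable (cellularPower p) := by
  have := measurable_txCellular p
  unfold cellularPower
  fun_prop

theorem cellularPower_nonneg (p : Params) (z : ℝ × ℝ) : 0 ≤ cellularPower p z := le_max_right _ _

theorem txCellular_pos (p : Params) {ρ : ℝ} (hρ : 0 < ρ) : 0 < txCellular p ρ :=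
  mul_pos p.P0_pos (Real.rpow_pos_of_pos (div_pos (Real.rpow_pos_of_pos hρ _) p.AB_pos) _)

theorem txCellular_le (p : Params) {ρ t : ℝ} (hρ : 0 < ρ) (ht : ρ ≤ t) :
    txCellular p ρ ≤ txCellular p t := by
  have := p.P0_pos
  have := p.AB_pos
  have := p.alphaB_pos
  have := p.eps_pos
  unfold txCellular
  gcongr

theorem cellularPower_eq (p : Params) {z : ℝ × ℝ} (h1 : 0 < z.1) (h2 : 0 < z.2) :
    cellularPower p z = p.P0 * p.AB ^ (1 - p.eps) * z.2 ^ (p.alphaB * p.eps) *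
      z.1 ^ (-p.alphaB) := by
  unfold cellularPower
  rw [max_eq_left (by
    have := txCellular_pos p h2
    have := p.AB_pos
    positivity)]
  unfold txCellular
  rw [Real.div_rpow (Real.rpow_pos_of_pos h2 _).le p.AB_pos.le, ← Real.rpow_mul h2.le,
    Real.rpow_sub p.AB_pos, Real.rpow_one]
  ring

/-- The truncation at 0 in `cellularPower`, which makes it nonnegative even at irrelevant negative
distances, is invisible after `ENNReal.ofReal`. -/
theorem ofReal_rxCellular {Ω : Type*} (p : Params) (C : ℕ → Ω → Plane) (M : ℕ → Ω → ℝ × ℝ) (ω : Ω)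
    (i : ℕ) :
    ENNReal.ofReal (rxCellular p C M ω i) =
      ENNReal.ofReal (cellularPower p (equivDist p.alphaB (C i ω) (M i ω).1, (M i ω).2)) := by
  unfold rxCellular cellularPower
  rw [power_eq_equivDist p.alphaB_pos.ne' (txCellular p (M i ω).2 * p.AB)]
  simp [ENNReal.ofReal_max]

theorem measurable_interfC (hC : ∀ i, Measurable (C i)) (hM : ∀ i, Measurable (M i)) :
    Measurable (interfC p C M) := by
  unfold interfC
  refine Measurable.tsum fun i => ?_
  simp_rw [ofReal_rxCellular]
  exact ((measurable_cellularPower p).comp (((measurable_equivDist p.alphaB).comp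
    ((hC i).prodMk (measurable_fst.comp (hM i)))).prodMk
      (measurable_snd.comp (hM i)))).ennreal_ofReal

theorem measurable_markedDist {F : Type*} [MeasurableSpace F] (alpha : ℝ) :
    Measurable fun z : Plane × ℝ × F => (equivDist alpha z.1 z.2.1, z.2.2) :=
  ((measurable_equivDist alpha).comp
    (measurable_fst.prodMk (measurable_fst.comp measurable_snd))).prodMk
    (measurable_snd.comp measurable_snd)

theorem ae_pos_mem_Ioo
    (hY : IsMarkedPoisson Y xi (homogeneous p.lamB) (shadowLaw p.sigmaB) μ) :
    ∀ᵐ z ∂((radial p.rateB).prod (cellularDistLaw p Y xi μ)), 0 < z.1 ∧ z.2 ∈ Ioo 0 (tMax p) := by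
  have := isProbabilityMeasure_cellularDistLaw hY
  exact (Measure.quasiMeasurePreserving_fst.ae (ae_pos_radial p.rateB)).and
    (Measure.quasiMeasurePreserving_snd.ae (ae_mem_Ioo_cellularDistLaw hY))

/-- In cellular mode the distance to the own base station stays below `tMax`, which bounds the
transmit power by a constant and reduces the estimate to one radial variable. -/
theorem lintegral_min_one_cellularPower
    (hY : IsMarkedPoisson Y xi (homogeneous p.lamB) (shadowLaw p.sigmaB) μ) :
    ∫⁻ z, min 1 (ENNReal.ofReal (cellularPower p z))
      ∂((radial p.rateB).prod (cellularDistLaw p Y xi μ)) ≠ ∞ := by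
  have := isProbabilityMeasure_cellularDistLaw hY
  refine ne_top_of_le_ne_top (lintegral_min_one_radial p.rateB_pos.le
    (txCellular p (tMax p) * p.AB) p.two_lt_alphaB) ?_
  calc _ ≤ ∫⁻ z : ℝ × ℝ, min 1 (ENNReal.ofReal (txCellular p (tMax p) * p.AB *
        z.1 ^ (-p.alphaB))) ∂((radial p.rateB).prod (cellularDistLaw p Y xi μ)) := by
        refine lintegral_mono_ae ?_
        filter_upwards [ae_pos_mem_Ioo hY] with z ⟨h1, h2⟩
        refine min_le_min le_rfl ?_
        unfold cellularPower
        rw [ENNReal.ofReal_max]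
        simp only [ENNReal.ofReal_zero, max_zero]
        refine ENNReal.ofReal_le_ofReal ?_
        have := txCellular_le p h2.1 h2.2.le
        have := p.AB_pos
        gcongr
    _ = _ := by
        rw [lintegral_prod _ (by fun_prop)]
        simp

/-- Finiteness keeps the SINR positive. Positivity of the interference keeps it finite even when the
noise `η` is 0. -/
theorem ae_interfC (hY : IsMarkedPoisson Y xi (homogeneous p.lamB) (shadowLaw p.sigmaB) μ)
    (hC : IsMarkedPoisson C M (homogeneous p.lamB)
      ((shadowLaw p.sigmaB).prod (cellularDistLaw p Y xi μ)) μ) :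
    ∀ᵐ ω ∂μ, interfC p C M ω ≠ 0 ∧ interfC p C M ω ≠ ∞ := by
  have := isProbabilityMeasure_cellularDistLaw hY
  have hφ := measurable_markedDist (F := ℝ) p.alphaB
  have hπ := map_equivDist_mark p.lamB_pos.le p.sigmaB p.alphaB (cellularDistLaw p Y xi μ)
  filter_upwards [hC.ae_forall hφ hπ (ae_pos_mem_Ioo hY), hC.ae_tsum_comp_ne_top hφ hπ
    (measurable_cellularPower p) (lintegral_min_one_cellularPower hY)] with ω h1 h2
  unfold interfC
  simp_rw [ofReal_rxCellular]
  refine ⟨fun h0 => ?_, h2⟩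
  have h3 := ENNReal.tsum_eq_zero.1 h0 0
  rw [ENNReal.ofReal_eq_zero] at h3
  obtain ⟨h4, h5⟩ := h1 0
  rw [cellularPower_eq p (z := (equivDist p.alphaB (C 0 ω) (M 0 ω).1, (M 0 ω).2)) h4 h5.1] at h3
  dsimp only at h3
  have := p.P0_pos
  have := p.AB_pos
  have := h5.1
  exact h3.not_gt (by positivity)

/-- The characteristic function of the interference from the cellular UEs. -/
theorem integral_exp_interfC
    (hY : IsMarkedPoisson Y xi (homogeneous p.lamB) (shadowLaw p.sigmaB) μ)
    (hC : IsMarkedPoisson C M (homogeneous p.lamB)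
      ((shadowLaw p.sigmaB).prod (cellularDistLaw p Y xi μ)) μ) (w r : ℝ) :
    ∫ ω, Complex.exp (-(Complex.I * (w / signal p r : ℝ) * ((interfC p C M ω).toReal : ℝ))) ∂μ =
      charC p w r := by
  have := isProbabilityMeasure_cellularDistLaw hY
  have hφ := measurable_markedDist (F := ℝ) p.alphaB
  have hπ := map_equivDist_mark p.lamB_pos.le p.sigmaB p.alphaB (cellularDistLaw p Y xi μ)
  set s : ℝ := w / signal p r with hs
  -- No void condition is imposed on cellular users, hence the empty set. The frequency is already
  -- divided by the signal power.
  have h1 := hC.integral_void_exp hφ hπ (A := ∅) MeasurableSet.empty (by simp)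
    (measurable_cellularPower p) (cellularPower_nonneg p) (lintegral_min_one_cellularPower hY) s
  have hgi := integrable_one_sub_indicator (A := ∅) MeasurableSet.empty (by simp)
    (measurable_cellularPower p) (cellularPower_nonneg p) (lintegral_min_one_cellularPower hY) s
  simp only [mem_empty_iff_false, not_false_eq_true, implies_true, ofPred_true, compl_empty,
    indicator_univ] at h1 hgi
  unfold interfC
  simp_rw [ofReal_rxCellular]
  rw [h1]
  change Complex.exp (-∫ z, _ ∂((radial p.rateB).prod (cellularDistLaw p Y xi μ))) = _
  rw [integral_prod _ hgi, integral_radial p.rateB_pos.le]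
  unfold charC
  rw [← neg_mul]
  congr 2
  refine setIntegral_congr_fun measurableSet_Ioi fun τ (hτ : 0 < τ) => ?_
  congr 1
  have hm : Measurable fun ρ => Complex.exp (-(Complex.I * s * (cellularPower p (τ, ρ) : ℝ))) := by
    have := (measurable_cellularPower p).comp (measurable_prodMk_left (x := τ))
    fun_prop
  rw [integral_sub (integrable_const _), integral_cellularDistLaw hY
    fun ρ => Complex.exp (-(Complex.I * s * (cellularPower p (τ, ρ) : ℝ)))]
  · simp only [integral_const, probReal_univ, one_smul]
    congr 1
    refine setIntegral_congr_fun measurableSet_Ioo fun ρ hρ => ?_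
    congr 3
    rw [cellularPower_eq p hτ hρ.1, hs]
    push_cast
    ring
  · refine Integrable.of_bound hm.aestronglyMeasurable 1 (.of_forall fun ρ => ?_)
    have := norm_exp_neg_I_mul (s * cellularPower p (τ, ρ))
    push_cast at this
    rw [← mul_assoc] at this
    exact this.le

end CellularInterference

/-! ### The D2D transmitters and the law of the link distance. -/

section DeviceLinks

variable {Ω : Type*} [MeasurableSpace Ω] {μ : Measure Ω} [IsProbabilityMeasure μ] {p : Params}
  {D : ℕ → Ω → Plane} {N : ℕ → Ω → ℝ × Bool}

theorem fairCoin_singleton (b : Bool) : fairCoin {b} = 2⁻¹ := by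
  unfold fairCoin
  rw [PMF.toMeasure_apply_singleton _ _ (measurableSet_singleton b)]
  simp

theorem integral_fairCoin (f : Bool → ℂ) : ∫ b, f b ∂fairCoin = (f true + f false) / 2 := by
  unfold fairCoin
  rw [PMF.integral_eq_sum]
  simp
  ring

/-- The intensity of the equivalent distances of the D2D transmitters is `radial p.rateD`. -/
noncomputable def Params.rateD (p : Params) : ℝ :=
  Real.pi * (1 - qCellular p) * p.lamU * fadingFactor p.sigmaD p.alphaD

theorem Params.rateD_pos (p : Params) : 0 < p.rateD := by
  have := p.lamU_pos
  have := sub_pos.2 (qCellular_lt_one p)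
  have := fadingFactor_pos p.sigmaD p.alphaD
  unfold Params.rateD
  positivity

theorem two_mul_rateD (p : Params) : 2 * Real.pi * ((1 - qCellular p) * p.lamU) *
    fadingFactor p.sigmaD p.alphaD = 2 * p.rateD := by
  unfold Params.rateD
  ring

theorem signal_pos (p : Params) {r : ℝ} (hr : 0 < r) : 0 < signal p r :=
  mul_pos (mul_pos p.Pd_pos p.AD_pos) (Real.rpow_pos_of_pos hr _)

theorem measurable_signal (p : Params) : Measurable (signal p) := by
  unfold signal
  fun_prop

theorem lintegral_min_one_signal (p : Params) {c : ℝ} (hc : 0 ≤ c) :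
    ∫⁻ v, min 1 (ENNReal.ofReal (signal p v)) ∂(radial c) ≠ ∞ :=
  lintegral_min_one_radial hc _ p.two_lt_alphaD

/-- The power received from a D2D UE at equivalent distance `z.1`. -/
noncomputable def devicePower (p : Params) (z : ℝ × Bool) : ℝ :=
  if z.2 then max (signal p z.1) 0 else 0

theorem measurable_devicePower (p : Params) : Measurable (devicePower p) :=
  Measurable.ite (measurable_snd (measurableSet_singleton true))
    (((measurable_signal p).comp measurable_fst).max measurable_const) measurable_const

theorem devicePower_nonneg (p : Params) (z : ℝ × Bool) : 0 ≤ devicePower p z := by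
  unfold devicePower
  split_ifs
  · exact le_max_right _ _
  · exact le_rfl

theorem rxD2D_eq {Ω : Type*} (p : Params) (D : ℕ → Ω → Plane) (N : ℕ → Ω → ℝ × Bool) (ω : Ω)
    (j : ℕ) : rxD2D p D N ω j =
      if (N j ω).2 then signal p (equivDist p.alphaD (D j ω) (N j ω).1) else 0 := by
  unfold rxD2D signal
  rw [power_eq_equivDist p.alphaD_pos.ne' (p.Pd * p.AD)]

theorem ofReal_rxD2D {Ω : Type*} (p : Params) (D : ℕ → Ω → Plane) (N : ℕ → Ω → ℝ × Bool) (ω : Ω)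
    (j : ℕ) : ENNReal.ofReal (rxD2D p D N ω j) =
      ENNReal.ofReal (devicePower p (equivDist p.alphaD (D j ω) (N j ω).1, (N j ω).2)) := by
  rw [rxD2D_eq]
  unfold devicePower
  split_ifs
  · simp [ENNReal.ofReal_max]
  · rfl

/-- The total power received from the D2D transmitters, the serving one included. -/
noncomputable def totalD (p : Params) {Ω : Type*} (D : ℕ → Ω → Plane) (N : ℕ → Ω → ℝ × Bool)
    (ω : Ω) : ℝ≥0∞ :=
  ∑' j, ENNReal.ofReal (rxD2D p D N ω j)

theorem measurable_rxD2D (hD : ∀ i, Measurable (D i)) (hN : ∀ i, Measurable (N i)) (j : ℕ) :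
    Measurable fun ω => rxD2D p D N ω j := by
  simp_rw [rxD2D_eq]
  refine Measurable.ite ((measurable_snd.comp (hN j)) (measurableSet_singleton true)) ?_
    measurable_const
  exact (measurable_signal p).comp ((measurable_equivDist _).comp
    ((hD j).prodMk (measurable_fst.comp (hN j))))

theorem measurable_totalD (hD : ∀ i, Measurable (D i)) (hN : ∀ i, Measurable (N i)) :
    Measurable (totalD p D N) :=
  Measurable.tsum fun j => (measurable_rxD2D hD hN j).ennreal_ofReal

theorem measurable_linkDist (hD : ∀ i, Measurable (D i)) (hN : ∀ i, Measurable (N i)) :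
    Measurable (linkDist p D N) :=
  measurable_eval_nat (f := fun k ω => equivDist p.alphaD (D k ω) (N k ω).1)
    (fun k => (measurable_equivDist p.alphaD).comp
      ((hD k).prodMk (measurable_fst.comp (hN k))))
    (measurable_strongest (measurable_rxD2D hD hN))

/-- The transmitters at equivalent distance at most `a`. -/
def nearTransmitters (a : ℝ) : Set (ℝ × Bool) := Iic a ×ˢ {true}

theorem measurableSet_nearTransmitters (a : ℝ) : MeasurableSet (nearTransmitters a) :=
  measurableSet_Iic.prod (measurableSet_singleton _)

/-- The fair coin halves the intensity `radial (2 * p.rateD)` of all D2D users. This is why the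
transmitters have rate `p.rateD`, with `π` in place of `2π`. -/
theorem prod_nearTransmitters (p : Params) {a : ℝ} (ha : 0 ≤ a) :
    ((radial (2 * p.rateD)).prod fairCoin) (nearTransmitters a) =
      ENNReal.ofReal (p.rateD * a ^ 2 / 2) := by
  have := p.rateD_pos
  unfold nearTransmitters
  rw [Measure.prod_prod, fairCoin_singleton, radial_Iic (by positivity) ha,
    ← ENNReal.ofReal_ofNat 2, ← ENNReal.ofReal_inv_of_pos two_pos,
    ← ENNReal.ofReal_mul (by positivity)]
  congr 1
  ring

theorem lintegral_min_one_devicePower (p : Params) :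
    ∫⁻ z, min 1 (ENNReal.ofReal (devicePower p z)) ∂((radial (2 * p.rateD)).prod fairCoin) ≠ ∞ := by
  have := p.rateD_pos
  refine ne_top_of_le_ne_top (lintegral_min_one_signal p (c := 2 * p.rateD) (by positivity)) ?_
  calc _ ≤ ∫⁻ z : ℝ × Bool, min 1 (ENNReal.ofReal (signal p z.1))
        ∂((radial (2 * p.rateD)).prod fairCoin) := by
        refine lintegral_mono fun z => min_le_min le_rfl ?_
        unfold devicePower
        split_ifs
        · simp [ENNReal.ofReal_max]
        · simp
    _ = _ := by
        have := measurable_signal p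
        rw [lintegral_prod _ (by fun_prop)]
        simp only [lintegral_const, measure_univ, mul_one]

theorem integrableOn_of_integrable_radial {c : ℝ} (hc : 0 < c) {f : ℝ → ℂ}
    (hf : Integrable f (radial c)) : IntegrableOn (fun v => f v * v) (Ioi 0) := by
  unfold radial at hf
  rw [integrable_withDensity_iff_integrable_smul' (by fun_prop) (by simp)] at hf
  refine (hf.const_mul (c : ℂ)⁻¹).congr ?_
  filter_upwards [ae_restrict_mem measurableSet_Ioi] with v (hv : 0 < v)
  rw [ENNReal.toReal_ofReal (by positivity), Complex.real_smul]
  have : (c : ℂ) ≠ 0 := by exact_mod_cast hc.ne'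
  push_cast
  field_simp

theorem integrableOn_one_sub_exp_signal (p : Params) (w : ℝ) :
    IntegrableOn (fun v : ℝ => (1 - Complex.exp (-(Complex.I * w * (signal p v : ℝ)))) * (v : ℂ))
      (Ioi 0) := by
  have h := integrable_one_sub_indicator (π := radial 1) (A := ∅) MeasurableSet.empty (by simp)
    ((measurable_signal p).max measurable_const) (fun v => le_max_right (signal p v) 0)
    (by simpa [ENNReal.ofReal_max] using lintegral_min_one_signal p zero_le_one) w
  refine (integrableOn_of_integrable_radial one_pos h).congr_fun (fun v (hv : 0 < v) => ?_)
    measurableSet_Ioi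
  simp [max_eq_left (signal_pos p hv).le]

/-- The exponent of the characteristic function of the interference from beyond `a`. -/
noncomputable def deviceExponent (p : Params) (w a : ℝ) : ℂ :=
  ∫ v in Ioi a, (1 - Complex.exp (-(Complex.I * w * (signal p v : ℝ)))) * (v : ℂ)

/-- Receivers contribute nothing. A transmitter within distance `a` contributes the full weight 1 of
the void condition, whence `a ^ 2 / 2`, and one beyond `a` contributes `1 - exp (-i w S(v))`, where
`S` is `signal p`. The coin cancels the factor 2 of the intensity. -/
theorem integral_devicePower (p : Params) (w : ℝ) {a : ℝ} (ha : 0 ≤ a) :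
    ∫ z, (1 - (nearTransmitters a)ᶜ.indicator
      (fun z => Complex.exp (-(Complex.I * w * (devicePower p z : ℝ)))) z)
      ∂((radial (2 * p.rateD)).prod fairCoin) =
      p.rateD * (a ^ 2 / 2 + deviceExponent p w a) := by
  have hr := p.rateD_pos
  have hint := integrable_one_sub_indicator (π := (radial (2 * p.rateD)).prod fairCoin)
    (measurableSet_nearTransmitters a)
    (by rw [prod_nearTransmitters p ha]; exact ENNReal.ofReal_ne_top) (measurable_devicePower p)
    (devicePower_nonneg p) (lintegral_min_one_devicePower p) w
  rw [integral_prod _ hint, integral_radial (by positivity), ← Ioc_union_Ioi_eq_Ioi ha]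
  have h1 : EqOn (fun v : ℝ => (∫ b, (1 - (nearTransmitters a)ᶜ.indicator
      (fun z => Complex.exp (-(Complex.I * w * (devicePower p z : ℝ)))) (v, b)) ∂fairCoin) * (v : ℂ))
      (fun v => ((v / 2 : ℝ) : ℂ)) (Ioc 0 a) := fun v hv => by
    beta_reduce
    rw [integral_fairCoin, indicator_of_notMem, indicator_of_mem]
    · simp [devicePower]
      ring
    · simp [nearTransmitters]
    · simp [nearTransmitters, hv.2]
  have h2 : EqOn (fun v : ℝ => (∫ b, (1 - (nearTransmitters a)ᶜ.indicator
      (fun z => Complex.exp (-(Complex.I * w * (devicePower p z : ℝ)))) (v, b)) ∂fairCoin) * (v : ℂ))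
      (fun v => 2⁻¹ * ((1 - Complex.exp (-(Complex.I * w * (signal p v : ℝ)))) * (v : ℂ)))
      (Ioi a) := fun v (hv : a < v) => by
    beta_reduce
    rw [integral_fairCoin, indicator_of_mem, indicator_of_mem]
    · simp [devicePower, max_eq_left (signal_pos p (ha.trans_lt hv)).le]
      ring
    · simp [nearTransmitters]
    · simp [nearTransmitters, hv]
  rw [setIntegral_union (Ioc_disjoint_Ioi le_rfl) measurableSet_Ioi,
    setIntegral_congr_fun measurableSet_Ioc h1, setIntegral_congr_fun measurableSet_Ioi h2,
    integral_const_mul, integral_complex_ofReal, ← intervalIntegral.integral_of_le ha,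
    intervalIntegral.integral_div, integral_id]
  · unfold deviceExponent
    push_cast
    ring
  · refine IntegrableOn.congr_fun ?_ h1.symm measurableSet_Ioc
    exact (Continuous.integrableOn_Icc (by fun_prop)).mono_set Ioc_subset_Icc_self
  · refine IntegrableOn.congr_fun ?_ h2.symm measurableSet_Ioi
    exact ((integrableOn_one_sub_exp_signal p w).mono_set (Ioi_subset_Ioi ha)).const_mul _

theorem map_markedDist_device (p : Params) :
    ((homogeneous ((1 - qCellular p) * p.lamU)).prod ((shadowLaw p.sigmaD).prod fairCoin)).map
        (fun z => (equivDist p.alphaD z.1 z.2.1, z.2.2)) =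
      (radial (2 * p.rateD)).prod fairCoin := by
  rw [map_equivDist_mark (mul_nonneg (sub_pos.2 (qCellular_lt_one p)).le p.lamU_pos.le),
    two_mul_rateD]

theorem measure_no_nearTransmitters
    (hD : IsMarkedPoisson D N (homogeneous ((1 - qCellular p) * p.lamU))
      ((shadowLaw p.sigmaD).prod fairCoin) μ) {a : ℝ} (ha : 0 ≤ a) :
    μ {ω | ∀ i, (equivDist p.alphaD (D i ω) (N i ω).1, (N i ω).2) ∉ nearTransmitters a} =
      ENNReal.ofReal (Real.exp (-(p.rateD * a ^ 2 / 2))) := by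
  have hr := p.rateD_pos
  rw [hD.measure_void (measurable_markedDist p.alphaD) (map_markedDist_device p)
    (measurableSet_nearTransmitters a)
    (by rw [prod_nearTransmitters p ha]; exact ENNReal.ofReal_ne_top), measureReal_def,
    prod_nearTransmitters p ha, ENNReal.toReal_ofReal (by positivity)]

/-- If there is no transmitter at all, then there is none within distance `a`, and the probability
of the latter tends to 0 as `a` grows. -/
theorem ae_exists_transmitter
    (hD : IsMarkedPoisson D N (homogeneous ((1 - qCellular p) * p.lamU))
      ((shadowLaw p.sigmaD).prod fairCoin) μ) : ∀ᵐ ω ∂μ, ∃ i, (N i ω).2 = true := by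
  have hle : ∀ a : ℝ, 0 ≤ a → μ {ω | ¬ ∃ i, (N i ω).2 = true} ≤
      ENNReal.ofReal (Real.exp (-(p.rateD * a ^ 2 / 2))) := fun a ha => by
    rw [← measure_no_nearTransmitters hD ha]
    refine measure_mono fun ω (hω : ¬ _) i hi => hω ⟨i, ?_⟩
    simpa using hi.2
  have hlim := (ENNReal.continuous_ofReal.tendsto _).comp (tendsto_exp_neg_sq p.rateD_pos)
  rw [ENNReal.ofReal_zero] at hlim
  exact le_antisymm (ge_of_tendsto hlim ((eventually_ge_atTop 0).mono hle)) (zero_le)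

/-- Almost surely the serving transmitter exists, at a positive minimal equivalent distance. -/
theorem ae_linkDist_spec
    (hD : IsMarkedPoisson D N (homogeneous ((1 - qCellular p) * p.lamU))
      ((shadowLaw p.sigmaD).prod fairCoin) μ) :
    ∀ᵐ ω ∂μ, 0 < linkDist p D N ω ∧ totalD p D N ω ≠ ∞ ∧
      rxD2D p D N ω (serving p D N ω) = signal p (linkDist p D N ω) ∧
      ∀ a, a < linkDist p D N ω ↔
        ∀ i, (equivDist p.alphaD (D i ω) (N i ω).1, (N i ω).2) ∉ nearTransmitters a := by
  have hφ := measurable_markedDist (F := Bool) p.alphaD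
  have hπ := map_markedDist_device p
  have hK := mul_pos p.Pd_pos p.AD_pos
  filter_upwards [hD.ae_forall hφ hπ (Measure.quasiMeasurePreserving_fst.ae (ae_pos_radial _)),
    hD.ae_tsum_comp_ne_top hφ hπ (measurable_devicePower p) (lintegral_min_one_devicePower p),
    ae_exists_transmitter hD] with ω hpos hsum ⟨j, hj⟩
  simp_rw [← ofReal_rxD2D] at hsum
  have hnn : ∀ k, 0 ≤ rxD2D p D N ω k := fun k => by
    rw [rxD2D_eq]
    split_ifs
    · exact (signal_pos p (hpos k)).le
    · exact le_rfl
  have hlim : Tendsto (rxD2D p D N ω) cofinite (𝓝 0) := by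
    have := (ENNReal.tendsto_toReal ENNReal.zero_ne_top).comp
      (ENNReal.tendsto_cofinite_zero_of_tsum_ne_top hsum)
    exact this.congr fun k => ENNReal.toReal_ofReal (hnn k)
  have hjpos : 0 < rxD2D p D N ω j := by
    rw [rxD2D_eq, if_pos hj]
    exact signal_pos p (hpos j)
  have hmax := le_strongest (exists_forall_le hlim ⟨j, hjpos⟩)
  change ∀ k, rxD2D p D N ω k ≤ rxD2D p D N ω (serving p D N ω) at hmax
  have hserv : (N (serving p D N ω) ω).2 = true := by
    by_contra hne
    have := hjpos.trans_le (hmax j)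
    rw [rxD2D_eq, if_neg hne] at this
    exact this.false
  have hrx : rxD2D p D N ω (serving p D N ω) = signal p (linkDist p D N ω) := by
    rw [rxD2D_eq, if_pos hserv]
    rfl
  refine ⟨hpos _, hsum, hrx, fun a => ⟨fun ha i hi => ?_, fun h => ?_⟩⟩
  · have h1 := hmax i
    have hi2 : (N i ω).2 = true := by simpa using hi.2
    rw [hrx, rxD2D_eq, if_pos hi2] at h1
    have h2 := (power_le_power_iff hK p.alphaD_pos (hpos i) (hpos _)).1 h1
    exact (ha.trans_le h2).not_ge hi.1
  · by_contra hle
    exact h (serving p D N ω) ⟨not_lt.1 hle, by simpa using hserv⟩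

theorem totalD_eq {Ω : Type*} (p : Params) (D : ℕ → Ω → Plane) (N : ℕ → Ω → ℝ × Bool) (ω : Ω) :
    totalD p D N ω = ENNReal.ofReal (rxD2D p D N ω (serving p D N ω)) + interfD p D N ω := by
  unfold totalD interfD
  rw [ENNReal.tsum_eq_add_tsum_ite (serving p D N ω)]
  congr 1
  exact tsum_congr fun j => by split_ifs <;> rfl

/-- The equivalent distance of the D2D link has a Rayleigh law. -/
theorem map_linkDist
    (hD : IsMarkedPoisson D N (homogeneous ((1 - qCellular p) * p.lamU))
      ((shadowLaw p.sigmaD).prod fairCoin) μ) :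
    μ.map (linkDist p D N) = rayleigh p.rateD := by
  refine map_eq_rayleigh p.rateD_pos
    (measurable_linkDist hD.poisson.measurable hD.measurable_mark) fun a ha => ?_
  rw [← measure_no_nearTransmitters hD ha]
  refine measure_congr ?_
  filter_upwards [ae_linkDist_spec hD] with ω hω
  exact propext (hω.2.2.2 a)

/-- The characteristic function of the total power of the D2D transmitters, on the event that the
link is longer than `a`. -/
theorem integral_exp_totalD
    (hD : IsMarkedPoisson D N (homogeneous ((1 - qCellular p) * p.lamU))
      ((shadowLaw p.sigmaD).prod fairCoin) μ) (w : ℝ) {a : ℝ} (ha : 0 ≤ a) :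
    ∫ ω, {ω | a < linkDist p D N ω}.indicator (fun ω =>
      Complex.exp (-(Complex.I * w * ((totalD p D N ω).toReal : ℝ)))) ω ∂μ =
      Complex.exp (-(p.rateD * (a ^ 2 / 2 + deviceExponent p w a))) := by
  rw [← integral_devicePower p w ha, ← hD.integral_void_exp (measurable_markedDist p.alphaD)
    (map_markedDist_device p) (measurableSet_nearTransmitters a)
    (by rw [prod_nearTransmitters p ha]; exact ENNReal.ofReal_ne_top) (measurable_devicePower p)
    (devicePower_nonneg p) (lintegral_min_one_devicePower p)]
  refine integral_congr_ae ?_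
  filter_upwards [ae_linkDist_spec hD] with ω hω
  unfold totalD
  simp_rw [← ofReal_rxD2D]
  set S : Set Ω := {ω | ∀ i, (equivDist p.alphaD (D i ω) (N i ω).1, (N i ω).2) ∉
    nearTransmitters a}
  have hS : a < linkDist p D N ω ↔ ω ∈ S := hω.2.2.2 a
  by_cases h : a < linkDist p D N ω
  · rw [indicator_of_mem (show ω ∈ {ω | a < linkDist p D N ω} from h),
      indicator_of_mem (hS.1 h)]
  · rw [indicator_of_notMem (show ω ∉ {ω | a < linkDist p D N ω} from h),
      indicator_of_notMem fun h2 => h (hS.2 h2)]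

end DeviceLinks

/-! ### Differentiating the restricted transform in the void radius. -/

section ExponentDerivative

variable {p : Params}

theorem deviceExponent_re_nonneg (p : Params) (w : ℝ) {a : ℝ} (ha : 0 ≤ a) :
    0 ≤ (deviceExponent p w a).re := by
  unfold deviceExponent
  have h1 := (integrableOn_one_sub_exp_signal p w).mono_set (Ioi_subset_Ioi ha)
  have h2 := integral_re h1
  simp only [RCLike.re_to_complex] at h2
  rw [← h2]
  refine setIntegral_nonneg measurableSet_Ioi fun v (hv : a < v) => ?_
  rw [Complex.re_mul_ofReal]
  refine mul_nonneg ?_ (ha.trans hv.le)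
  rw [Complex.sub_re, Complex.one_re, sub_nonneg]
  refine (Complex.re_le_norm _).trans ?_
  have := norm_exp_neg_I_mul (w * signal p v)
  push_cast at this
  rw [← mul_assoc] at this
  exact this.le

/-- Writing the tail integral as a constant minus a primitive gives both its continuity up to 0 and
its derivative. The indicator makes the integrand integrable on the whole line. -/
theorem deviceExponent_eq (p : Params) (w : ℝ) {a : ℝ} (ha : 0 ≤ a) :
    deviceExponent p w a = deviceExponent p w 0 - ∫ v in (0 : ℝ)..a, (Ioi 0).indicator
      (fun v : ℝ => (1 - Complex.exp (-(Complex.I * w * (signal p v : ℝ)))) * (v : ℂ)) v := by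
  have h := integrableOn_one_sub_exp_signal p w
  rw [intervalIntegral.integral_of_le ha, eq_sub_iff_add_eq', setIntegral_indicator
    measurableSet_Ioi, inter_eq_left.2 Ioc_subset_Ioi_self]
  unfold deviceExponent
  rw [← setIntegral_union (Ioc_disjoint_Ioi le_rfl) measurableSet_Ioi
    (h.mono_set Ioc_subset_Ioi_self) (h.mono_set (Ioi_subset_Ioi ha)), Ioc_union_Ioi_eq_Ioi ha]

theorem integrable_indicator_exponent (p : Params) (w : ℝ) : Integrable ((Ioi 0).indicator
    fun v : ℝ => (1 - Complex.exp (-(Complex.I * w * (signal p v : ℝ)))) * (v : ℂ)) :=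
  (integrableOn_one_sub_exp_signal p w).integrable_indicator measurableSet_Ioi

theorem continuousOn_deviceExponent (p : Params) (w : ℝ) :
    ContinuousOn (deviceExponent p w) (Ici 0) := by
  have h : Continuous fun a => ∫ v in (0 : ℝ)..a, (Ioi 0).indicator
      (fun v : ℝ => (1 - Complex.exp (-(Complex.I * w * (signal p v : ℝ)))) * (v : ℂ)) v :=
    intervalIntegral.continuous_primitive
      (fun _ _ => (integrable_indicator_exponent p w).intervalIntegrable) 0
  exact (continuous_const.sub h).continuousOn.congr fun a ha => deviceExponent_eq p w ha

theorem continuousAt_signal (p : Params) {r : ℝ} (hr : 0 < r) : ContinuousAt (signal p) r :=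
  continuousAt_const.mul (Real.continuousAt_rpow_const _ _ (Or.inl hr.ne'))

theorem hasDerivAt_deviceExponent (p : Params) (w : ℝ) {r : ℝ} (hr : 0 < r) :
    HasDerivAt (deviceExponent p w)
      (-((1 - Complex.exp (-(Complex.I * w * (signal p r : ℝ)))) * (r : ℂ))) r := by
  have hmem : Ioi (0 : ℝ) ∈ 𝓝 r := Ioi_mem_nhds hr
  have hi := integrable_indicator_exponent p w
  have hc : ContinuousAt (fun v : ℝ =>
      (1 - Complex.exp (-(Complex.I * w * (signal p v : ℝ)))) * (v : ℂ)) r := by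
    have := continuousAt_signal p hr
    fun_prop
  have h1 := intervalIntegral.integral_hasDerivAt_right (a := 0) (b := r) hi.intervalIntegrable
    (hi.aestronglyMeasurable.stronglyMeasurableAtFilter)
    (hc.congr (eventually_of_mem hmem fun v hv => by rw [indicator_of_mem hv]))
  rw [indicator_of_mem (show r ∈ Ioi (0 : ℝ) from hr)] at h1
  have h2 := h1.const_sub (deviceExponent p w 0)
  refine h2.congr_of_eventuallyEq ?_
  filter_upwards [hmem] with v hv
  exact deviceExponent_eq p w (le_of_lt hv)

/-- The characteristic function of the total power of the transmitters beyond `a`, restricted to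
the event that there is none closer. -/
noncomputable def deviceChar (p : Params) (w a : ℝ) : ℂ :=
  Complex.exp (-(p.rateD * (a ^ 2 / 2 + deviceExponent p w a)))

theorem norm_deviceChar_le (p : Params) (w : ℝ) {a : ℝ} (ha : 0 ≤ a) :
    ‖deviceChar p w a‖ ≤ Real.exp (-(p.rateD * a ^ 2 / 2)) := by
  unfold deviceChar
  rw [Complex.norm_exp]
  refine Real.exp_le_exp.2 ?_
  have h1 := deviceExponent_re_nonneg p w ha
  have h2 := mul_nonneg p.rateD_pos.le h1
  have h3 : (a ^ 2 / 2 + deviceExponent p w a : ℂ) =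
      ((a ^ 2 / 2 : ℝ) : ℂ) + deviceExponent p w a := by push_cast; ring
  rw [h3, Complex.neg_re, Complex.re_ofReal_mul, Complex.add_re, Complex.ofReal_re]
  linarith

/-- The derivative `r` of the void term `r ^ 2 / 2` cancels the 1 in `1 - exp (-i w S(r))`. Only the
phase of a transmitter sitting exactly at distance `r` survives. -/
theorem hasDerivAt_deviceChar (p : Params) (w : ℝ) {r : ℝ} (hr : 0 < r) :
    HasDerivAt (deviceChar p w) (-(Complex.exp (-(Complex.I * w * (signal p r : ℝ))) *
      ((p.rateD * r : ℝ) : ℂ) * deviceChar p w r)) r := by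
  have h1 : HasDerivAt (fun r : ℝ => ((r : ℂ) ^ 2 / 2)) (r : ℂ) r := by
    have := ((hasDerivAt_pow 2 (r : ℂ)).comp_ofReal).div_const 2
    refine this.congr_deriv ?_
    push_cast
    ring
  have h2 := ((h1.add (hasDerivAt_deviceExponent p w hr)).const_mul (p.rateD : ℂ)).neg.cexp
  refine h2.congr_deriv ?_
  unfold deviceChar
  simp only [Pi.add_apply, Pi.neg_apply]
  push_cast
  ring

theorem continuousOn_deviceChar (p : Params) (w : ℝ) : ContinuousOn (deviceChar p w) (Ici 0) := by
  have := continuousOn_deviceExponent p w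
  unfold deviceChar
  fun_prop

/-- This is the disintegration over the link distance. The integrand contains the phase of the
serving transmitter at `r`, the factor `p.rateD * r`, and the transform of the process without
transmitters up to `r`. It holds since `deviceChar` vanishes at infinity and its derivative is
dominated by the Rayleigh density. -/
theorem deviceChar_eq_integral (p : Params) (w : ℝ) {a : ℝ} (ha : 0 ≤ a) :
    deviceChar p w a = ∫ r in Ioi a, Complex.exp (-(Complex.I * w * (signal p r : ℝ))) *
      ((p.rateD * r : ℝ) : ℂ) * deviceChar p w r := by
  have hr := p.rateD_pos
  have hlim : Tendsto (deviceChar p w) atTop (𝓝 0) :=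
    squeeze_zero_norm' ((eventually_ge_atTop 0).mono fun r h => norm_deviceChar_le p w h)
      (tendsto_exp_neg_sq hr)
  have hint : IntegrableOn (fun r : ℝ => -(Complex.exp (-(Complex.I * w * (signal p r : ℝ))) *
      ((p.rateD * r : ℝ) : ℂ) * deviceChar p w r)) (Ioi a) := by
    refine Integrable.mono' (lintegral_rayleigh_Ioi hr ha).1 ?_ ?_
    · refine ContinuousOn.aestronglyMeasurable ?_ measurableSet_Ioi
      have h1 : ContinuousOn (signal p) (Ioi a) := fun r h =>
        (continuousAt_signal p (ha.trans_lt h)).continuousWithinAt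
      have h2 : ContinuousOn (deviceChar p w) (Ioi a) :=
        (continuousOn_deviceChar p w).mono fun r h => ha.trans (le_of_lt h)
      fun_prop
    · filter_upwards [ae_restrict_mem measurableSet_Ioi] with r (h : a < r)
      have h0 : 0 ≤ r := ha.trans h.le
      have := norm_exp_neg_I_mul (w * signal p r)
      push_cast at this
      rw [← mul_assoc] at this
      rw [norm_neg, norm_mul, norm_mul, this, one_mul, Complex.norm_real, Real.norm_of_nonneg
        (by positivity)]
      exact mul_le_mul_of_nonneg_left (norm_deviceChar_le p w h0) (by positivity)
  have := integral_Ioi_of_hasDerivAt_of_tendsto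
    ((continuousOn_deviceChar p w a ha).mono (Ici_subset_Ici.2 ha))
    (fun r h => hasDerivAt_deviceChar p w (ha.trans_lt h)) hint hlim
  rw [integral_neg, zero_sub] at this
  exact (neg_injective this).symm

end ExponentDerivative

/-! ### Joint transform with the cellular interference, and passage from tails to conditioning. -/

section Joint

variable {Ω : Type*} [MeasurableSpace Ω] {μ : Measure Ω} [IsProbabilityMeasure μ] {p : Params}
  {Y : ℕ → Ω → Plane} {xi : ℕ → Ω → ℝ} {C : ℕ → Ω → Plane} {M : ℕ → Ω → ℝ × ℝ}
  {D : ℕ → Ω → Plane} {N : ℕ → Ω → ℝ × Bool}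

/-- The total power at the origin, noise and signal included. -/
noncomputable def totalPower (p : Params) {Ω : Type*} (C : ℕ → Ω → Plane) (M : ℕ → Ω → ℝ × ℝ)
    (D : ℕ → Ω → Plane) (N : ℕ → Ω → ℝ × Bool) (ω : Ω) : ℝ :=
  (totalD p D N ω).toReal + (interfC p C M ω).toReal + p.eta

theorem norm_exp_neg_I_mul_mul (w x : ℝ) : ‖Complex.exp (-(Complex.I * w * x))‖ = 1 := by
  have := norm_exp_neg_I_mul (w * x)
  push_cast at this
  rwa [← mul_assoc] at this

theorem setIntegral_exp_totalPower
    (hC : ∀ i, Measurable (C i)) (hM : ∀ i, Measurable (M i))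
    (hD : IsMarkedPoisson D N (homogeneous ((1 - qCellular p) * p.lamU))
      ((shadowLaw p.sigmaD).prod fairCoin) μ)
    (hCD : IndepFun (fun ω i => (C i ω, M i ω)) (fun ω j => (D j ω, N j ω)) μ) (w : ℝ) {a : ℝ}
    (ha : 0 ≤ a) :
    ∫ ω in linkDist p D N ⁻¹' Ioi a, Complex.exp (-(Complex.I * w * (totalPower p C M D N ω : ℝ)))
      ∂μ = deviceChar p w a *
      ((∫ ω, Complex.exp (-(Complex.I * w * ((interfC p C M ω).toReal : ℝ))) ∂μ) *
        Complex.exp (-(Complex.I * w * (p.eta : ℝ)))) := by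
  have hDm := hD.poisson.measurable
  have hNm := hD.measurable_mark
  have hR := measurable_linkDist (p := p) hDm hNm
  -- Both factors are rewritten as functionals on the space of marked sequences. The assumed
  -- independence of the two sequences then passes to them by composition.
  let GD : (ℕ → Plane × ℝ × Bool) → ℂ :=
    {s | a < linkDist p (fun j (s : ℕ → Plane × ℝ × Bool) => (s j).1) (fun j s => (s j).2) s}.indicator
      fun s => Complex.exp (-(Complex.I * w *
        ((totalD p (fun j (s : ℕ → Plane × ℝ × Bool) => (s j).1) (fun j s => (s j).2) s).toReal : ℝ)))
  let GC : (ℕ → Plane × ℝ × ℝ) → ℂ := fun s => Complex.exp (-(Complex.I * w *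
    ((interfC p (fun j (s : ℕ → Plane × ℝ × ℝ) => (s j).1) (fun j s => (s j).2) s).toReal : ℝ)))
  have hGD : Measurable GD := by
    have h1 : Measurable (linkDist p (fun j (s : ℕ → Plane × ℝ × Bool) => (s j).1)
      (fun j s => (s j).2)) := measurable_linkDist (fun j => by fun_prop) (fun j => by fun_prop)
    have h2 : Measurable (totalD p (fun j (s : ℕ → Plane × ℝ × Bool) => (s j).1)
      (fun j s => (s j).2)) := measurable_totalD (fun j => by fun_prop) (fun j => by fun_prop)
    exact Measurable.indicator (by fun_prop) (measurableSet_lt measurable_const h1)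
  have hGC : Measurable GC := by
    have h2 : Measurable (interfC p (fun j (s : ℕ → Plane × ℝ × ℝ) => (s j).1)
      (fun j s => (s j).2)) := measurable_interfC (fun j => by fun_prop) (fun j => by fun_prop)
    fun_prop
  have hmD : Measurable fun ω j => (D j ω, N j ω) :=
    measurable_pi_lambda _ fun j => (hDm j).prodMk (hNm j)
  have hmC : Measurable fun ω j => (C j ω, M j ω) :=
    measurable_pi_lambda _ fun j => (hC j).prodMk (hM j)
  have hind := (hCD.symm.comp hGD hGC).integral_fun_mul_eq_mul_integral
    (hGD.comp hmD).aestronglyMeasurable (hGC.comp hmC).aestronglyMeasurable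
  have h3 := integral_exp_totalD hD w ha
  change ∫ ω, (GD ∘ fun ω j => (D j ω, N j ω)) ω ∂μ = deviceChar p w a at h3
  rw [h3] at hind
  rw [← integral_indicator (hR measurableSet_Ioi), ← mul_assoc]
  change _ = deviceChar p w a * (∫ ω, (GC ∘ fun ω j => (C j ω, M j ω)) ω ∂μ) * _
  rw [← hind, ← integral_mul_const]
  refine integral_congr_ae (.of_forall fun ω => ?_)
  change _ = {ω | a < linkDist p D N ω}.indicator (fun ω => Complex.exp (-(Complex.I * w *
    ((totalD p D N ω).toReal : ℝ)))) ω *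
    Complex.exp (-(Complex.I * w * ((interfC p C M ω).toReal : ℝ))) * _
  by_cases h : a < linkDist p D N ω
  · rw [indicator_of_mem (show ω ∈ linkDist p D N ⁻¹' Ioi a from h),
      indicator_of_mem (show ω ∈ {ω | a < linkDist p D N ω} from h), ← Complex.exp_add,
      ← Complex.exp_add]
    congr 1
    unfold totalPower
    push_cast
    ring
  · rw [indicator_of_notMem (show ω ∉ linkDist p D N ⁻¹' Ioi a from h),
      indicator_of_notMem (show ω ∉ {ω | a < linkDist p D N ω} from h)]
    ring

theorem integral_rayleigh_Ioi {c : ℝ} (hc : 0 < c) {a : ℝ} (ha : 0 ≤ a) (f : ℝ → ℂ) :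
    ∫ r in Ioi a, f r ∂(rayleigh c) =
      ∫ r in Ioi a, ((c * r * Real.exp (-(c * r ^ 2 / 2)) : ℝ) : ℂ) * f r := by
  unfold rayleigh
  rw [setIntegral_withDensity_eq_setIntegral_toReal_smul (by fun_prop) (by simp) _
    measurableSet_Ioi, Measure.restrict_restrict measurableSet_Ioi, Ioi_inter_Ioi, max_eq_left ha]
  refine setIntegral_congr_fun measurableSet_Ioi fun r (hr : a < r) => ?_
  have : 0 ≤ r := ha.trans hr.le
  rw [ENNReal.toReal_ofReal (by positivity), Complex.real_smul]

/-- Two complex set functions on the half line agree if they agree on the tails. -/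
theorem setIntegral_preimage_eq_of_Ioi {μ : Measure Ω} {R : Ω → ℝ} (hR : Measurable R) {m : Measure ℝ}
    (hR0 : ∀ᵐ ω ∂μ, 0 < R ω) (hm0 : ∀ᵐ r ∂m, 0 < r) {u : Ω → ℂ} (hu : Integrable u μ)
    {v : ℝ → ℂ} (hv : Integrable v m)
    (h : ∀ a, 0 ≤ a → ∫ ω in R ⁻¹' Ioi a, u ω ∂μ = ∫ r in Ioi a, v r ∂m)
    {A : Set ℝ} (hA : MeasurableSet A) : ∫ ω in R ⁻¹' A, u ω ∂μ = ∫ r in A, v r ∂m := by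
  have hIoi : ∀ a, ∫ ω in R ⁻¹' Ioi a, u ω ∂μ = ∫ r in Ioi a, v r ∂m := fun a => by
    have h1 : R ⁻¹' Ioi a =ᵐ[μ] R ⁻¹' Ioi (max a 0) := by
      filter_upwards [hR0] with ω hω
      refine propext ?_
      change a < R ω ↔ max a 0 < R ω
      simp [hω]
    have h2 : (Ioi a : Set ℝ) =ᵐ[m] Ioi (max a 0) := by
      filter_upwards [hm0] with r hr
      refine propext ?_
      change a < r ↔ max a 0 < r
      simp [hr]
    rw [setIntegral_congr_set h1, setIntegral_congr_set h2, h _ (le_max_right _ _)]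
  have huniv : ∫ ω, u ω ∂μ = ∫ r, v r ∂m := by
    have h1 : R ⁻¹' Ioi 0 =ᵐ[μ] univ := by
      filter_upwards [hR0] with ω hω
      exact propext ⟨fun _ => trivial, fun _ => hω⟩
    have h2 : (Ioi 0 : Set ℝ) =ᵐ[m] univ := by
      filter_upwards [hm0] with r hr
      exact propext ⟨fun _ => trivial, fun _ => hr⟩
    have := h 0 le_rfl
    rwa [setIntegral_congr_set h1, setIntegral_congr_set h2, setIntegral_univ,
      setIntegral_univ] at this
  -- Half lines form a generating π-system. Complex values cause no trouble, because integrability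
  -- and equality of the total integrals give the complement and union steps.
  induction A, hA using MeasurableSpace.induction_on_inter
    (BorelSpace.measurable_eq.trans (borel_eq_generateFrom_Ioi ℝ)) isPiSystem_Ioi with
  | empty => simp
  | basic t ht =>
    obtain ⟨a, rfl⟩ := ht
    exact hIoi a
  | compl t ht ih =>
    have h1 := integral_add_compl (hR ht) hu
    have h2 := integral_add_compl ht hv
    rw [preimage_compl]
    rw [ih, huniv, ← h2] at h1
    exact add_left_cancel h1
  | iUnion f hd hf ih =>
    rw [preimage_iUnion, integral_iUnion (fun i => hR (hf i))
      (fun i j hij => (hd hij).preimage R) hu.integrableOn, integral_iUnion hf hd hv.integrableOn]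
    exact tsum_congr ih

/-- The frequency of a conditional characteristic function may depend on the condition. -/
theorem setIntegral_exp_substitute {R Z : Ω → ℝ} (hR : Measurable R) (hZ : Measurable Z)
    {k : ℝ → ℝ → ℂ} (hk : Measurable (Function.uncurry k)) (hkc : ∀ r, Continuous fun w => k w r)
    (hkb : ∀ᵐ r ∂(μ.map R), ∀ w, ‖k w r‖ ≤ 1)
    (h : ∀ (w : ℝ) (A : Set ℝ), MeasurableSet A → ∫ ω in R ⁻¹' A, Complex.exp (-(Complex.I * w * (Z ω : ℝ))) ∂μ =
      ∫ r in A, k w r ∂(μ.map R))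
    {f : ℝ → ℝ} (hf : Measurable f) {A : Set ℝ} (hA : MeasurableSet A) :
    ∫ ω in R ⁻¹' A, Complex.exp (-(Complex.I * (f (R ω) : ℝ) * (Z ω : ℝ))) ∂μ =
      ∫ r in A, k (f r) r ∂(μ.map R) := by
  have := Measure.isProbabilityMeasure_map (μ := μ) hR.aemeasurable
  have hsimple : ∀ s : SimpleFunc ℝ ℝ,
      ∫ ω in R ⁻¹' A, Complex.exp (-(Complex.I * (s (R ω) : ℝ) * (Z ω : ℝ))) ∂μ =
        ∫ r in A, k (s r) r ∂(μ.map R) := by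
    intro s
    -- On each fibre of `s` the frequency is the constant `c`, so the hypothesis for constant
    -- frequencies applies there.
    have hU : A = ⋃ c ∈ s.range, A ∩ s ⁻¹' {c} := by
      ext r
      simp
    have hms : ∀ c ∈ s.range, MeasurableSet (A ∩ s ⁻¹' {c}) := fun c _ =>
      hA.inter (s.measurableSet_fiber c)
    have hdisj : (s.range : Set ℝ).Pairwise (Function.onFun Disjoint fun c => A ∩ s ⁻¹' {c}) :=
      fun c _ d _ hcd => Set.disjoint_left.2 fun r h1 h2 => hcd (h1.2.symm.trans h2.2)
    have hi1 : Integrable (fun ω => Complex.exp (-(Complex.I * (s (R ω) : ℝ) * (Z ω : ℝ)))) μ := by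
      refine Integrable.of_bound (Measurable.aestronglyMeasurable ?_) 1
        (.of_forall fun ω => (norm_exp_neg_I_mul_mul _ _).le)
      have := s.measurable.comp hR
      fun_prop
    have hi2 : Integrable (fun r => k (s r) r) (μ.map R) :=
      Integrable.of_bound (hk.comp (s.measurable.prodMk measurable_id)).aestronglyMeasurable 1
        (hkb.mono fun r hr => hr _)
    rw [hU, preimage_iUnion₂, integral_biUnion_finset _ (fun c hc => hR (hms c hc))
      (fun c hc d hd hcd => (hdisj hc hd hcd).preimage R) (fun c _ => hi1.integrableOn),
      integral_biUnion_finset _ hms hdisj (fun c _ => hi2.integrableOn)]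
    refine Finset.sum_congr rfl fun c hc => ?_
    rw [← (setIntegral_congr_fun (hms c hc) fun r hr => ?_ :
        ∫ r in A ∩ s ⁻¹' {c}, k c r ∂(μ.map R) = _), ← h c _ (hms c hc)]
    · refine setIntegral_congr_fun (hR (hms c hc)) fun ω hω => ?_
      have : s (R ω) = c := hω.2
      rw [this]
    · have : s r = c := hr.2
      rw [this]
  -- For general `f` both sides pass to the limit by dominated convergence. This is where continuity
  -- of `k` in the frequency is needed.
  let s : ℕ → SimpleFunc ℝ ℝ := SimpleFunc.approxOn f hf univ 0 (mem_univ 0)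
  have hs : ∀ r, Tendsto (fun n => s n r) atTop (𝓝 (f r)) := fun r =>
    SimpleFunc.tendsto_approxOn hf (mem_univ 0) (by simp)
  have h1 : Tendsto (fun n => ∫ ω in R ⁻¹' A,
      Complex.exp (-(Complex.I * (s n (R ω) : ℝ) * (Z ω : ℝ))) ∂μ) atTop
      (𝓝 (∫ ω in R ⁻¹' A, Complex.exp (-(Complex.I * (f (R ω) : ℝ) * (Z ω : ℝ))) ∂μ)) := by
    refine tendsto_integral_of_dominated_convergence (fun _ => 1) (fun n => ?_)
      (integrable_const _) (fun n => .of_forall fun ω => (norm_exp_neg_I_mul_mul _ _).le)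
      (.of_forall fun ω => ?_)
    · refine Measurable.aestronglyMeasurable ?_
      have := (s n).measurable.comp hR
      fun_prop
    · have hc : Continuous fun x : ℝ => Complex.exp (-(Complex.I * x * (Z ω : ℝ))) := by fun_prop
      exact (hc.tendsto _).comp (hs (R ω))
  have h2 : Tendsto (fun n => ∫ r in A, k (s n r) r ∂(μ.map R)) atTop
      (𝓝 (∫ r in A, k (f r) r ∂(μ.map R))) := by
    refine tendsto_integral_of_dominated_convergence (fun _ => 1) (fun n => ?_)
      (integrable_const _) (fun n => (ae_restrict_of_ae hkb).mono fun r hr => hr _)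
      (.of_forall fun r => ((hkc r).tendsto _).comp (hs r))
    exact (hk.comp ((s n).measurable.prodMk measurable_id)).aestronglyMeasurable
  exact tendsto_nhds_unique h1 (h2.congr fun n => (hsimple (s n)).symm)

end Joint

/-! ### The conditional characteristic function of the inverse SINR. -/

section Conditional

variable {Ω : Type*} [MeasurableSpace Ω] {μ : Measure Ω} [IsProbabilityMeasure μ] {p : Params}
  {Y : ℕ → Ω → Plane} {xi : ℕ → Ω → ℝ} {C : ℕ → Ω → Plane} {M : ℕ → Ω → ℝ × ℝ}
  {D : ℕ → Ω → Plane} {N : ℕ → Ω → ℝ × Bool}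

theorem measurable_totalPower (hC : ∀ i, Measurable (C i)) (hM : ∀ i, Measurable (M i))
    (hD : ∀ i, Measurable (D i)) (hN : ∀ i, Measurable (N i)) :
    Measurable (totalPower p C M D N) :=
  ((measurable_totalD hD hN).ennreal_toReal.add (measurable_interfC hC hM).ennreal_toReal).add_const _

/-- The characteristic function of the total power, restricted to the event that the link is longer
than `r`. -/
noncomputable def tailChar (p : Params) (C : ℕ → Ω → Plane) (M : ℕ → Ω → ℝ × ℝ)
    (D : ℕ → Ω → Plane) (N : ℕ → Ω → ℝ × Bool) (μ : Measure Ω) (w r : ℝ) : ℂ :=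
  ∫ ω, (linkDist p D N ⁻¹' Ioi r).indicator
    (fun ω => Complex.exp (-(Complex.I * w * (totalPower p C M D N ω : ℝ)))) ω ∂μ

/-- The conditional characteristic function of the total power, given that the link has equivalent
distance `r`. -/
noncomputable def totalKernel (p : Params) (C : ℕ → Ω → Plane) (M : ℕ → Ω → ℝ × ℝ)
    (D : ℕ → Ω → Plane) (N : ℕ → Ω → ℝ × Bool) (μ : Measure Ω) (w r : ℝ) : ℂ :=
  Complex.exp (-(Complex.I * w * (signal p r : ℝ))) *
    (Real.exp (p.rateD * r ^ 2 / 2) : ℂ) * tailChar p C M D N μ w r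

theorem measurable_tailChar (hC : ∀ i, Measurable (C i)) (hM : ∀ i, Measurable (M i))
    (hD : ∀ i, Measurable (D i)) (hN : ∀ i, Measurable (N i)) :
    Measurable (Function.uncurry (tailChar p C M D N μ)) := by
  have hR := measurable_linkDist (p := p) hD hN
  have hZ := measurable_totalPower (p := p) hC hM hD hN
  have hm : Measurable fun x : (ℝ × ℝ) × Ω => {x : (ℝ × ℝ) × Ω | x.1.2 < linkDist p D N x.2}.indicator
      (fun x => Complex.exp (-(Complex.I * x.1.1 * (totalPower p C M D N x.2 : ℝ)))) x :=
    Measurable.indicator (by fun_prop)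
      (measurableSet_lt (measurable_snd.comp measurable_fst) (hR.comp measurable_snd))
  exact hm.stronglyMeasurable.integral_prod_right'.measurable

/-- Because the kernel is defined through an expectation over `Ω`, its joint measurability and its
continuity in the frequency follow from general theorems, without any study of the explicit
exponents. -/
theorem measurable_totalKernel (hC : ∀ i, Measurable (C i)) (hM : ∀ i, Measurable (M i))
    (hD : ∀ i, Measurable (D i)) (hN : ∀ i, Measurable (N i)) :
    Measurable (Function.uncurry (totalKernel p C M D N μ)) := by
  have h1 := measurable_tailChar (p := p) (μ := μ) hC hM hD hN
  have h2 := measurable_signal p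
  refine Measurable.mul (Measurable.mul ?_ ?_) h1
  · have : Measurable fun x : ℝ × ℝ => Complex.exp (-(Complex.I * x.1 * (signal p x.2 : ℝ))) := by
      fun_prop
    exact this
  · have : Measurable fun x : ℝ × ℝ => (Real.exp (p.rateD * x.2 ^ 2 / 2) : ℂ) := by fun_prop
    exact this

theorem continuous_totalKernel (hC : ∀ i, Measurable (C i)) (hM : ∀ i, Measurable (M i))
    (hD : ∀ i, Measurable (D i)) (hN : ∀ i, Measurable (N i)) (r : ℝ) :
    Continuous fun w => totalKernel p C M D N μ w r := by
  have hR := measurable_linkDist (p := p) hD hN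
  have hZ := measurable_totalPower (p := p) hC hM hD hN
  have h : Continuous fun w => tailChar p C M D N μ w r := by
    refine continuous_of_dominated (bound := fun _ => 1) (fun w => ?_) (fun w => ?_)
      (integrable_const _) (.of_forall fun ω => ?_)
    · exact (Measurable.indicator (by fun_prop) (hR measurableSet_Ioi)).aestronglyMeasurable
    · exact .of_forall fun ω => (norm_indicator_le_norm_self _ _).trans
        (norm_exp_neg_I_mul_mul _ _).le
    · by_cases hω : ω ∈ linkDist p D N ⁻¹' Ioi r
      · simp only [indicator_of_mem hω]
        fun_prop
      · simp only [indicator_of_notMem hω]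
        fun_prop
  unfold totalKernel
  fun_prop

/-- The growing exponential in the kernel is exactly compensated by the probability that the link is
longer than `r`. -/
theorem norm_totalKernel_le
    (hD : IsMarkedPoisson D N (homogeneous ((1 - qCellular p) * p.lamU))
      ((shadowLaw p.sigmaD).prod fairCoin) μ) (w : ℝ) {r : ℝ} (hr : 0 ≤ r) :
    ‖totalKernel p C M D N μ w r‖ ≤ 1 := by
  have hR := measurable_linkDist (p := p) hD.poisson.measurable hD.measurable_mark
  have h1 : ‖tailChar p C M D N μ w r‖ ≤ Real.exp (-(p.rateD * r ^ 2 / 2)) := by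
    calc _ ≤ ∫ ω, ‖(linkDist p D N ⁻¹' Ioi r).indicator
          (fun ω => Complex.exp (-(Complex.I * w * (totalPower p C M D N ω : ℝ)))) ω‖ ∂μ :=
          norm_integral_le_integral_norm _
      _ = ∫ ω, (linkDist p D N ⁻¹' Ioi r).indicator 1 ω ∂μ := by
          refine integral_congr_ae (.of_forall fun ω => ?_)
          change ‖_‖ = _
          rw [norm_indicator_eq_indicator_norm]
          simp only [norm_exp_neg_I_mul_mul]
          rfl
      _ = _ := by
          rw [integral_indicator_one (hR measurableSet_Ioi), measureReal_def,
            ← Measure.map_apply hR measurableSet_Ioi, map_linkDist hD,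
            (lintegral_rayleigh_Ioi p.rateD_pos hr).2, ENNReal.toReal_ofReal (Real.exp_pos _).le]
  unfold totalKernel
  rw [norm_mul, norm_mul, norm_exp_neg_I_mul_mul, one_mul, Complex.norm_real,
    Real.norm_of_nonneg (Real.exp_pos _).le]
  calc _ ≤ Real.exp (p.rateD * r ^ 2 / 2) * Real.exp (-(p.rateD * r ^ 2 / 2)) := by gcongr
    _ = 1 := by rw [← Real.exp_add, add_neg_cancel, Real.exp_zero]

theorem tailChar_eq (hC : ∀ i, Measurable (C i)) (hM : ∀ i, Measurable (M i))
    (hD : IsMarkedPoisson D N (homogeneous ((1 - qCellular p) * p.lamU))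
      ((shadowLaw p.sigmaD).prod fairCoin) μ)
    (hCD : IndepFun (fun ω i => (C i ω, M i ω)) (fun ω j => (D j ω, N j ω)) μ) (w : ℝ) {a : ℝ}
    (ha : 0 ≤ a) : tailChar p C M D N μ w a = deviceChar p w a *
      ((∫ ω, Complex.exp (-(Complex.I * w * ((interfC p C M ω).toReal : ℝ))) ∂μ) *
        Complex.exp (-(Complex.I * w * (p.eta : ℝ)))) := by
  rw [← setIntegral_exp_totalPower hC hM hD hCD w ha, ← integral_indicator
    (measurable_linkDist hD.poisson.measurable hD.measurable_mark measurableSet_Ioi)]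
  rfl

/-- The disintegration of `deviceChar`, multiplied by the cellular and noise factors, which do not
depend on the link distance. The exponential of the Rayleigh density cancels the one built into the
kernel. -/
theorem setIntegral_Ioi_totalKernel (hC : ∀ i, Measurable (C i)) (hM : ∀ i, Measurable (M i))
    (hD : IsMarkedPoisson D N (homogeneous ((1 - qCellular p) * p.lamU))
      ((shadowLaw p.sigmaD).prod fairCoin) μ)
    (hCD : IndepFun (fun ω i => (C i ω, M i ω)) (fun ω j => (D j ω, N j ω)) μ) (w : ℝ) {a : ℝ}
    (ha : 0 ≤ a) :
    ∫ ω in linkDist p D N ⁻¹' Ioi a, Complex.exp (-(Complex.I * w * (totalPower p C M D N ω : ℝ)))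
      ∂μ = ∫ r in Ioi a, totalKernel p C M D N μ w r ∂(rayleigh p.rateD) := by
  rw [setIntegral_exp_totalPower hC hM hD hCD w ha, deviceChar_eq_integral p w ha,
    ← integral_mul_const, integral_rayleigh_Ioi p.rateD_pos ha]
  refine setIntegral_congr_fun measurableSet_Ioi fun r (hr : a < r) => ?_
  unfold totalKernel
  rw [tailChar_eq hC hM hD hCD w (ha.trans hr.le)]
  have : (Real.exp (-(p.rateD * r ^ 2 / 2)) : ℂ) * (Real.exp (p.rateD * r ^ 2 / 2) : ℂ) = 1 := by
    rw [← Complex.ofReal_mul, ← Real.exp_add, neg_add_cancel, Real.exp_zero, Complex.ofReal_one]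
  push_cast at this ⊢
  linear_combination (-(Complex.exp (-(Complex.I * w * (signal p r : ℝ))) * (p.rateD * r) *
    (deviceChar p w r * ((∫ ω, Complex.exp (-(Complex.I * w * ((interfC p C M ω).toReal : ℝ))) ∂μ) *
      Complex.exp (-(Complex.I * w * (p.eta : ℝ))))))) * this

/-- At frequency `w / signal p r` the constants of the signal power cancel, leaving the ratio of the
two path losses. -/
theorem charD_eq (p : Params) (w : ℝ) {r : ℝ} (hr : 0 < r) :
    charD p w r = Complex.exp (-(p.rateD * deviceExponent p (w / signal p r) r)) := by
  have hSc : (signal p r : ℂ) ≠ 0 := by exact_mod_cast (signal_pos p hr).ne'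
  have hexp : deviceExponent p (w / signal p r) r = ∫ L in Ioi r, (1 - Complex.exp
      (-(Complex.I * w * (L ^ (-p.alphaD) / r ^ (-p.alphaD) : ℝ)))) * (L : ℂ) := by
    refine setIntegral_congr_fun measurableSet_Ioi fun L hL => ?_
    have : signal p L = L ^ (-p.alphaD) / r ^ (-p.alphaD) * signal p r := by
      have := (Real.rpow_pos_of_pos hr (-p.alphaD)).ne'
      unfold signal
      field_simp
    rw [this]
    congr 4
    push_cast
    field_simp
  unfold charD
  rw [hexp]
  congr 1
  unfold Params.rateD
  push_cast
  ring

/-- The factor `exp (-i w)` is the contribution of the serving signal to the normalized total power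
`1 + 1/SINR`. -/
theorem totalKernel_eq (hY : IsMarkedPoisson Y xi (homogeneous p.lamB) (shadowLaw p.sigmaB) μ)
    (hC : IsMarkedPoisson C M (homogeneous p.lamB)
      ((shadowLaw p.sigmaB).prod (cellularDistLaw p Y xi μ)) μ)
    (hD : IsMarkedPoisson D N (homogeneous ((1 - qCellular p) * p.lamU))
      ((shadowLaw p.sigmaD).prod fairCoin) μ)
    (hCD : IndepFun (fun ω i => (C i ω, M i ω)) (fun ω j => (D j ω, N j ω)) μ) (w : ℝ) {r : ℝ}
    (hr : 0 < r) :
    totalKernel p C M D N μ (w / signal p r) r =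
      Complex.exp (-(Complex.I * w)) * charInvSinr p w r := by
  have hS := signal_pos p hr
  have hSc : (signal p r : ℂ) ≠ 0 := by exact_mod_cast hS.ne'
  unfold totalKernel
  rw [tailChar_eq hC.poisson.measurable hC.measurable_mark hD hCD _ hr.le,
    integral_exp_interfC hY hC]
  have hdev : (Real.exp (p.rateD * r ^ 2 / 2) : ℂ) * deviceChar p (w / signal p r) r =
      charD p w r := by
    unfold deviceChar
    rw [charD_eq p w hr, Complex.ofReal_exp, ← Complex.exp_add]
    congr 1
    push_cast
    ring
  have h1 : Complex.I * ((w / signal p r : ℝ) : ℂ) * (signal p r : ℝ) = Complex.I * w := by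
    push_cast
    field_simp
  have h2 : Complex.I * ((w / signal p r : ℝ) : ℂ) * (p.eta : ℝ) =
      Complex.I * w * ((p.eta / signal p r : ℝ) : ℂ) := by
    push_cast
    field_simp
  unfold charInvSinr
  rw [h1, h2, ← hdev]
  ring

/-- Almost surely the SINR is a positive real number, and its inverse is the ratio of the total
power to the signal, up to the signal itself. -/
theorem ae_sinr_spec (hY : IsMarkedPoisson Y xi (homogeneous p.lamB) (shadowLaw p.sigmaB) μ)
    (hC : IsMarkedPoisson C M (homogeneous p.lamB)
      ((shadowLaw p.sigmaB).prod (cellularDistLaw p Y xi μ)) μ)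
    (hD : IsMarkedPoisson D N (homogeneous ((1 - qCellular p) * p.lamU))
      ((shadowLaw p.sigmaD).prod fairCoin) μ) :
    ∀ᵐ ω ∂μ, sinr p C M D N ω ≠ 0 ∧ sinr p C M D N ω ≠ ∞ ∧
      (sinr p C M D N ω)⁻¹.toReal =
        totalPower p C M D N ω / signal p (linkDist p D N ω) - 1 := by
  filter_upwards [ae_interfC hY hC, ae_linkDist_spec hD] with ω ⟨hC0, hCt⟩ ⟨hpos, hDt, hrx, _⟩
  have hS := signal_pos p hpos
  have htot := totalD_eq p D N ω
  rw [hrx] at htot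
  have hIt : interfD p D N ω ≠ ∞ := fun h => hDt (by rw [htot, h, add_top])
  have hden : interfC p C M ω + interfD p D N ω + ENNReal.ofReal p.eta ≠ ∞ := by
    simp [hCt, hIt]
  have hden0 : interfC p C M ω + interfD p D N ω + ENNReal.ofReal p.eta ≠ 0 := by
    simp [hC0]
  unfold sinr
  rw [hrx]
  refine ⟨?_, ?_, ?_⟩
  · rw [ENNReal.div_ne_zero]
    exact ⟨by simpa using hS, hden⟩
  · exact ENNReal.div_ne_top ENNReal.ofReal_ne_top hden0
  · rw [ENNReal.inv_div (Or.inl hden) (Or.inl hden0), ENNReal.toReal_div,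
      ENNReal.toReal_add (by simp [hCt, hIt]) ENNReal.ofReal_ne_top, ENNReal.toReal_add hCt hIt,
      ENNReal.toReal_ofReal p.eta_nonneg, ENNReal.toReal_ofReal hS.le]
    unfold totalPower
    rw [htot, ENNReal.toReal_add ENNReal.ofReal_ne_top hIt, ENNReal.toReal_ofReal hS.le]
    field_simp
    ring

/-- `charInvSinr` is the characteristic function of the inverse SINR given the link distance. -/
theorem setIntegral_exp_inv_sinr
    (hY : IsMarkedPoisson Y xi (homogeneous p.lamB) (shadowLaw p.sigmaB) μ)
    (hC : IsMarkedPoisson C M (homogeneous p.lamB)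
      ((shadowLaw p.sigmaB).prod (cellularDistLaw p Y xi μ)) μ)
    (hD : IsMarkedPoisson D N (homogeneous ((1 - qCellular p) * p.lamU))
      ((shadowLaw p.sigmaD).prod fairCoin) μ)
    (hCD : IndepFun (fun ω i => (C i ω, M i ω)) (fun ω j => (D j ω, N j ω)) μ) (w : ℝ)
    {A : Set ℝ} (hA : MeasurableSet A) :
    ∫ ω in linkDist p D N ⁻¹' A,
      Complex.exp (-(Complex.I * w * ((sinr p C M D N ω)⁻¹.toReal : ℝ))) ∂μ =
      ∫ r in A, charInvSinr p w r ∂(rayleigh p.rateD) := by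
  have hCm := hC.poisson.measurable
  have hMm := hC.measurable_mark
  have hDm := hD.poisson.measurable
  have hNm := hD.measurable_mark
  have hR := measurable_linkDist (p := p) hDm hNm
  have hZ := measurable_totalPower (p := p) hCm hMm hDm hNm
  have hk := measurable_totalKernel (p := p) (μ := μ) hCm hMm hDm hNm
  have hmap := map_linkDist hD
  have := isProbabilityMeasure_rayleigh p.rateD_pos
  have hbd : ∀ᵐ r ∂(rayleigh p.rateD), ∀ w, ‖totalKernel p C M D N μ w r‖ ≤ 1 :=
    (ae_pos_rayleigh _).mono fun r hr w => norm_totalKernel_le hD w hr.le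
  have hR0 : ∀ᵐ ω ∂μ, 0 < linkDist p D N ω := (ae_linkDist_spec hD).mono fun ω h => h.1
  have hall : ∀ (w : ℝ) (A : Set ℝ), MeasurableSet A → ∫ ω in linkDist p D N ⁻¹' A,
      Complex.exp (-(Complex.I * w * (totalPower p C M D N ω : ℝ))) ∂μ =
      ∫ r in A, totalKernel p C M D N μ w r ∂(μ.map (linkDist p D N)) := fun w A hA => by
    rw [hmap]
    refine setIntegral_preimage_eq_of_Ioi hR hR0 (ae_pos_rayleigh _) ?_ ?_
      (fun a ha => setIntegral_Ioi_totalKernel hCm hMm hD hCD w ha) hA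
    · exact Integrable.of_bound (Measurable.aestronglyMeasurable (by fun_prop)) 1
        (.of_forall fun ω => (norm_exp_neg_I_mul_mul _ _).le)
    · exact Integrable.of_bound
        (hk.comp (measurable_prodMk_left (x := w))).aestronglyMeasurable 1
        (hbd.mono fun r hr => hr w)
  -- The frequency `w / signal p R` normalizes the total power by the random signal.
  have hsub := setIntegral_exp_substitute hR hZ hk (continuous_totalKernel hCm hMm hDm hNm)
    (by rwa [hmap]) hall (f := fun r => w / signal p r)
    (measurable_const.div (measurable_signal p)) hA
  rw [hmap] at hsub
  have h1 : ∫ r in A, totalKernel p C M D N μ (w / signal p r) r ∂(rayleigh p.rateD) =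
      Complex.exp (-(Complex.I * w)) * ∫ r in A, charInvSinr p w r ∂(rayleigh p.rateD) := by
    rw [← integral_const_mul]
    exact setIntegral_congr_ae hA ((ae_pos_rayleigh _).mono fun r hr _ =>
      totalKernel_eq hY hC hD hCD w hr)
  have h2 : ∫ ω in linkDist p D N ⁻¹' A, Complex.exp (-(Complex.I *
      ((w / signal p (linkDist p D N ω) : ℝ) : ℂ) * (totalPower p C M D N ω : ℝ))) ∂μ =
      Complex.exp (-(Complex.I * w)) * ∫ ω in linkDist p D N ⁻¹' A,
        Complex.exp (-(Complex.I * w * ((sinr p C M D N ω)⁻¹.toReal : ℝ))) ∂μ := by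
    rw [← integral_const_mul]
    refine setIntegral_congr_ae (hR hA) ?_
    filter_upwards [ae_sinr_spec hY hC hD, hR0] with ω hω hpos _
    have hS : (signal p (linkDist p D N ω) : ℂ) ≠ 0 := by
      exact_mod_cast (signal_pos p hpos).ne'
    rw [hω.2.2, ← Complex.exp_add]
    congr 1
    push_cast
    field_simp
    ring
  rw [h1, h2] at hsub
  exact mul_left_cancel₀ (Complex.exp_ne_zero _) hsub

/-- Measurability of the explicit formula is inherited from `totalKernel`. The two agree only for `r
> 0`, which suffices since the Rayleigh law lives there. -/
theorem exists_measurable_charInvSinr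
    (hY : IsMarkedPoisson Y xi (homogeneous p.lamB) (shadowLaw p.sigmaB) μ)
    (hC : IsMarkedPoisson C M (homogeneous p.lamB)
      ((shadowLaw p.sigmaB).prod (cellularDistLaw p Y xi μ)) μ)
    (hD : IsMarkedPoisson D N (homogeneous ((1 - qCellular p) * p.lamU))
      ((shadowLaw p.sigmaD).prod fairCoin) μ)
    (hCD : IndepFun (fun ω i => (C i ω, M i ω)) (fun ω j => (D j ω, N j ω)) μ) :
    ∃ F : ℝ × ℝ → ℂ, Measurable F ∧ ∀ r w, 0 < r → charInvSinr p w r = F (r, w) := by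
  refine ⟨fun x => Complex.exp (Complex.I * x.2) *
    Function.uncurry (totalKernel p C M D N μ) (x.2 / signal p x.1, x.1), ?_, fun r w hr => ?_⟩
  · have hk := measurable_totalKernel (p := p) (μ := μ) hC.poisson.measurable hC.measurable_mark
      hD.poisson.measurable hD.measurable_mark
    have hS := measurable_signal p
    refine Measurable.mul (by fun_prop) (hk.comp ?_)
    fun_prop
  · change _ = _ * totalKernel p C M D N μ (w / signal p r) r
    rw [totalKernel_eq hY hC hD hCD w hr, ← mul_assoc, ← Complex.exp_add, add_neg_cancel,
      Complex.exp_zero, one_mul]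

theorem measurable_sinr (hC : ∀ i, Measurable (C i)) (hM : ∀ i, Measurable (M i))
    (hD : ∀ i, Measurable (D i)) (hN : ∀ i, Measurable (N i)) :
    Measurable (sinr p C M D N) := by
  have hs : Measurable (serving p D N) := measurable_strongest (measurable_rxD2D hD hN)
  have h1 := measurable_eval_nat (f := fun k ω => rxD2D p D N ω k) (measurable_rxD2D hD hN) hs
  have h2 : Measurable (interfD p D N) := by
    refine Measurable.tsum fun j => Measurable.ite ?_ measurable_const
      (measurable_rxD2D hD hN j).ennreal_ofReal
    exact measurableSet_eq_fun measurable_const hs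
  exact h1.ennreal_ofReal.div (((measurable_interfC hC hM).add h2).add_const _)

/-- The conditional characteristic function of the inverse SINR given the link distance. -/
theorem condExp_exp_inv_sinr
    (hY : IsMarkedPoisson Y xi (homogeneous p.lamB) (shadowLaw p.sigmaB) μ)
    (hC : IsMarkedPoisson C M (homogeneous p.lamB)
      ((shadowLaw p.sigmaB).prod (cellularDistLaw p Y xi μ)) μ)
    (hD : IsMarkedPoisson D N (homogeneous ((1 - qCellular p) * p.lamU))
      ((shadowLaw p.sigmaD).prod fairCoin) μ)
    (hCD : IndepFun (fun ω i => (C i ω, M i ω)) (fun ω j => (D j ω, N j ω)) μ) (w : ℝ) :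
    μ[fun ω => Complex.exp (-(Complex.I * w * ((sinr p C M D N ω)⁻¹.toReal : ℝ))) |
        MeasurableSpace.comap (linkDist p D N) inferInstance]
      =ᵐ[μ] fun ω => charInvSinr p w (linkDist p D N ω) := by
  have hDm := hD.poisson.measurable
  have hNm := hD.measurable_mark
  have hR := measurable_linkDist (p := p) hDm hNm
  have hsinr := measurable_sinr (p := p) hC.poisson.measurable hC.measurable_mark hDm hNm
  have hmap := map_linkDist hD
  obtain ⟨F, hF, hFeq⟩ := exists_measurable_charInvSinr hY hC hD hCD
  have hFm : Measurable fun r => F (r, w) := hF.comp (by fun_prop)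
  have hae : (fun r => charInvSinr p w r) =ᵐ[rayleigh p.rateD] fun r => F (r, w) :=
    (ae_pos_rayleigh _).mono fun r hr => hFeq r w hr
  have hint : Integrable (fun ω => charInvSinr p w (linkDist p D N ω)) μ := by
    have hb : ∀ᵐ r ∂(rayleigh p.rateD), ‖charInvSinr p w r‖ ≤ 1 := by
      filter_upwards [ae_pos_rayleigh p.rateD] with r hr
      have h1 := norm_totalKernel_le (C := C) (M := M) hD (w / signal p r) hr.le
      rw [totalKernel_eq hY hC hD hCD w hr, norm_mul, norm_exp_neg_I_mul, one_mul] at h1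
      exact h1
    rw [← hmap] at hae hb
    refine Integrable.of_bound ?_ 1 (ae_of_ae_map hR.aemeasurable hb)
    exact ⟨fun ω => F (linkDist p D N ω, w), (hFm.comp hR).stronglyMeasurable,
      ae_of_ae_map hR.aemeasurable hae⟩
  symm
  refine ae_eq_condExp_of_forall_setIntegral_eq hR.comap_le ?_ (fun s _ _ => hint.integrableOn)
    ?_ ?_
  · exact Integrable.of_bound (Measurable.aestronglyMeasurable (by fun_prop)) 1
      (.of_forall fun ω => (norm_exp_neg_I_mul_mul _ _).le)
  · rintro s ⟨A, hA, rfl⟩ -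
    rw [setIntegral_exp_inv_sinr hY hC hD hCD w hA, ← hmap]
    refine (setIntegral_map hA ?_ hR.aemeasurable).symm
    rw [← hmap] at hae
    exact ⟨fun r => F (r, w), hFm.stronglyMeasurable, hae⟩
  · refine ⟨fun ω => F (linkDist p D N ω, w), ?_, ?_⟩
    · exact (hFm.comp (comap_measurable _)).stronglyMeasurable
    · rw [← hmap] at hae
      exact ae_of_ae_map hR.aemeasurable hae

end Conditional

/-! ### Fourier inversion on an interval. -/

section Inversion

/-- The Fourier kernel of the interval `(0, x]`. -/
noncomputable def intervalKernel (x w : ℝ) : ℂ :=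
  (Complex.exp (Complex.I * w * x) - 1) / (2 * Real.pi * Complex.I * w)

theorem measurable_intervalKernel (x : ℝ) : Measurable (intervalKernel x) := by
  unfold intervalKernel
  fun_prop

theorem continuous_intervalKernel (w : ℝ) : Continuous fun x => intervalKernel x w := by
  unfold intervalKernel
  fun_prop

/-- The numerator is bounded by both `2` and `|w x|`; the second bound handles small `w`, the first
gives the decay. At `w = 0` the kernel is 0 by the convention for division. -/
theorem norm_intervalKernel_le (x w : ℝ) : ‖intervalKernel x w‖ ≤ (|x| + 1) / (1 + |w|) := by
  have hpos : 0 < 1 + |w| := by positivity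
  rcases eq_or_ne w 0 with rfl | hw
  · simp [intervalKernel]
    positivity
  have hw0 : 0 < |w| := abs_pos.2 hw
  have h1 : ‖Complex.exp (Complex.I * w * x) - 1‖ ≤ min 2 (|w| * |x|) := by
    have := norm_one_sub_exp_le (-(w * x))
    rw [norm_sub_rev, abs_neg, abs_mul] at this
    refine le_trans (le_of_eq ?_) this
    congr 3
    push_cast
    ring
  have hden : ‖(2 * Real.pi * Complex.I * w : ℂ)‖ = 2 * Real.pi * |w| := by
    simp [abs_of_pos Real.pi_pos]
  unfold intervalKernel
  rw [norm_div, hden, div_le_div_iff₀ (by positivity) hpos]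
  have h2 := h1.trans (min_le_left _ _)
  have h3 := h1.trans (min_le_right _ _)
  have h4 : ‖Complex.exp (Complex.I * w * x) - 1‖ * |w| ≤ 2 * |w| := by gcongr
  have h5 : (|x| + 1) * (2 * 3 * |w|) ≤ (|x| + 1) * (2 * Real.pi * |w|) := by
    gcongr
    exact Real.pi_gt_three.le
  have h6 : 0 ≤ |w| * |x| := by positivity
  nlinarith

theorem intervalKernel_eq {w : ℝ} (hw : w ≠ 0) (x : ℝ) : intervalKernel x w =
    (2 * Real.pi : ℂ)⁻¹ * ∫ u in (0 : ℝ)..x, Complex.exp (Complex.I * w * u) := by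
  have hc : Complex.I * w ≠ 0 := mul_ne_zero Complex.I_ne_zero (by exact_mod_cast hw)
  rw [integral_exp_mul_complex hc]
  unfold intervalKernel
  simp only [Complex.ofReal_zero, mul_zero, Complex.exp_zero]
  have : (Real.pi : ℂ) ≠ 0 := by exact_mod_cast Real.pi_ne_zero
  field_simp

theorem norm_exp_I_mul (w u : ℝ) : ‖Complex.exp (Complex.I * w * u)‖ = 1 := by
  have := norm_exp_neg_I_mul_mul (-w) u
  simpa using this

theorem norm_exp_neg_mul_sq (b w : ℝ) :
    ‖Complex.exp (-(b : ℂ) * w ^ 2)‖ = Real.exp (-b * w ^ 2) := by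
  rw [Complex.norm_exp]
  congr 1
  rw [← Complex.ofReal_pow, ← Complex.ofReal_neg, ← Complex.ofReal_mul, Complex.ofReal_re]

/-- The variance of a centered Gaussian of standard deviation `δ`. -/
def sqVariance (δ : ℝ) : ℝ≥0 := NNReal.mk (δ ^ 2) (sq_nonneg δ)

theorem fourier_gaussian_eq_gaussianPDFReal {δ : ℝ} (hδ : 0 < δ) (y u : ℝ) :
    (2 * Real.pi : ℂ)⁻¹ * ∫ w : ℝ, Complex.exp (Complex.I * (u - y : ℝ) * w) *
      Complex.exp (-((δ ^ 2 / 2 : ℝ) : ℂ) * w ^ 2) = (gaussianPDFReal y (sqVariance δ) u : ℂ) := by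
  have hb : 0 < δ ^ 2 / 2 := by positivity
  rw [fourierIntegral_gaussian (b := ((δ ^ 2 / 2 : ℝ) : ℂ)) (by rwa [Complex.ofReal_re]) ((u - y : ℝ) : ℂ)]
  have h1 : ((Real.pi : ℂ) / ((δ ^ 2 / 2 : ℝ) : ℂ)) ^ (1 / 2 : ℂ) =
      ((Real.sqrt (2 * Real.pi) / δ : ℝ) : ℂ) := by
    rw [← Complex.ofReal_div, show (1 / 2 : ℂ) = ((1 / 2 : ℝ) : ℂ) by push_cast; rfl,
      ← Complex.ofReal_cpow (by positivity), ← Real.sqrt_eq_rpow]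
    congr 1
    rw [show Real.pi / (δ ^ 2 / 2) = 2 * Real.pi / δ ^ 2 by field_simp,
      Real.sqrt_div (by positivity), Real.sqrt_sq hδ.le]
  have h2 : Complex.exp (-((u - y : ℝ) : ℂ) ^ 2 / (4 * ((δ ^ 2 / 2 : ℝ) : ℂ))) =
      ((Real.exp (-(u - y) ^ 2 / (2 * δ ^ 2)) : ℝ) : ℂ) := by
    rw [Complex.ofReal_exp]
    congr 1
    push_cast
    ring
  rw [h1, h2, gaussianPDFReal_def]
  have hv : ((sqVariance δ : ℝ≥0) : ℝ) = δ ^ 2 := rfl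
  beta_reduce
  rw [hv, Real.sqrt_mul (show (0 : ℝ) ≤ 2 * Real.pi by positivity) (δ ^ 2), Real.sqrt_sq hδ.le]
  have h3 : (2 * Real.pi)⁻¹ * (Real.sqrt (2 * Real.pi) / δ) = (Real.sqrt (2 * Real.pi) * δ)⁻¹ := by
    have h4 : 0 < Real.sqrt (2 * Real.pi) := Real.sqrt_pos.2 (by positivity)
    nth_rewrite 1 [← Real.mul_self_sqrt (show 0 ≤ 2 * Real.pi by positivity)]
    field_simp
  push_cast [← h3]
  ring

/-- The kernel is the integral of `exp (i w u) / (2π)` over `u` in `(0, x]`. The Gaussian damping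
makes Fubini's theorem applicable, and the inner integral over `w` is the Gaussian density centred
at `y`. -/
theorem integral_intervalKernel_gaussian {δ : ℝ} (hδ : 0 < δ) {x : ℝ} (hx : 0 ≤ x) (y : ℝ) :
    ∫ w : ℝ, intervalKernel x w * Complex.exp (-((δ ^ 2 / 2 : ℝ) : ℂ) * w ^ 2) *
      Complex.exp (-(Complex.I * w * y)) =
      ((gaussianReal y (sqVariance δ)).real (Ioc 0 x) : ℂ) := by
  have hb : 0 < δ ^ 2 / 2 := by positivity
  have hv : sqVariance δ ≠ 0 := by
    rw [← NNReal.coe_ne_zero]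
    exact (pow_pos hδ 2).ne'
  have hint : Integrable (Function.uncurry fun w u : ℝ => Complex.exp (Complex.I * w * u) *
      (Complex.exp (-((δ ^ 2 / 2 : ℝ) : ℂ) * w ^ 2) * Complex.exp (-(Complex.I * w * y))))
      ((volume : Measure ℝ).prod (volume.restrict (Ioc 0 x))) := by
    have h1 : Integrable (fun z : ℝ × ℝ => Real.exp (-(δ ^ 2 / 2) * z.1 ^ 2) * (1 : ℝ))
        ((volume : Measure ℝ).prod (volume.restrict (Ioc 0 x))) :=
      (integrable_exp_neg_mul_sq hb).mul_prod (integrable_const 1)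
    refine Integrable.mono' h1 (Measurable.aestronglyMeasurable ?_) (.of_forall fun z => ?_)
    · unfold Function.uncurry
      fun_prop
    · change ‖_ * _‖ ≤ _
      rw [norm_mul, norm_mul, norm_exp_I_mul, norm_exp_neg_I_mul_mul, norm_exp_neg_mul_sq]
      simp
  calc _ = ∫ w : ℝ, (2 * Real.pi : ℂ)⁻¹ * ∫ u in Ioc 0 x, Complex.exp (Complex.I * w * u) *
        (Complex.exp (-((δ ^ 2 / 2 : ℝ) : ℂ) * w ^ 2) * Complex.exp (-(Complex.I * w * y))) := by
        refine integral_congr_ae ?_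
        filter_upwards [compl_mem_ae_iff.2 (measure_singleton (0 : ℝ))] with w hw
        rw [intervalKernel_eq hw, integral_mul_const, intervalIntegral.integral_of_le hx]
        ring
    _ = ∫ u in Ioc 0 x, (2 * Real.pi : ℂ)⁻¹ * ∫ w : ℝ, Complex.exp (Complex.I * w * u) *
        (Complex.exp (-((δ ^ 2 / 2 : ℝ) : ℂ) * w ^ 2) * Complex.exp (-(Complex.I * w * y))) := by
        rw [integral_const_mul, integral_const_mul, integral_integral_swap hint]
    _ = ∫ u in Ioc 0 x, (gaussianPDFReal y (sqVariance δ) u : ℂ) := by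
        refine integral_congr_ae (.of_forall fun u => ?_)
        beta_reduce
        rw [← fourier_gaussian_eq_gaussianPDFReal hδ]
        congr 2
        ext w
        rw [mul_comm (Complex.exp (-((δ ^ 2 / 2 : ℝ) : ℂ) * w ^ 2)), ← mul_assoc,
          ← Complex.exp_add]
        congr 2
        push_cast
        ring
    _ = _ := by
        rw [integral_complex_ofReal, measureReal_def, gaussianReal_apply_eq_integral _ hv,
          ENNReal.toReal_ofReal]
        exact integral_nonneg fun u => gaussianPDFReal_nonneg _ _ _

/-- As the variance vanishes the mass concentrates at `y`. Away from the two endpoints the indicator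
is locally constant there; at an endpoint the limit could be one half. -/
theorem tendsto_gaussianReal_Ioc {x y : ℝ} (h0 : y ≠ 0) (hx : y ≠ x) :
    Tendsto (fun δ => (gaussianReal y (sqVariance δ)).real (Ioc 0 x)) (𝓝[>] 0)
      (𝓝 ((Ioo 0 x).indicator 1 y)) := by
  have hmap : ∀ δ, (gaussianReal y (sqVariance δ)).real (Ioc 0 x) =
      ∫ z, (Ioc 0 x).indicator (1 : ℝ → ℝ) (y + δ * z) ∂(gaussianReal 0 1) := fun δ => by
    have h1 : gaussianReal y (sqVariance δ) = (gaussianReal 0 1).map (fun z => y + δ * z) := by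
      rw [← Function.comp_def (fun z => y + z), ← Measure.map_map (by fun_prop) (by fun_prop),
        gaussianReal_map_const_mul, gaussianReal_map_const_add]
      simp [sqVariance]
    rw [← integral_indicator_one measurableSet_Ioc, h1, integral_map (by fun_prop)]
    exact (measurable_one.indicator measurableSet_Ioc).aestronglyMeasurable
  simp_rw [hmap]
  have hlim : (Ioo 0 x).indicator (1 : ℝ → ℝ) y =
      ∫ _, (Ioo 0 x).indicator (1 : ℝ → ℝ) y ∂(gaussianReal 0 1) := by simp
  rw [hlim]
  refine tendsto_integral_filter_of_dominated_convergence (fun _ => 1) (.of_forall fun δ => ?_)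
    (.of_forall fun δ => .of_forall fun z => ?_) (integrable_const _) (.of_forall fun z => ?_)
  · exact ((measurable_one.indicator measurableSet_Ioc).comp
      (by fun_prop : Measurable fun z : ℝ => y + δ * z)).aestronglyMeasurable
  · refine (norm_indicator_le_norm_self _ _).trans ?_
    simp
  · have hc : Tendsto (fun δ : ℝ => y + δ * z) (𝓝[>] 0) (𝓝 y) := by
      have : Continuous fun δ : ℝ => y + δ * z := by fun_prop
      have h2 := this.tendsto 0
      simp only [zero_mul, add_zero] at h2
      exact h2.mono_left nhdsWithin_le_nhds
    refine tendsto_const_nhds.congr' ?_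
    by_cases hy : y ∈ Ioo 0 x
    · filter_upwards [hc.eventually (isOpen_Ioo.mem_nhds hy)] with δ hδ
      rw [indicator_of_mem hy, indicator_of_mem (Ioo_subset_Ioc_self hδ)]
      rfl
    · have hy' : y ∈ (Icc 0 x)ᶜ := fun h => hy
        ⟨lt_of_le_of_ne h.1 (Ne.symm h0), lt_of_le_of_ne h.2 hx⟩
      filter_upwards [hc.eventually (isClosed_Icc.isOpen_compl.mem_nhds hy')] with δ hδ
      rw [indicator_of_notMem hy, indicator_of_notMem fun h => hδ (Ioc_subset_Icc_self h)]

variable {Ω : Type*} [MeasurableSpace Ω] {μ : Measure Ω} [IsProbabilityMeasure μ] {X : Ω → ℝ}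
  {Φ : ℝ → ℂ}

theorem continuous_charFunction (hX : Measurable X)
    (hΦ : ∀ w, Φ w = ∫ ω, Complex.exp (-(Complex.I * w * (X ω : ℝ))) ∂μ) : Continuous Φ := by
  rw [funext hΦ]
  refine continuous_of_dominated (bound := fun _ => 1) (fun w => ?_) (fun w => ?_)
    (integrable_const _) (.of_forall fun ω => by fun_prop)
  · exact Measurable.aestronglyMeasurable (by fun_prop)
  · exact .of_forall fun ω => (norm_exp_neg_I_mul_mul _ _).le

theorem integrable_intervalKernel_mul (hΦc : AEStronglyMeasurable Φ)
    (hint : Integrable fun w => ‖Φ w‖ / (1 + |w|)) (x : ℝ) :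
    Integrable fun w => intervalKernel x w * Φ w := by
  refine (hint.const_mul (|x| + 1)).mono'
    ((measurable_intervalKernel x).aestronglyMeasurable.mul hΦc) (.of_forall fun w => ?_)
  rw [norm_mul]
  calc _ ≤ (|x| + 1) / (1 + |w|) * ‖Φ w‖ := by
        gcongr
        exact norm_intervalKernel_le x w
    _ = _ := by ring

/-- The damped inversion integral equals the mean Gaussian mass of the interval around `X`. Letting
the damping vanish, the left side converges by the assumed absolute integrability, and the right
side because `X` almost surely avoids both endpoints. -/
theorem integral_inversion_of_not_atom (hX : Measurable X)
    (hΦ : ∀ w, Φ w = ∫ ω, Complex.exp (-(Complex.I * w * (X ω : ℝ))) ∂μ)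
    (hint : Integrable fun w => ‖Φ w‖ / (1 + |w|)) (h0 : ∀ᵐ ω ∂μ, X ω ≠ 0) {x : ℝ} (hx : 0 ≤ x)
    (hxa : ∀ᵐ ω ∂μ, X ω ≠ x) :
    ∫ w, intervalKernel x w * Φ w = (μ.real {ω | X ω ∈ Ioo 0 x} : ℂ) := by
  have hΦc := (continuous_charFunction hX hΦ).aestronglyMeasurable (μ := volume)
  have hI := integrable_intervalKernel_mul hΦc hint x
  have h1 : Tendsto (fun δ : ℝ => ∫ w : ℝ, intervalKernel x w * Φ w *
      Complex.exp (-((δ ^ 2 / 2 : ℝ) : ℂ) * w ^ 2)) (𝓝[>] 0)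
      (𝓝 (∫ w, intervalKernel x w * Φ w)) := by
    refine tendsto_integral_filter_of_dominated_convergence
      (fun w => ‖intervalKernel x w * Φ w‖) (.of_forall fun δ => ?_)
      (.of_forall fun δ => .of_forall fun w => ?_) hI.norm (.of_forall fun w => ?_)
    · exact hI.1.mul (Measurable.aestronglyMeasurable (by fun_prop))
    · rw [norm_mul, norm_exp_neg_mul_sq]
      refine mul_le_of_le_one_right (norm_nonneg _) (Real.exp_le_one_iff.2 ?_)
      nlinarith [sq_nonneg δ, sq_nonneg w, mul_nonneg (sq_nonneg δ) (sq_nonneg w)]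
    · have hc : Continuous fun δ : ℝ => intervalKernel x w * Φ w *
          Complex.exp (-((δ ^ 2 / 2 : ℝ) : ℂ) * w ^ 2) := by fun_prop
      have := (hc.tendsto 0).mono_left (nhdsWithin_le_nhds (s := Ioi 0))
      simpa using this
  have h2 : Tendsto (fun δ : ℝ => ∫ ω, ((gaussianReal (X ω) (sqVariance δ)).real (Ioc 0 x) : ℂ) ∂μ)
      (𝓝[>] 0) (𝓝 (∫ ω, (((Ioo 0 x).indicator 1 (X ω) : ℝ) : ℂ) ∂μ)) := by
    simp_rw [integral_complex_ofReal]
    refine (Complex.continuous_ofReal.tendsto _).comp ?_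
    refine tendsto_integral_filter_of_dominated_convergence (fun _ => 1) ?_
      (.of_forall fun δ => .of_forall fun ω => ?_) (integrable_const _) ?_
    · filter_upwards [self_mem_nhdsWithin] with δ (hδ : 0 < δ)
      have hm : StronglyMeasurable fun ω => ∫ w : ℝ, intervalKernel x w *
          Complex.exp (-((δ ^ 2 / 2 : ℝ) : ℂ) * w ^ 2) *
          Complex.exp (-(Complex.I * w * (X ω : ℝ))) := by
        have := measurable_intervalKernel x
        refine StronglyMeasurable.integral_prod_right' (f := fun z : Ω × ℝ => intervalKernel x z.2 *
          Complex.exp (-((δ ^ 2 / 2 : ℝ) : ℂ) * z.2 ^ 2) *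
          Complex.exp (-(Complex.I * z.2 * (X z.1 : ℝ)))) (Measurable.stronglyMeasurable ?_)
        fun_prop
      simp_rw [integral_intervalKernel_gaussian hδ hx] at hm
      have := Complex.measurable_re.comp hm.measurable
      exact this.aestronglyMeasurable
    · rw [Real.norm_of_nonneg measureReal_nonneg]
      exact measureReal_le_one
    · filter_upwards [h0, hxa] with ω hω1 hω2
      exact tendsto_gaussianReal_Ioc hω1 hω2
  have h3 : ∀ᶠ δ : ℝ in 𝓝[>] 0, ∫ w : ℝ, intervalKernel x w * Φ w *
      Complex.exp (-((δ ^ 2 / 2 : ℝ) : ℂ) * w ^ 2) =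
      ∫ ω, ((gaussianReal (X ω) (sqVariance δ)).real (Ioc 0 x) : ℂ) ∂μ := by
    filter_upwards [self_mem_nhdsWithin] with δ (hδ : 0 < δ)
    have hb : 0 < δ ^ 2 / 2 := by positivity
    simp_rw [← integral_intervalKernel_gaussian hδ hx]
    rw [integral_integral_swap]
    · refine integral_congr_ae (.of_forall fun w => ?_)
      beta_reduce
      rw [integral_const_mul, hΦ]
      ring
    · have hb1 : Integrable (fun z : Ω × ℝ => (1 : ℝ) * ((|x| + 1) *
          Real.exp (-(δ ^ 2 / 2) * z.2 ^ 2))) (μ.prod volume) :=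
        (integrable_const (1 : ℝ)).mul_prod ((integrable_exp_neg_mul_sq hb).const_mul (|x| + 1))
      refine Integrable.mono' hb1 (Measurable.aestronglyMeasurable ?_) (.of_forall fun z => ?_)
      · have := measurable_intervalKernel x
        unfold Function.uncurry
        fun_prop
      · change ‖_ * _ * _‖ ≤ _
        rw [norm_mul, norm_mul, norm_exp_neg_I_mul_mul, norm_exp_neg_mul_sq, mul_one, one_mul]
        gcongr
        refine (norm_intervalKernel_le x z.2).trans (div_le_self (by positivity) ?_)
        linarith [abs_nonneg z.2]
  have h4 := tendsto_nhds_unique (h1.congr' h3) h2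
  rw [h4, integral_complex_ofReal]
  congr 1
  change _ = μ.real (X ⁻¹' Ioo 0 x)
  rw [← integral_indicator_one (hX measurableSet_Ioo)]
  rfl

/-- The inversion formula for the probability of an open interval from the origin. -/
theorem integral_inversion (hX : Measurable X)
    (hΦ : ∀ w, Φ w = ∫ ω, Complex.exp (-(Complex.I * w * (X ω : ℝ))) ∂μ)
    (hint : Integrable fun w => ‖Φ w‖ / (1 + |w|)) (h0 : ∀ᵐ ω ∂μ, X ω ≠ 0) {x : ℝ} (hx : 0 < x) :
    ∫ w, intervalKernel x w * Φ w = (μ.real {ω | X ω ∈ Ioo 0 x} : ℂ) := by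
  have hΦc := (continuous_charFunction hX hΦ).aestronglyMeasurable (μ := volume)
  have hcount : {y : ℝ | 0 < μ (X ⁻¹' {y})}.Countable :=
    Measure.countable_meas_pos_of_disjoint_iUnion (μ := μ)
      (fun y => hX (measurableSet_singleton y))
      (fun y z hyz => Disjoint.preimage _ (by simpa using hyz))
  have hdense := hcount.dense_compl ℝ
  -- The atoms of `X` are countable, so `x` is a limit from below of points that are not atoms.
  -- Along these the probability of `(0, y)` tends to that of the open interval `(0, x)`, even if
  -- `x` is itself an atom.
  set S : Set ℝ := Ioo 0 x ∩ {y : ℝ | 0 < μ (X ⁻¹' {y})}ᶜ with hS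
  have hmem : x ∈ closure S := by
    have h1 := closure_mono (hdense.open_subset_closure_inter (isOpen_Ioo (a := (0 : ℝ)) (b := x)))
    rw [closure_closure, closure_Ioo hx.ne] at h1
    exact h1 ⟨hx.le, le_rfl⟩
  have hne : (𝓝[S] x).NeBot := mem_closure_iff_nhdsWithin_neBot.1 hmem
  have hGc : Continuous fun y => ∫ w, intervalKernel y w * Φ w := by
    refine continuous_iff_continuousAt.2 fun y => ?_
    refine continuousAt_of_dominated (bound := fun w => (|y| + 2) * (‖Φ w‖ / (1 + |w|)))
      (.of_forall fun z => (integrable_intervalKernel_mul hΦc hint z).1) ?_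
      (hint.const_mul _) (.of_forall fun w =>
        ((continuous_intervalKernel w).mul continuous_const).continuousAt)
    filter_upwards [Metric.ball_mem_nhds y one_pos] with z hz
    refine .of_forall fun w => ?_
    have hz' : |z| ≤ |y| + 1 := by
      have h1 := abs_sub_abs_le_abs_sub z y
      have h2 : |z - y| < 1 := by simpa [Real.dist_eq] using hz
      linarith
    rw [norm_mul]
    calc _ ≤ (|z| + 1) / (1 + |w|) * ‖Φ w‖ := by
          gcongr
          exact norm_intervalKernel_le z w
      _ ≤ (|y| + 2) / (1 + |w|) * ‖Φ w‖ := by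
          have : |z| + 1 ≤ |y| + 2 := by linarith
          gcongr
      _ = _ := by ring
  have hP : Tendsto (fun y => (μ.real {ω | X ω ∈ Ioo 0 y} : ℂ)) (𝓝[S] x)
      (𝓝 (μ.real {ω | X ω ∈ Ioo 0 x} : ℂ)) := by
    refine (Complex.continuous_ofReal.tendsto _).comp ?_
    have hind : ∀ y, μ.real {ω | X ω ∈ Ioo 0 y} = ∫ ω, (Ioo 0 y).indicator (1 : ℝ → ℝ) (X ω) ∂μ :=
      fun y => by
        change μ.real (X ⁻¹' Ioo 0 y) = _
        rw [← integral_indicator_one (hX measurableSet_Ioo)]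
        rfl
    simp_rw [hind]
    refine tendsto_integral_filter_of_dominated_convergence (fun _ => 1) (.of_forall fun y => ?_)
      (.of_forall fun y => .of_forall fun ω => ?_) (integrable_const _) (.of_forall fun ω => ?_)
    · exact ((measurable_one.indicator measurableSet_Ioo).comp hX).aestronglyMeasurable
    · refine (norm_indicator_le_norm_self _ _).trans ?_
      simp
    · refine tendsto_const_nhds.congr' ?_
      by_cases hω : X ω ∈ Ioo 0 x
      · filter_upwards [mem_nhdsWithin_of_mem_nhds (Ioi_mem_nhds hω.2)] with y hy
        have hy' : X ω ∈ Ioo 0 y := ⟨hω.1, hy⟩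
        rw [indicator_of_mem hω, indicator_of_mem hy']
      · filter_upwards [self_mem_nhdsWithin] with y hy
        have hyx : y < x := hy.1.2
        have hy' : X ω ∉ Ioo 0 y := fun h => hω (mem_Ioo.2 ⟨h.1, lt_trans h.2 hyx⟩)
        rw [indicator_of_notMem hω, indicator_of_notMem hy']
  refine tendsto_nhds_unique ((hGc.tendsto x).mono_left nhdsWithin_le_nhds) (hP.congr' ?_)
  filter_upwards [self_mem_nhdsWithin] with y hy
  refine (integral_inversion_of_not_atom hX hΦ hint h0 hy.1.1.le ?_).symm
  have h1 : μ (X ⁻¹' {y}) = 0 := by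
    have := hy.2
    simpa using this
  exact compl_mem_ae_iff.2 h1

end Inversion

/-! ### Decay of the characteristic function in the frequency. -/

section Decay

theorem signal_scale (p : Params) {r u v : ℝ} (hr : 0 < r) (hu : 0 < u) (hv : 0 < v) :
    (u / r) ^ p.alphaD / signal p r * signal p v = (v / u) ^ (-p.alphaD) := by
  have h1 := (Real.rpow_pos_of_pos hr (-p.alphaD)).ne'
  have h2 := (Real.rpow_pos_of_pos hr p.alphaD).ne'
  have h3 := (Real.rpow_pos_of_pos hu p.alphaD).ne'
  have h4 := (Real.rpow_pos_of_pos hv p.alphaD).ne'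
  have h5 := p.Pd_pos.ne'
  have h6 := p.AD_pos.ne'
  unfold signal
  rw [Real.div_rpow hu.le hr.le, Real.div_rpow hv.le hu.le, Real.rpow_neg hr.le,
    Real.rpow_neg hv.le, Real.rpow_neg hu.le]
  field_simp

/-- A positive lower bound of `1 - cos` on `[2 ^ (-α), 1]`. -/
noncomputable def Params.cosGap (p : Params) : ℝ := 1 - Real.cos (2 ^ (-p.alphaD))

theorem Params.cosGap_pos (p : Params) : 0 < p.cosGap := by
  have h1 : (0 : ℝ) < 2 ^ (-p.alphaD) := by positivity
  have h2 : (2 : ℝ) ^ (-p.alphaD) ≤ 1 :=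
    Real.rpow_le_one_of_one_le_of_nonpos one_le_two (neg_nonpos.2 p.alphaD_pos.le)
  have h3 : Real.cos (2 ^ (-p.alphaD)) < Real.cos 0 :=
    Real.cos_lt_cos_of_nonneg_of_le_pi le_rfl (h2.trans (by linarith [Real.pi_gt_three])) h1
  rw [Real.cos_zero] at h3
  exact sub_pos.2 h3

theorem re_one_sub_exp (x : ℝ) : (1 - Complex.exp (-(Complex.I * x))).re = 1 - Real.cos x := by
  rw [Complex.sub_re, Complex.one_re, show -(Complex.I * (x : ℂ)) = ((-x : ℝ) : ℂ) * Complex.I by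
    push_cast; ring, Complex.exp_ofReal_mul_I_re, Real.cos_neg]

/-- On the window `(u, 2u]` with `u = r |w| ^ (1/α)`, the phase has absolute value `(v/u) ^ (-α)`,
which lies in `[2 ^ (-α), 1]`, so `1 - cos` is at least `p.cosGap`. The window has length `u` and
weight at least `u`, which yields `u² = r² |w| ^ (2/α)`. The assumption `1 ≤ |w|` places it beyond
`r`. -/
theorem le_deviceExponent_re (p : Params) {w r : ℝ} (hr : 0 < r) (hw : 1 ≤ |w|) :
    p.cosGap * (r ^ 2 * |w| ^ (2 / p.alphaD)) ≤ (deviceExponent p (w / signal p r) r).re := by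
  have ha := p.alphaD_pos
  set s := w / signal p r with hs
  set u := r * |w| ^ (1 / p.alphaD) with hu
  have hw0 : 0 < |w| := one_pos.trans_le hw
  have hu0 : 0 < u := by positivity
  have hru : r ≤ u := le_mul_of_one_le_right hr.le (Real.one_le_rpow hw (by positivity))
  have hint := (integrableOn_one_sub_exp_signal p s).mono_set (Ioi_subset_Ioi hr.le)
  have hre := integral_re hint
  simp only [RCLike.re_to_complex] at hre
  have hval : ∀ v : ℝ, ((1 - Complex.exp (-(Complex.I * s * (signal p v : ℝ)))) * (v : ℂ)).re =
      (1 - Real.cos (s * signal p v)) * v := fun v => by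
    rw [Complex.re_mul_ofReal, ← re_one_sub_exp]
    push_cast
    rw [mul_assoc]
  unfold deviceExponent
  rw [← hre]
  have hint' := hint.re
  simp only [RCLike.re_to_complex] at hint'
  simp_rw [hval] at hint' ⊢
  change IntegrableOn _ (Ioi r) at hint'
  have hsub : Ioc u (2 * u) ⊆ Ioi r := fun v hv => hru.trans_lt hv.1
  have h1 : ∫ _ in Ioc u (2 * u), p.cosGap * u = p.cosGap * (r ^ 2 * |w| ^ (2 / p.alphaD)) := by
    rw [setIntegral_const, measureReal_def, Real.volume_Ioc, ENNReal.toReal_ofReal (by linarith),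
      smul_eq_mul, show 2 / p.alphaD = 1 / p.alphaD + 1 / p.alphaD by ring, Real.rpow_add hw0, hu]
    ring
  rw [← h1]
  refine le_trans (setIntegral_mono_on (integrableOn_const (by simp)) (hint'.mono_set hsub)
    measurableSet_Ioc fun v hv => ?_) (setIntegral_mono_set hint' ?_ hsub.eventuallyLE)
  · have hv0 : 0 < v := hu0.trans hv.1
    have hx : |s * signal p v| = (v / u) ^ (-p.alphaD) := by
      rw [← signal_scale p hr hu0 hv0, abs_mul, hs, abs_div, abs_of_pos (signal_pos p hr),
        abs_of_pos (signal_pos p hv0), hu, mul_div_cancel_left₀ _ hr.ne', ← Real.rpow_mul hw0.le,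
        one_div_mul_cancel ha.ne', Real.rpow_one]
    have hlow : (2 : ℝ) ^ (-p.alphaD) ≤ (v / u) ^ (-p.alphaD) :=
      Real.rpow_le_rpow_of_nonpos (by positivity) ((div_le_iff₀ hu0).2 hv.2)
        (neg_nonpos.2 ha.le)
    have hup : (v / u) ^ (-p.alphaD) ≤ 1 :=
      Real.rpow_le_one_of_one_le_of_nonpos ((one_le_div hu0).2 hv.1.le) (neg_nonpos.2 ha.le)
    have hcos : Real.cos ((v / u) ^ (-p.alphaD)) ≤ Real.cos (2 ^ (-p.alphaD)) :=
      Real.cos_le_cos_of_nonneg_of_le_pi (by positivity)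
        (hup.trans (by linarith [Real.pi_gt_three])) hlow
    rw [← Real.cos_abs (s * signal p v), hx]
    have hg := p.cosGap_pos
    have h2 : p.cosGap ≤ 1 - Real.cos ((v / u) ^ (-p.alphaD)) := by
      unfold Params.cosGap
      linarith
    exact mul_le_mul h2 hv.1.le hu0.le (hg.le.trans h2)
  · filter_upwards [ae_restrict_mem measurableSet_Ioi] with v (hv : r < v)
    exact mul_nonneg (sub_nonneg.2 (Real.cos_le_one _)) (hr.le.trans hv.le)

theorem norm_charD_le (p : Params) {w r : ℝ} (hr : 0 < r) (hw : 1 ≤ |w|) :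
    ‖charD p w r‖ ≤ Real.exp (-(p.rateD * p.cosGap * |w| ^ (2 / p.alphaD)) * r ^ 2) := by
  rw [charD_eq p w hr, Complex.norm_exp, Complex.neg_re, Complex.re_ofReal_mul]
  refine Real.exp_le_exp.2 ?_
  have := mul_le_mul_of_nonneg_left (le_deviceExponent_re p hr hw) p.rateD_pos.le
  linarith

variable {Ω : Type*} [MeasurableSpace Ω] {μ : Measure Ω} [IsProbabilityMeasure μ] {p : Params}
  {Y : ℕ → Ω → Plane} {xi : ℕ → Ω → ℝ} {C : ℕ → Ω → Plane} {M : ℕ → Ω → ℝ × ℝ}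
  {D : ℕ → Ω → Plane} {N : ℕ → Ω → ℝ × Bool}

theorem norm_charC_le (hY : IsMarkedPoisson Y xi (homogeneous p.lamB) (shadowLaw p.sigmaB) μ)
    (hC : IsMarkedPoisson C M (homogeneous p.lamB)
      ((shadowLaw p.sigmaB).prod (cellularDistLaw p Y xi μ)) μ) (w r : ℝ) :
    ‖charC p w r‖ ≤ 1 := by
  rw [← integral_exp_interfC hY hC w r]
  refine (norm_integral_le_integral_norm _).trans ?_
  simp only [norm_exp_neg_I_mul_mul]
  simp

theorem norm_charInvSinr_le_charD
    (hY : IsMarkedPoisson Y xi (homogeneous p.lamB) (shadowLaw p.sigmaB) μ)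
    (hC : IsMarkedPoisson C M (homogeneous p.lamB)
      ((shadowLaw p.sigmaB).prod (cellularDistLaw p Y xi μ)) μ) (w r : ℝ) :
    ‖charInvSinr p w r‖ ≤ ‖charD p w r‖ := by
  unfold charInvSinr
  rw [norm_mul, norm_mul, norm_exp_neg_I_mul_mul, mul_one]
  exact mul_le_of_le_one_left (norm_nonneg _) (norm_charC_le hY hC w r)

theorem norm_charD_le_one (p : Params) (w : ℝ) {r : ℝ} (hr : 0 < r) : ‖charD p w r‖ ≤ 1 := by
  rw [charD_eq p w hr, Complex.norm_exp, Complex.neg_re, Complex.re_ofReal_mul,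
    Real.exp_le_one_iff, neg_nonpos]
  exact mul_nonneg p.rateD_pos.le (deviceExponent_re_nonneg p _ hr.le)

/-- The bound of the conditional characteristic function. -/
noncomputable def charBound (p : Params) (w r : ℝ) : ℝ :=
  if |w| ≤ 1 then 1 else Real.exp (-(p.rateD * p.cosGap * |w| ^ (2 / p.alphaD)) * r ^ 2)

theorem charBound_nonneg (p : Params) (w r : ℝ) : 0 ≤ charBound p w r := by
  unfold charBound
  split_ifs <;> positivity

theorem measurable_charBound (p : Params) : Measurable (Function.uncurry (charBound p)) := by
  unfold charBound Function.uncurry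
  exact Measurable.ite (measurableSet_le (by fun_prop) measurable_const) measurable_const
    (by fun_prop)

theorem norm_charInvSinr_le
    (hY : IsMarkedPoisson Y xi (homogeneous p.lamB) (shadowLaw p.sigmaB) μ)
    (hC : IsMarkedPoisson C M (homogeneous p.lamB)
      ((shadowLaw p.sigmaB).prod (cellularDistLaw p Y xi μ)) μ) (w : ℝ) {r : ℝ} (hr : 0 < r) :
    ‖charInvSinr p w r‖ ≤ charBound p w r := by
  refine (norm_charInvSinr_le_charD hY hC w r).trans ?_
  unfold charBound
  split_ifs with h
  · exact norm_charD_le_one p w hr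
  · exact norm_charD_le p hr (not_le.1 h).le

theorem integrable_div_one_add_abs {f : ℝ → ℝ} (hf : Measurable f) {K s : ℝ} (hs : 0 < s)
    (h0 : ∀ w, 0 ≤ f w) (h1 : ∀ w, |w| ≤ 1 → f w ≤ K) (h2 : ∀ w, 1 < |w| → f w ≤ K * |w| ^ (-s)) :
    Integrable fun w => f w / (1 + |w|) := by
  have hK : 0 ≤ K := (h0 0).trans (h1 0 (by simp))
  have hg : Integrable fun w : ℝ => (1 + ‖w‖) ^ (-(s + 1)) :=
    integrable_one_add_norm (by simpa using hs)
  have hm : Measurable fun w => f w / (1 + |w|) := by fun_prop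
  refine (hg.const_mul (K * 2 ^ s)).mono' hm.aestronglyMeasurable (.of_forall fun w => ?_)
  have hpos : 0 < 1 + |w| := by positivity
  -- The quantity `(1 + |w|) / 2` is at most 1 when `|w| ≤ 1` and at most `|w|` otherwise. Its
  -- negative power therefore dominates both regimes.
  have hhalf : (2 : ℝ) ^ s * (1 + |w|) ^ (-s) = ((1 + |w|) / 2) ^ (-s) := by
    rw [Real.div_rpow hpos.le zero_le_two, Real.rpow_neg zero_le_two, div_inv_eq_mul, mul_comm]
  have hbound : f w ≤ K * (2 ^ s * (1 + |w|) ^ (-s)) := by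
    rw [hhalf]
    rcases le_or_gt |w| 1 with hw | hw
    · refine (h1 w hw).trans (le_mul_of_one_le_right hK ?_)
      exact Real.one_le_rpow_of_pos_of_le_one_of_nonpos (by positivity) (by linarith) (by linarith)
    · refine (h2 w hw).trans (mul_le_mul_of_nonneg_left ?_ hK)
      exact Real.rpow_le_rpow_of_nonpos (by positivity) (by linarith) (by linarith)
  rw [Real.norm_of_nonneg (div_nonneg (h0 w) hpos.le), Real.norm_eq_abs, neg_add', ← neg_add',
    neg_add, Real.rpow_add hpos, Real.rpow_neg_one, div_eq_mul_inv]
  calc _ ≤ K * (2 ^ s * (1 + |w|) ^ (-s)) * (1 + |w|)⁻¹ := by gcongr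
    _ = _ := by ring

/-- From `exp (-y) ≤ 1/y`: for fixed `r`, a power decay is all that integrability requires. -/
theorem exp_neg_mul_sq_le {a r : ℝ} (ha : 0 < a) (hr : 0 < r) (s : ℝ) :
    ∃ K, ∀ x : ℝ, 0 < x → Real.exp (-(a * x ^ s) * r ^ 2) ≤ K * x ^ (-s) := by
  refine ⟨(a * r ^ 2)⁻¹, fun x hx => ?_⟩
  have hy : 0 < a * x ^ s * r ^ 2 := by positivity
  have h1 := Real.add_one_le_exp (a * x ^ s * r ^ 2)
  rw [neg_mul, Real.exp_neg, Real.rpow_neg hx.le, ← mul_inv]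
  refine inv_anti₀ (by positivity) ?_
  linarith

theorem integrable_charBound_div (p : Params) {r : ℝ} (hr : 0 < r) :
    Integrable fun w => charBound p w r / (1 + |w|) := by
  obtain ⟨K, hK⟩ := exp_neg_mul_sq_le (mul_pos p.rateD_pos p.cosGap_pos) hr
    (2 / p.alphaD)
  refine integrable_div_one_add_abs (K := max 1 K) (s := 2 / p.alphaD)
    ((measurable_charBound p).comp measurable_prodMk_right) (div_pos two_pos p.alphaD_pos)
    (fun w => charBound_nonneg p w r) (fun w hw => ?_) (fun w hw => ?_)
  · unfold charBound
    rw [if_pos hw]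
    exact le_max_left _ _
  · unfold charBound
    rw [if_neg hw.not_ge]
    refine (hK |w| (one_pos.trans hw)).trans ?_
    gcongr
    exact le_max_right _ _

theorem integral_rayleigh {E : Type*} [NormedAddCommGroup E] [NormedSpace ℝ E] {c : ℝ}
    (hc : 0 < c) (f : ℝ → E) : ∫ r, f r ∂(rayleigh c) =
      ∫ r in Ioi 0, (c * r * Real.exp (-(c * r ^ 2 / 2))) • f r := by
  unfold rayleigh
  rw [integral_withDensity_eq_integral_toReal_smul (by fun_prop) (by simp)]
  refine setIntegral_congr_fun measurableSet_Ioi fun r (hr : 0 < r) => ?_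
  rw [ENNReal.toReal_ofReal (by positivity)]

theorem integrable_rayleigh_iff {E : Type*} [NormedAddCommGroup E] [NormedSpace ℝ E] {c : ℝ}
    (hc : 0 < c) {f : ℝ → E} : Integrable f (rayleigh c) ↔
      IntegrableOn (fun r => (c * r * Real.exp (-(c * r ^ 2 / 2))) • f r) (Ioi 0) := by
  unfold rayleigh
  rw [integrable_withDensity_iff_integrable_smul' (by fun_prop) (by simp)]
  refine integrable_congr ?_
  filter_upwards [ae_restrict_mem measurableSet_Ioi] with r (hr : 0 < r)
  rw [ENNReal.toReal_ofReal (by positivity)]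

/-- Dropping the exponential of the Rayleigh density leaves a multiple of the Rayleigh density of
parameter `2b`, whose total mass is 1. -/
theorem integral_rayleigh_exp_le {c b : ℝ} (hc : 0 < c) (hb : 0 < b) :
    ∫ r, Real.exp (-b * r ^ 2) ∂(rayleigh c) ≤ c / (2 * b) := by
  have := isProbabilityMeasure_rayleigh hc
  have := isProbabilityMeasure_rayleigh (show 0 < 2 * b by positivity)
  have h1 : ∫ _, (1 : ℝ) ∂(rayleigh (2 * b)) = 1 := by simp
  rw [integral_rayleigh (by positivity)] at h1
  have h2 : IntegrableOn (fun r => (2 * b * r * Real.exp (-(2 * b * r ^ 2 / 2))) • (1 : ℝ))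
      (Ioi 0) := (integrable_rayleigh_iff (by positivity)).1 (integrable_const 1)
  rw [integral_rayleigh hc]
  calc _ ≤ ∫ r in Ioi 0, c / (2 * b) * ((2 * b * r * Real.exp (-(2 * b * r ^ 2 / 2))) • (1 : ℝ)) := by
        refine integral_mono_of_nonneg ?_ (h2.const_mul _) ?_
        · filter_upwards [ae_restrict_mem measurableSet_Ioi] with r (hr : 0 < r)
          change 0 ≤ _ * _
          positivity
        · filter_upwards [ae_restrict_mem measurableSet_Ioi] with r (hr : 0 < r)
          have h3 : Real.exp (-(c * r ^ 2 / 2)) ≤ 1 := Real.exp_le_one_iff.2 (by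
            have : 0 ≤ c * r ^ 2 / 2 := by positivity
            linarith)
          have h4 : c / (2 * b) * ((2 * b * r * Real.exp (-(2 * b * r ^ 2 / 2))) • (1 : ℝ)) =
              c * r * 1 * Real.exp (-b * r ^ 2) := by
            rw [smul_eq_mul, show -(2 * b * r ^ 2 / 2) = -b * r ^ 2 by ring]
            field_simp
          rw [h4, smul_eq_mul]
          gcongr
    _ = _ := by rw [integral_const_mul, h1, mul_one]

theorem charBound_le_one (p : Params) (w r : ℝ) : charBound p w r ≤ 1 := by
  unfold charBound
  split_ifs
  · exact le_rfl
  · have h1 := p.rateD_pos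
    have h2 := p.cosGap_pos
    have : 0 ≤ p.rateD * p.cosGap * |w| ^ (2 / p.alphaD) * r ^ 2 := by positivity
    exact Real.exp_le_one_iff.2 (by linarith)

theorem integrable_charBound (p : Params) (w : ℝ) :
    Integrable (charBound p w) (rayleigh p.rateD) := by
  have := isProbabilityMeasure_rayleigh p.rateD_pos
  refine Integrable.of_bound
    ((measurable_charBound p).comp measurable_prodMk_left).aestronglyMeasurable 1
    (.of_forall fun r => ?_)
  rw [Real.norm_of_nonneg (charBound_nonneg p w r)]
  exact charBound_le_one p w r

/-- The bound at a fixed `r` degenerates as `r → 0`. The linear vanishing of the Rayleigh density at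
0 compensates for this and leaves `|w| ^ (-2/α_D)` after averaging. -/
theorem integrable_integral_charBound_div (p : Params) :
    Integrable fun w => (∫ r, charBound p w r ∂(rayleigh p.rateD)) / (1 + |w|) := by
  have := isProbabilityMeasure_rayleigh p.rateD_pos
  have hc := p.rateD_pos
  have hg := p.cosGap_pos
  have hs := div_pos two_pos p.alphaD_pos
  refine integrable_div_one_add_abs (K := max 1 (2 * p.cosGap)⁻¹) (s := 2 / p.alphaD) ?_ hs
    (fun w => integral_nonneg fun r => charBound_nonneg p w r) (fun w hw => ?_) (fun w hw => ?_)
  · exact (measurable_charBound p).stronglyMeasurable.integral_prod_right'.measurable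
  · refine (integral_mono (integrable_charBound p w) (integrable_const 1)
      (charBound_le_one p w)).trans ?_
    simp
  · have hw0 : 0 < |w| := one_pos.trans hw
    unfold charBound
    simp only [if_neg hw.not_ge]
    refine (integral_rayleigh_exp_le hc (by positivity)).trans ?_
    calc _ = (2 * p.cosGap)⁻¹ * |w| ^ (-(2 / p.alphaD)) := by
          rw [Real.rpow_neg hw0.le]
          field_simp
      _ ≤ _ := by
          gcongr
          exact le_max_right _ _

end Decay

/-! ### The density of the link distance and the coverage probability. -/

section Coverage

variable {Ω : Type*} [MeasurableSpace Ω] {μ : Measure Ω} [IsProbabilityMeasure μ] {p : Params}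
  {Y : ℕ → Ω → Plane} {xi : ℕ → Ω → ℝ} {C : ℕ → Ω → Plane} {M : ℕ → Ω → ℝ × ℝ}
  {D : ℕ → Ω → Plane} {N : ℕ → Ω → ℝ × Bool}

theorem hasDerivAt_cdf_linkDist
    (hD : IsMarkedPoisson D N (homogeneous ((1 - qCellular p) * p.lamU))
      ((shadowLaw p.sigmaD).prod fairCoin) μ) {r : ℝ} (hr : 0 < r) :
    HasDerivAt (fun x => μ.real {ω | linkDist p D N ω ≤ x})
      (p.rateD * r * Real.exp (-(p.rateD * r ^ 2 / 2))) r := by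
  have hR := measurable_linkDist (p := p) hD.poisson.measurable hD.measurable_mark
  refine ((hasDerivAt_exp_neg_sq p.rateD r).const_add 1).congr_of_eventuallyEq ?_
  filter_upwards [Ioi_mem_nhds hr] with x (hx : 0 < x)
  have h1 : {ω | linkDist p D N ω ≤ x} = (linkDist p D N ⁻¹' Ioi x)ᶜ := by
    ext ω
    simp
  rw [h1, probReal_compl_eq_one_sub (hR measurableSet_Ioi), measureReal_def,
    ← Measure.map_apply hR measurableSet_Ioi, map_linkDist hD,
    (lintegral_rayleigh_Ioi p.rateD_pos hx.le).2, ENNReal.toReal_ofReal (Real.exp_pos _).le,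
    sub_eq_add_neg]

theorem linkDensity_eq
    (hD : IsMarkedPoisson D N (homogeneous ((1 - qCellular p) * p.lamU))
      ((shadowLaw p.sigmaD).prod fairCoin) μ) {r : ℝ} (hr : 0 < r) :
    linkDensity p D N μ r = p.rateD * r * Real.exp (-(p.rateD * r ^ 2 / 2)) :=
  (hasDerivAt_cdf_linkDist hD hr).deriv

theorem map_linkDist_eq_withDensity
    (hD : IsMarkedPoisson D N (homogeneous ((1 - qCellular p) * p.lamU))
      ((shadowLaw p.sigmaD).prod fairCoin) μ) :
    μ.map (linkDist p D N) = (volume.restrict (Ioi (0 : ℝ))).withDensity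
      (fun r => ENNReal.ofReal (linkDensity p D N μ r)) := by
  rw [map_linkDist hD]
  unfold rayleigh
  refine withDensity_congr_ae ?_
  filter_upwards [ae_restrict_mem measurableSet_Ioi] with r hr
  rw [linkDensity_eq hD hr]

theorem inversionIntegrand_eq (p : Params) (T r w : ℝ) :
    inversionIntegrand p T r w = intervalKernel (1 / T) w * charInvSinr p w r := by
  unfold inversionIntegrand intervalKernel
  congr 4
  push_cast
  ring

theorem norm_inversionIntegrand_le
    (hY : IsMarkedPoisson Y xi (homogeneous p.lamB) (shadowLaw p.sigmaB) μ)
    (hC : IsMarkedPoisson C M (homogeneous p.lamB)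
      ((shadowLaw p.sigmaB).prod (cellularDistLaw p Y xi μ)) μ) (T w : ℝ) {r : ℝ} (hr : 0 < r) :
    ‖inversionIntegrand p T r w‖ ≤ (|1 / T| + 1) * (charBound p w r / (1 + |w|)) := by
  rw [inversionIntegrand_eq, norm_mul]
  calc _ ≤ (|1 / T| + 1) / (1 + |w|) * charBound p w r := by
        gcongr
        · exact norm_intervalKernel_le _ _
        · exact norm_charInvSinr_le hY hC w hr
    _ = _ := by ring

theorem exists_measurable_inversionIntegrand
    (hY : IsMarkedPoisson Y xi (homogeneous p.lamB) (shadowLaw p.sigmaB) μ)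
    (hC : IsMarkedPoisson C M (homogeneous p.lamB)
      ((shadowLaw p.sigmaB).prod (cellularDistLaw p Y xi μ)) μ)
    (hD : IsMarkedPoisson D N (homogeneous ((1 - qCellular p) * p.lamU))
      ((shadowLaw p.sigmaD).prod fairCoin) μ)
    (hCD : IndepFun (fun ω i => (C i ω, M i ω)) (fun ω j => (D j ω, N j ω)) μ) (T : ℝ) :
    ∃ G : ℝ × ℝ → ℂ, Measurable G ∧ ∀ r w, 0 < r → inversionIntegrand p T r w = G (r, w) := by
  obtain ⟨F, hF, hFeq⟩ := exists_measurable_charInvSinr hY hC hD hCD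
  refine ⟨fun x => intervalKernel (1 / T) x.2 * F x,
    ((measurable_intervalKernel _).comp measurable_snd).mul hF, fun r w hr => ?_⟩
  rw [inversionIntegrand_eq, hFeq r w hr]

theorem integrable_inversionIntegrand
    (hY : IsMarkedPoisson Y xi (homogeneous p.lamB) (shadowLaw p.sigmaB) μ)
    (hC : IsMarkedPoisson C M (homogeneous p.lamB)
      ((shadowLaw p.sigmaB).prod (cellularDistLaw p Y xi μ)) μ)
    (hD : IsMarkedPoisson D N (homogeneous ((1 - qCellular p) * p.lamU))
      ((shadowLaw p.sigmaD).prod fairCoin) μ)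
    (hCD : IndepFun (fun ω i => (C i ω, M i ω)) (fun ω j => (D j ω, N j ω)) μ) (T : ℝ) {r : ℝ}
    (hr : 0 < r) : Integrable (inversionIntegrand p T r) := by
  obtain ⟨G, hG, hGeq⟩ := exists_measurable_inversionIntegrand hY hC hD hCD T
  refine ((integrable_charBound_div p hr).const_mul (|1 / T| + 1)).mono' ?_
    (.of_forall fun w => norm_inversionIntegrand_le hY hC T w hr)
  rw [funext fun w => hGeq r w hr]
  exact (hG.comp measurable_prodMk_left).aestronglyMeasurable

/-- This is the integrable majorant that justifies exchanging the frequency and the distance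
integrals. -/
theorem integrable_prod_charBound (p : Params) :
    Integrable (fun z : ℝ × ℝ => charBound p z.2 z.1 / (1 + |z.2|))
      ((rayleigh p.rateD).prod volume) := by
  have := isProbabilityMeasure_rayleigh p.rateD_pos
  have hm : Measurable fun z : ℝ × ℝ => charBound p z.2 z.1 / (1 + |z.2|) := by
    have h1 : Measurable fun z : ℝ × ℝ => Function.uncurry (charBound p) (z.2, z.1) :=
      (measurable_charBound p).comp (by fun_prop)
    exact h1.div (by fun_prop)
  rw [integrable_prod_iff' hm.aestronglyMeasurable]
  refine ⟨.of_forall fun w => (integrable_charBound p w).div_const (1 + |w|), ?_⟩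
  refine (integrable_integral_charBound_div p).congr (.of_forall fun w => ?_)
  have h2 : ∀ r, ‖charBound p w r / (1 + |w|)‖ = charBound p w r / (1 + |w|) := fun r =>
    Real.norm_of_nonneg (div_nonneg (charBound_nonneg p w r) (by positivity))
  simp only [h2, integral_div]

theorem integrable_prod_inversionIntegrand
    (hY : IsMarkedPoisson Y xi (homogeneous p.lamB) (shadowLaw p.sigmaB) μ)
    (hC : IsMarkedPoisson C M (homogeneous p.lamB)
      ((shadowLaw p.sigmaB).prod (cellularDistLaw p Y xi μ)) μ)
    (hD : IsMarkedPoisson D N (homogeneous ((1 - qCellular p) * p.lamU))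
      ((shadowLaw p.sigmaD).prod fairCoin) μ)
    (hCD : IndepFun (fun ω i => (C i ω, M i ω)) (fun ω j => (D j ω, N j ω)) μ) (T : ℝ) :
    Integrable (Function.uncurry (inversionIntegrand p T)) ((rayleigh p.rateD).prod volume) := by
  have := isProbabilityMeasure_rayleigh p.rateD_pos
  obtain ⟨G, hG, hGeq⟩ := exists_measurable_inversionIntegrand hY hC hD hCD T
  have hpos : ∀ᵐ z ∂((rayleigh p.rateD).prod (volume : Measure ℝ)), 0 < z.1 :=
    Measure.quasiMeasurePreserving_fst.ae (ae_pos_rayleigh p.rateD)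
  refine ((integrable_prod_charBound p).const_mul (|1 / T| + 1)).mono'
    ⟨G, hG.stronglyMeasurable, hpos.mono fun z hz => hGeq z.1 z.2 hz⟩
    (hpos.mono fun z hz => norm_inversionIntegrand_le hY hC T z.2 hz)

/-- After the exchange, the inner average over `r` is the unconditional characteristic function of
`1/SINR`, to which the inversion formula applies. -/
theorem integral_inversionIntegrand
    (hY : IsMarkedPoisson Y xi (homogeneous p.lamB) (shadowLaw p.sigmaB) μ)
    (hC : IsMarkedPoisson C M (homogeneous p.lamB)
      ((shadowLaw p.sigmaB).prod (cellularDistLaw p Y xi μ)) μ)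
    (hD : IsMarkedPoisson D N (homogeneous ((1 - qCellular p) * p.lamU))
      ((shadowLaw p.sigmaD).prod fairCoin) μ)
    (hCD : IndepFun (fun ω i => (C i ω, M i ω)) (fun ω j => (D j ω, N j ω)) μ) {T : ℝ}
    (hT : 0 < T) :
    ∫ r, (∫ w, inversionIntegrand p T r w) ∂(rayleigh p.rateD) =
      (μ.real {ω | ENNReal.ofReal T < sinr p C M D N ω} : ℂ) := by
  have := isProbabilityMeasure_rayleigh p.rateD_pos
  have hsinr := measurable_sinr (p := p) hC.poisson.measurable hC.measurable_mark
    hD.poisson.measurable hD.measurable_mark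
  have hX : Measurable fun ω => (sinr p C M D N ω)⁻¹.toReal := hsinr.inv.ennreal_toReal
  set Φ : ℝ → ℂ := fun w => ∫ r, charInvSinr p w r ∂(rayleigh p.rateD) with hΦdef
  have hΦ : ∀ w, Φ w =
      ∫ ω, Complex.exp (-(Complex.I * w * ((sinr p C M D N ω)⁻¹.toReal : ℝ))) ∂μ := fun w => by
    have := setIntegral_exp_inv_sinr hY hC hD hCD w MeasurableSet.univ
    simpa using this.symm
  have hint : Integrable fun w => ‖Φ w‖ / (1 + |w|) := by
    have hm : Measurable fun w => ‖Φ w‖ / (1 + |w|) := by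
      have := (continuous_charFunction hX hΦ).measurable
      fun_prop
    refine (integrable_integral_charBound_div p).mono' hm.aestronglyMeasurable
      (.of_forall fun w => ?_)
    rw [Real.norm_of_nonneg (by positivity)]
    gcongr
    refine norm_integral_le_of_norm_le (integrable_charBound p w) ?_
    exact (ae_pos_rayleigh p.rateD).mono fun r hr => norm_charInvSinr_le hY hC w hr
  have hspec := ae_sinr_spec hY hC hD
  have h0 : ∀ᵐ ω ∂μ, (sinr p C M D N ω)⁻¹.toReal ≠ 0 := hspec.mono fun ω h =>
    ENNReal.toReal_ne_zero.2 ⟨ENNReal.inv_ne_zero.2 h.2.1, ENNReal.inv_ne_top.2 h.1⟩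
  -- The strict inequality `SINR > T` corresponds to the open interval in the inversion formula, so
  -- continuity of the law of the SINR never enters.
  have hevent : {ω | ENNReal.ofReal T < sinr p C M D N ω} =ᵐ[μ]
      {ω | (sinr p C M D N ω)⁻¹.toReal ∈ Ioo 0 (1 / T)} := by
    filter_upwards [hspec, h0] with ω h h0
    refine propext ?_
    change ENNReal.ofReal T < sinr p C M D N ω ↔
      0 < (sinr p C M D N ω)⁻¹.toReal ∧ (sinr p C M D N ω)⁻¹.toReal < 1 / T
    rw [and_iff_right (lt_of_le_of_ne ENNReal.toReal_nonneg h0.symm), ENNReal.toReal_inv,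
      ← one_div, one_div_lt_one_div (ENNReal.toReal_pos h.1 h.2.1) hT,
      ENNReal.ofReal_lt_iff_lt_toReal hT.le h.2.1]
  rw [integral_integral_swap (integrable_prod_inversionIntegrand hY hC hD hCD T),
    measureReal_congr hevent, ← integral_inversion hX hΦ hint h0 (one_div_pos.2 hT)]
  refine integral_congr_ae (.of_forall fun w => ?_)
  simp_rw [inversionIntegrand_eq]
  rw [integral_const_mul]

end Coverage

end D2D

theorem lemma5 {Ω : Type*} [MeasurableSpace Ω] (μ : MeasureTheory.Measure Ω)
    [IsProbabilityMeasure μ] (p : D2D.Params)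
    -- the base stations, with their shadowings towards a typical UE
    (Y : ℕ → Ω → D2D.Plane) (xi : ℕ → Ω → ℝ)
    (hY : D2D.IsMarkedPoisson Y xi (D2D.homogeneous p.lamB) (D2D.shadowLaw p.sigmaB) μ)
    -- the active cellular UEs
    (C : ℕ → Ω → D2D.Plane) (M : ℕ → Ω → ℝ × ℝ)
    (hC : D2D.IsMarkedPoisson C M (D2D.homogeneous p.lamB)
      ((D2D.shadowLaw p.sigmaB).prod (D2D.cellularDistLaw p Y xi μ)) μ)
    -- the D2D UEs
    (D : ℕ → Ω → D2D.Plane) (N : ℕ → Ω → ℝ × Bool)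
    (hD : D2D.IsMarkedPoisson D N (D2D.homogeneous (D2D.lamD2D p Y xi μ))
      ((D2D.shadowLaw p.sigmaD).prod D2D.fairCoin) μ)
    (hCD : IndepFun (fun ω i => (C i ω, M i ω)) (fun ω j => (D j ω, N j ω)) μ) :
    -- the distance of the D2D link has the derivative of its distribution function as density
    (∀ r : ℝ, 0 < r → DifferentiableAt ℝ (fun x => μ.real {ω | D2D.linkDist p D N ω ≤ x}) r) ∧
    μ.map (D2D.linkDist p D N) = (volume.restrict (Ioi (0 : ℝ))).withDensity
      (fun r => ENNReal.ofReal (D2D.linkDensity p D N μ r)) ∧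
    -- the conditional characteristic function of 1 / SINR given the distance of the D2D link
    (∀ w : ℝ,
      μ[fun ω => Complex.exp (-(Complex.I * w * ((D2D.sinr p C M D N ω)⁻¹.toReal : ℝ))) |
        MeasurableSpace.comap (D2D.linkDist p D N) inferInstance]
      =ᵐ[μ] fun ω => D2D.charInvSinr p w (D2D.linkDist p D N ω)) ∧
    -- the coverage probability
    (∀ T : ℝ, 0 < T →
      (∀ r : ℝ, 0 < r → Integrable (D2D.inversionIntegrand p T r)) ∧
      IntegrableOn (fun r : ℝ =>
        (∫ w : ℝ, D2D.inversionIntegrand p T r w) * (D2D.linkDensity p D N μ r : ℂ)) (Ioi 0) ∧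
      ((μ.real {ω | ENNReal.ofReal T < D2D.sinr p C M D N ω} : ℝ) : ℂ) =
        ∫ r in Ioi (0 : ℝ),
          (∫ w : ℝ, D2D.inversionIntegrand p T r w) * (D2D.linkDensity p D N μ r : ℂ)) := by
  -- The auxiliary results use the intensity with the closed form of `q`; the identity for mode
  -- selection makes the hypothesis match.
  rw [D2D.lamD2D_eq hY] at hD
  refine ⟨fun r hr => (D2D.hasDerivAt_cdf_linkDist hD hr).differentiableAt,
    D2D.map_linkDist_eq_withDensity hD, D2D.condExp_exp_inv_sinr hY hC hD hCD, fun T hT =>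
    ⟨fun r hr => D2D.integrable_inversionIntegrand hY hC hD hCD T hr, ?_, ?_⟩⟩
  · have := D2D.isProbabilityMeasure_rayleigh p.rateD_pos
    have h := (D2D.integrable_prod_inversionIntegrand hY hC hD hCD T).integral_prod_left
    rw [D2D.integrable_rayleigh_iff p.rateD_pos] at h
    refine h.congr_fun (fun r hr => ?_) measurableSet_Ioi
    beta_reduce
    rw [D2D.linkDensity_eq hD hr, Complex.real_smul, mul_comm]
    rfl
  · rw [← D2D.integral_inversionIntegrand hY hC hD hCD hT, D2D.integral_rayleigh p.rateD_pos]
    refine setIntegral_congr_fun measurableSet_Ioi fun r hr => ?_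
    rw [D2D.linkDensity_eq hD hr, Complex.real_smul, mul_comm]
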